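/- Let $\Gamma$ be a divisible (linearly) ordered abelian group and let $A\le\Gamma$ be a subgroup (every ordered abelian group $A$ arises in this way). For $n\ge 0$ let $\Gamma_A^{\mathrm{bdd}}[n]$ be the category whose objects are the subsets $X\subseteq\Gamma^n$ that are defined by a finite Boolean combination of linear equalities and inequalities with coefficients in $\mathbb Z$ and parameters in $A$, and that are bounded, i.e. contained in $[-\gamma,\gamma]^n$ for some $\gamma\in\Gamma$. A morphism $X\to Y$ is a bijection $f$ for which there is a finite partition of $X$ into definable pieces $X_i$ (defined as above), matrices $M_i\in GL_n(\mathbb Z)$ and $a_i\in A^n$ with $f(x)=M_ix+a_i$ for $x\in X_i$. Let $K_+[n]$ be the Grothendieck semigroup of this category: it is generated by the classes $[X]_n$ of objects, subject to the relations $[X_1]_n+[X_2]_n=[Z]_n$ whenever $Z=Z_1\sqcup Z_2$ with objects $Z_i$ isomorphic to $X_i$; its neutral element is $[\emptyset]_n$. Then $K_+=\bigoplus_{n\ge0}K_+[n]$ is a graded commutative semiring with $[X]_n[Y]_m=[X\times Y]_{n+m}$. Write $[0]_1\in K_+[1]$ for the class of $\{0\}\subseteq\Gamma$. Let $K_+^{df}=(K_+[[0]_1^{-1}])_0$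 be the degree-$0$ part of the $\mathbb Z$-graded localization of $K_+$ at $[0]_1$, let $K^{df}(\Gamma_A^{\mathrm{bdd}})$ be the ring obtained from $K_+^{df}$ by introducing additive inverses, and let $K^{df}_{\mathbb Q}(\Gamma_A^{\mathrm{bdd}})=\mathbb Q\otimes K^{df}(\Gamma_A^{\mathrm{bdd}})$. For $a\in A$ let $\iota(a)=[0,a)_1/[0]_1$ (the class of the half-open interval $[0,a)$) if $a>0$, $\iota(0)=0$, and $\iota(a)=-\iota(-a)$ if $a<0$. Then $\iota$ is additive. Let $T_A=\mathrm{Sym}_{\mathbb Q}(\mathbb Q\otimes A)$ be the symmetric algebra of the $\mathbb Q$-vector space $\mathbb Q\otimes A$, and let $\phi_A:T_A\to K^{df}_{\mathbb Q}(\Gamma_A^{\mathrm{bdd}})$ be the homomorphism of $\mathbb Q$-algebras with $\phi_A(1\otimes a)=\iota(a)$ for all $a\in A$. **Lemma.** The homomorphism $\phi_A$ is injective. If $A$ is divisible, then $\phi_A$ is an isomorphism. -/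

import Mathlib

open scoped TensorProduct

set_option linter.unusedSectionVars false

noncomputable section

namespace BoundedPolytopes

/-! ## Bounded definable sets over an ordered abelian group -/

section Objects

variable {Γ : Type*} [AddCommGroup Γ] [LinearOrder Γ] [IsOrderedAddMonoid Γ]

/-- Subsets of `Γ^n` defined by linear equalities and inequalities with integer coefficients and
parameters in `A`: the Boolean algebra of sets generated by the open half spaces
`∑ i, c i • x i < a` with `c ∈ ℤ^n` and `a ∈ A`. (The condition `u ≤ a` is the negation of
`- u < - a`, and `u = a` is `u ≤ a` together with the negation of `u < a`.) -/
inductive IsDefinable (A : AddSubgroup Γ) {n : ℕ} : Set (Fin n → Γ) → Prop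
  | lt (c : Fin n → ℤ) (a : A) : IsDefinable A {x | ∑ i, c i • x i < (a : Γ)}
  | compl (X : Set (Fin n → Γ)) : IsDefinable A X → IsDefinable A Xᶜ
  | inter (X Y : Set (Fin n → Γ)) : IsDefinable A X → IsDefinable A Y → IsDefinable A (X ∩ Y)

/-- A subset of `Γ^n` is bounded if it lies in a box `[-γ, γ]^n` with `γ ∈ Γ`. -/
def IsBounded {n : ℕ} (X : Set (Fin n → Γ)) : Prop :=
  ∃ γ : Γ, ∀ x ∈ X, ∀ i, -γ ≤ x i ∧ x i ≤ γ

/-- Objects of the category of bounded definable subsets of `Γ^n` over `A`. -/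
structure Obj (A : AddSubgroup Γ) (n : ℕ) where
  carrier : Set (Fin n → Γ)
  definable : IsDefinable A carrier
  bounded : IsBounded carrier

/-- Isomorphism of `X, Y ⊆ Γ^n` over `A`: there is a bijection `f : X → Y` and a finite partition
of `X` into definable pieces such that on each piece `f` has the form `x ↦ M x + a` with
`M ∈ GL_n(ℤ)` and `a ∈ A^n`. -/
def Iso (A : AddSubgroup Γ) {n : ℕ} (X Y : Set (Fin n → Γ)) : Prop :=
  ∃ f : (Fin n → Γ) → (Fin n → Γ), Set.BijOn f X Y ∧
    ∃ (κ : Type) (_ : Finite κ) (P : κ → Set (Fin n → Γ)),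
      (∀ k, IsDefinable A (P k)) ∧ Pairwise (fun k l => Disjoint (P k) (P l)) ∧
      (⋃ k, P k) = X ∧
      ∀ k, ∃ (M : Matrix.GeneralLinearGroup (Fin n) ℤ) (a : Fin n → A),
        ∀ x ∈ P k, ∀ j, f x j = (∑ l, M.1 j l • x l) + (a j : Γ)

variable {A : AddSubgroup Γ}

namespace IsDefinable

theorem empty {n : ℕ} : IsDefinable A (∅ : Set (Fin n → Γ)) := by
  have := IsDefinable.lt (A := A) (n := n) 0 0
  simpa using this

theorem univ {n : ℕ} : IsDefinable A (Set.univ : Set (Fin n → Γ)) := by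
  simpa using (IsDefinable.empty (A := A) (n := n)).compl

theorem le {n : ℕ} (c : Fin n → ℤ) (a : A) : IsDefinable A {x | ∑ i, c i • x i ≤ (a : Γ)} := by
  have := (IsDefinable.lt (-c) (-a)).compl
  convert this using 1
  ext x
  simp

theorem ge {n : ℕ} (c : Fin n → ℤ) (a : A) : IsDefinable A {x | (a : Γ) ≤ ∑ i, c i • x i} := by
  have := (IsDefinable.lt c a).compl
  convert this using 1
  ext x
  simp

/-- Definability is stable under pulling back along coordinate maps. -/
theorem pullback {n m : ℕ} (σ : Fin n → Fin m) {X : Set (Fin n → Γ)} (hX : IsDefinable A X) :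
    IsDefinable A {z : Fin m → Γ | z ∘ σ ∈ X} := by
  induction hX with
  | lt c a =>
    have := IsDefinable.lt (A := A) (fun j => ∑ i with σ i = j, c i) a
    convert this using 1
    ext z
    have : ∑ i, c i • z (σ i) = ∑ j, (∑ i with σ i = j, c i) • z j := by
      rw [← Finset.sum_fiberwise Finset.univ σ]
      refine Finset.sum_congr rfl fun j _ => ?_
      rw [Finset.sum_smul]
      refine Finset.sum_congr rfl fun i hi => ?_
      rw [(Finset.mem_filter.1 hi).2]
    simp [this]
  | compl X _ ih => exact ih.compl
  | inter X Y _ _ ihX ihY => exact ihX.inter _ _ ihY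

end IsDefinable

namespace Iso

theorem refl {n : ℕ} {X : Set (Fin n → Γ)} (hX : IsDefinable A X) : Iso A X X := by
  refine ⟨id, Set.bijOn_id X, Unit, inferInstance, fun _ => X, fun _ => hX,
    fun k l h => (h rfl).elim, Set.iUnion_const _, fun _ => ⟨1, 0, fun x _ j => ?_⟩⟩
  simp [Matrix.one_apply]

/-- Products of isomorphisms are isomorphisms. -/
theorem prod {n m : ℕ} {X X' : Set (Fin n → Γ)} {Y Y' : Set (Fin m → Γ)}
    (h : Iso A X X') (h' : Iso A Y Y') :
    Iso A {z : Fin (n + m) → Γ | z ∘ Fin.castAdd m ∈ X ∧ z ∘ Fin.natAdd n ∈ Y}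
      {z : Fin (n + m) → Γ | z ∘ Fin.castAdd m ∈ X' ∧ z ∘ Fin.natAdd n ∈ Y'} := by
  obtain ⟨f, hf, κ, _, P, hPd, hPp, hPX, hPf⟩ := h
  obtain ⟨g, hg, κ', _, Q, hQd, hQp, hQY, hQg⟩ := h'
  have e1 : ∀ (u : Fin n → Γ) (v : Fin m → Γ), Fin.append u v ∘ Fin.castAdd m = u := by
    intro u v; ext i; simp
  have e2 : ∀ (u : Fin n → Γ) (v : Fin m → Γ), Fin.append u v ∘ Fin.natAdd n = v := by
    intro u v; ext i; simp
  have e3 : ∀ z : Fin (n + m) → Γ,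
      Fin.append (z ∘ Fin.castAdd m) (z ∘ Fin.natAdd n) = z := by
    intro z; ext i
    refine Fin.addCases (fun i => ?_) (fun i => ?_) i <;> simp
  refine ⟨fun z => Fin.append (f (z ∘ Fin.castAdd m)) (g (z ∘ Fin.natAdd n)), ⟨?_, ?_, ?_⟩,
    κ × κ', inferInstance,
    fun k => {z | z ∘ Fin.castAdd m ∈ P k.1} ∩ {z | z ∘ Fin.natAdd n ∈ Q k.2}, ?_, ?_, ?_, ?_⟩
  · rintro z ⟨h1, h2⟩
    exact ⟨by rw [e1]; exact hf.mapsTo h1, by rw [e2]; exact hg.mapsTo h2⟩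
  · rintro z ⟨h1, h2⟩ w ⟨h3, h4⟩ hzw
    have a1 := congrArg (fun t => t ∘ Fin.castAdd m) hzw
    have a2 := congrArg (fun t => t ∘ Fin.natAdd n) hzw
    simp only [e1, e2] at a1 a2
    rw [← e3 z, ← e3 w, hf.injOn h1 h3 a1, hg.injOn h2 h4 a2]
  · rintro z ⟨h1, h2⟩
    obtain ⟨u, hu, hu'⟩ := hf.surjOn h1
    obtain ⟨v, hv, hv'⟩ := hg.surjOn h2
    refine ⟨Fin.append u v, ⟨by rwa [e1], by rwa [e2]⟩, ?_⟩
    simp only [e1, e2, hu', hv', e3]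
  · exact fun k => ((hPd k.1).pullback _).inter _ _ ((hQd k.2).pullback _)
  · rintro ⟨k, k'⟩ ⟨l, l'⟩ hkl
    rw [Set.disjoint_left]
    rintro z ⟨h1, h2⟩ ⟨h3, h4⟩
    by_cases hk : k = l
    · by_cases hk' : k' = l'
      · exact hkl (by rw [hk, hk'])
      · exact Set.disjoint_left.1 (hQp hk') h2 h4
    · exact Set.disjoint_left.1 (hPp hk) h1 h3
  · subst hPX hQY
    ext z
    simp
  · rintro ⟨k, k'⟩
    obtain ⟨M, a, hM⟩ := hPf k
    obtain ⟨N, b, hN⟩ := hQg k'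
    have hdet : IsUnit (Matrix.reindex finSumFinEquiv finSumFinEquiv
        (Matrix.fromBlocks M.1 0 0 N.1)).det := by
      rw [Matrix.det_reindex_self, Matrix.det_fromBlocks_zero₂₁]
      exact ((Matrix.isUnit_iff_isUnit_det _).1 M.isUnit).mul
        ((Matrix.isUnit_iff_isUnit_det _).1 N.isUnit)
    refine ⟨Matrix.nonsingInvUnit _ hdet, Fin.append a b, ?_⟩
    rintro z ⟨h1, h2⟩ j
    have hv : (Matrix.nonsingInvUnit _ hdet).1 = Matrix.reindex finSumFinEquiv finSumFinEquiv
        (Matrix.fromBlocks M.1 0 0 N.1) := rfl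
    rw [hv, Fin.sum_univ_add]
    refine Fin.addCases (fun i => ?_) (fun i => ?_) j
    · simpa using hM _ h1 i
    · simpa using hN _ h2 i

end Iso

namespace Obj

/-- The cartesian product `X × Y ⊆ Γ^(n+m)`. -/
def prod {n m : ℕ} (X : Obj A n) (Y : Obj A m) : Obj A (n + m) where
  carrier := {z | z ∘ Fin.castAdd m ∈ X.carrier ∧ z ∘ Fin.natAdd n ∈ Y.carrier}
  definable := (X.definable.pullback _).inter _ _ (Y.definable.pullback _)
  bounded := by
    obtain ⟨γ, hγ⟩ := X.bounded
    obtain ⟨δ, hδ⟩ := Y.bounded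
    refine ⟨max γ δ, fun z hz i => ?_⟩
    refine Fin.addCases (fun i => ?_) (fun i => ?_) i
    · have := hγ _ hz.1 i
      exact ⟨(neg_le_neg (le_max_left _ _)).trans this.1, this.2.trans (le_max_left _ _)⟩
    · have := hδ _ hz.2 i
      exact ⟨(neg_le_neg (le_max_right _ _)).trans this.1, this.2.trans (le_max_right _ _)⟩

/-- The empty subset of `Γ^n`. -/
def empty (A : AddSubgroup Γ) (n : ℕ) : Obj A n where
  carrier := ∅
  definable := IsDefinable.empty
  bounded := ⟨0, fun _ h => h.elim⟩

/-- The one-point set `Γ^0`. -/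
def point (A : AddSubgroup Γ) : Obj A 0 where
  carrier := Set.univ
  definable := IsDefinable.univ
  bounded := ⟨0, fun _ _ i => i.elim0⟩

/-- The subset `{0}` of `Γ = Γ^1`. -/
def zero (A : AddSubgroup Γ) : Obj A 1 where
  carrier := {x | x 0 = 0}
  definable := by
    convert (IsDefinable.le (A := A) (n := 1) 1 0).inter _ _ (IsDefinable.ge (A := A) 1 0) using 1
    ext x
    simp [le_antisymm_iff]
  bounded := ⟨0, fun x h i => by
    have : i = 0 := Subsingleton.elim _ _
    subst this
    simp [show x 0 = 0 from h]⟩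

/-- The half-open interval `[0, a) ⊆ Γ = Γ^1`; it is empty if `a ≤ 0`. -/
def interval (a : A) : Obj A 1 where
  carrier := {x | 0 ≤ x 0 ∧ x 0 < (a : Γ)}
  definable := by
    convert (IsDefinable.ge (A := A) (n := 1) 1 0).inter _ _ (IsDefinable.lt (A := A) 1 a) using 1
    ext x
    simp
  bounded := ⟨(a : Γ), fun x h i => by
    have : i = 0 := Subsingleton.elim _ _
    subst this
    have h' := h.1.trans h.2.le
    exact ⟨(neg_nonpos.2 h').trans h.1, h.2.le⟩⟩

/-- Renaming the coordinates. -/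
def reindex {n m : ℕ} (e : Fin n ≃ Fin m) (X : Obj A n) : Obj A m where
  carrier := {z | z ∘ e ∈ X.carrier}
  definable := X.definable.pullback _
  bounded := by
    obtain ⟨γ, hγ⟩ := X.bounded
    refine ⟨γ, fun z hz i => ?_⟩
    simpa using hγ _ hz (e.symm i)

theorem ext' {n : ℕ} {X Y : Obj A n} (h : X.carrier = Y.carrier) : X = Y := by
  cases X; cases Y; cases h; rfl

theorem iso_reindex {n : ℕ} (e : Fin n ≃ Fin n) (X : Obj A n) :
    Iso A X.carrier (X.reindex e).carrier := by
  refine ⟨fun z => z ∘ e.symm, ⟨?_, ?_, ?_⟩, Unit, inferInstance, fun _ => X.carrier,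
    fun _ => X.definable, fun k l h => (h rfl).elim, Set.iUnion_const _, fun _ => ?_⟩
  · intro z hz
    change (z ∘ e.symm) ∘ e ∈ X.carrier
    simpa [Function.comp_assoc] using hz
  · intro z _ w _ h
    exact e.symm.surjective.injective_comp_right h
  · intro z hz
    exact ⟨z ∘ e, hz, by simp [Function.comp_assoc]⟩
  · have hdet : IsUnit (Equiv.Perm.permMatrix ℤ (e.symm : Equiv.Perm (Fin n))).det := by
      rw [Matrix.det_permutation]
      exact Units.isUnit _
    refine ⟨Matrix.nonsingInvUnit _ hdet, 0, fun x _ j => ?_⟩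
    have hv : (Matrix.nonsingInvUnit _ hdet).1 =
      Equiv.Perm.permMatrix ℤ (e.symm : Equiv.Perm (Fin n)) := rfl
    rw [hv]
    simp [Equiv.Perm.permMatrix, PEquiv.toMatrix_apply]

end Obj

end Objects

/-! ## The Grothendieck semigroups and the graded Grothendieck semiring -/

section Semiring

variable {Γ : Type*} [AddCommGroup Γ] [LinearOrder Γ] [IsOrderedAddMonoid Γ]
variable (A : AddSubgroup Γ)

/-- The defining relations of the Grothendieck semigroup in degree `n`, on the free commutative
monoid on the objects: `[X₁] + [X₂] = [Z]` if `Z` is the disjoint union of `Z₁, Z₂` with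
`Xᵢ ≅ Zᵢ`, and `[∅] = 0`. (In the free semigroup modulo the relations of the first kind `[∅]` is
neutral, so the last relation only says that the neutral element of the free monoid is the one that
is already there.) -/
inductive Rel (n : ℕ) : (Obj A n →₀ ℕ) → (Obj A n →₀ ℕ) → Prop
  | add (X₁ X₂ Z Z₁ Z₂ : Obj A n) (hZ : Z.carrier = Z₁.carrier ∪ Z₂.carrier)
      (hd : Disjoint Z₁.carrier Z₂.carrier)
      (h₁ : Iso A X₁.carrier Z₁.carrier) (h₂ : Iso A X₂.carrier Z₂.carrier) :
      Rel n (Finsupp.single X₁ 1 + Finsupp.single X₂ 1) (Finsupp.single Z 1)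
  | empty : Rel n (Finsupp.single (Obj.empty A n) 1) 0

/-- The Grothendieck semigroup of bounded definable subsets of `Γ^n`. -/
def SG (n : ℕ) : Type _ := (addConGen (Rel A n)).Quotient

instance (n : ℕ) : AddCommMonoid (SG A n) :=
  inferInstanceAs (AddCommMonoid (addConGen (Rel A n)).Quotient)

variable {A}

/-- The class `[X]` in the Grothendieck semigroup. -/
def cls {n : ℕ} (X : Obj A n) : SG A n := (addConGen (Rel A n)).mk' (Finsupp.single X 1)

theorem cls_empty (n : ℕ) : cls (Obj.empty A n) = 0 :=
  (AddCon.eq _).2 (AddConGen.Rel.of _ _ Rel.empty)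

theorem cls_add {n : ℕ} (X₁ X₂ Z Z₁ Z₂ : Obj A n) (hZ : Z.carrier = Z₁.carrier ∪ Z₂.carrier)
    (hd : Disjoint Z₁.carrier Z₂.carrier)
    (h₁ : Iso A X₁.carrier Z₁.carrier) (h₂ : Iso A X₂.carrier Z₂.carrier) :
    cls X₁ + cls X₂ = cls Z :=
  (AddCon.eq _).2 (AddConGen.Rel.of _ _ (Rel.add X₁ X₂ Z Z₁ Z₂ hZ hd h₁ h₂))

theorem cls_eq_of_iso {n : ℕ} {X Y : Obj A n} (h : Iso A X.carrier Y.carrier) :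
    cls X = cls Y := by
  have := cls_add X (Obj.empty A n) Y Y (Obj.empty A n) (by simp [Obj.empty])
    (by simp [Obj.empty]) h (Iso.refl (Obj.empty A n).definable)
  rwa [cls_empty, add_zero] at this

namespace SG

theorem hom_ext {n : ℕ} {M : Type*} [AddCommMonoid M] {f g : SG A n →+ M}
    (h : ∀ X : Obj A n, f (cls X) = g (cls X)) : f = g := by
  refine AddCon.hom_ext (c := addConGen (Rel A n)) (Finsupp.addHom_ext' fun X => ?_)
  ext
  exact h X

/-- The universal property of the Grothendieck semigroup. -/
def lift {n : ℕ} {M : Type*} [AddCommMonoid M] (f : Obj A n → M)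
    (h0 : f (Obj.empty A n) = 0)
    (hadd : ∀ X₁ X₂ Z Z₁ Z₂ : Obj A n, Z.carrier = Z₁.carrier ∪ Z₂.carrier →
      Disjoint Z₁.carrier Z₂.carrier → Iso A X₁.carrier Z₁.carrier →
      Iso A X₂.carrier Z₂.carrier → f X₁ + f X₂ = f Z) : SG A n →+ M :=
  (addConGen (Rel A n)).lift (Finsupp.liftAddHom fun X => multiplesHom M (f X)) <| by
    rw [AddCon.addConGen_le]
    intro x y hxy
    cases hxy with
    | add X₁ X₂ Z Z₁ Z₂ hZ hd h₁ h₂ => simpa [AddCon.ker_rel] using hadd X₁ X₂ Z Z₁ Z₂ hZ hd h₁ h₂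
    | empty => simpa [AddCon.ker_rel] using h0

theorem lift_cls {n : ℕ} {M : Type*} [AddCommMonoid M] (f : Obj A n → M) (h0) (hadd)
    (X : Obj A n) : lift f h0 hadd (cls X) = f X := by
  change (Finsupp.liftAddHom fun X => multiplesHom M (f X)) (Finsupp.single X 1) = f X
  simp

/-- Multiplication of classes, `[X] * [Y] = [X × Y]`, extended bilinearly. -/
def mulHom (A : AddSubgroup Γ) (n m : ℕ) : SG A n →+ SG A m →+ SG A (n + m) :=
  lift (fun X => lift (fun Y => cls (X.prod Y))
      (by
        rw [← cls_empty]
        congr 1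
        exact Obj.ext' (by ext; simp [Obj.prod, Obj.empty]))
      (fun X₁ X₂ Z Z₁ Z₂ hZ hd h₁ h₂ => by
        refine cls_add _ _ _ (X.prod Z₁) (X.prod Z₂) ?_ ?_
          ((Iso.refl X.definable).prod h₁) ((Iso.refl X.definable).prod h₂)
        · ext z
          simp only [Obj.prod, hZ, Set.mem_union, Set.mem_ofPred_eq]
          tauto
        · rw [Set.disjoint_left]
          exact fun z hz hz' => Set.disjoint_left.1 hd hz.2 hz'.2))
    (by
      refine hom_ext fun Y => ?_
      rw [lift_cls, AddMonoidHom.zero_apply, ← cls_empty]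
      congr 1
      exact Obj.ext' (by ext; simp [Obj.prod, Obj.empty]))
    (fun X₁ X₂ Z Z₁ Z₂ hZ hd h₁ h₂ => by
      refine hom_ext fun Y => ?_
      rw [AddMonoidHom.add_apply, lift_cls, lift_cls, lift_cls]
      refine cls_add _ _ _ (Z₁.prod Y) (Z₂.prod Y) ?_ ?_
        (h₁.prod (Iso.refl Y.definable)) (h₂.prod (Iso.refl Y.definable))
      · ext z
        simp only [Obj.prod, hZ, Set.mem_union, Set.mem_ofPred_eq]
        tauto
      · rw [Set.disjoint_left]
        exact fun z hz hz' => Set.disjoint_left.1 hd hz.1 hz'.1)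

theorem mulHom_cls {n m : ℕ} (X : Obj A n) (Y : Obj A m) :
    mulHom A n m (cls X) (cls Y) = cls (X.prod Y) := by
  rw [mulHom, lift_cls, lift_cls]

/-- Transport along an equality of degrees. -/
def castHom (A : AddSubgroup Γ) {n m : ℕ} (h : n = m) : SG A n →+ SG A m :=
  h ▸ AddMonoidHom.id (SG A n)

theorem mk_castHom {n m : ℕ} (h : n = m) (x : SG A n) :
    GradedMonoid.mk n x = GradedMonoid.mk m (castHom A h x) := by
  subst h; rfl

theorem castHom_cls {n m : ℕ} (h : n = m) (e : Fin n ≃ Fin m) (X : Obj A n) :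
    castHom A h (cls X) = cls (X.reindex e) := by
  subst h
  exact cls_eq_of_iso (X.iso_reindex e)

instance : GradedMonoid.GOne (SG A) where
  one := cls (Obj.point A)

instance : GradedMonoid.GMul (SG A) where
  mul {n m} x y := mulHom A n m x y

instance : DirectSum.GCommSemiring (SG A) where
  mul_zero {n m} x := map_zero (mulHom A n m x)
  zero_mul {n m} y := DFunLike.congr_fun (map_zero (mulHom A n m)) y
  mul_add {n m} x y z := map_add (mulHom A n m x) y z
  add_mul x y z := DFunLike.congr_fun (map_add (mulHom A _ _) x y) z
  one_mul := by
    rintro ⟨n, x⟩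
    refine (mk_castHom (Nat.zero_add n) _).trans (congrArg (GradedMonoid.mk n) ?_)
    refine DFunLike.congr_fun (f := (castHom A (Nat.zero_add n)).comp
      (mulHom A 0 n (cls (Obj.point A)))) (g := AddMonoidHom.id _) (hom_ext fun X => ?_) x
    rw [AddMonoidHom.comp_apply, mulHom_cls, castHom_cls _ (finCongr (Nat.zero_add n))]
    refine congrArg cls (Obj.ext' ?_)
    ext z
    simp only [Obj.reindex, Obj.prod, Obj.point, Set.mem_univ, true_and, Set.mem_ofPred_eq]
    refine iff_of_eq (congrArg (· ∈ X.carrier) (funext fun i => congrArg z ?_))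
    ext; simp
  mul_one := by
    rintro ⟨n, x⟩
    refine (mk_castHom (Nat.add_zero n) _).trans (congrArg (GradedMonoid.mk n) ?_)
    refine DFunLike.congr_fun (f := (castHom A (Nat.add_zero n)).comp
      ((mulHom A n 0).flip (cls (Obj.point A)))) (g := AddMonoidHom.id _)
      (hom_ext fun X => ?_) x
    rw [AddMonoidHom.comp_apply, AddMonoidHom.flip_apply, mulHom_cls,
      castHom_cls _ (finCongr (Nat.add_zero n))]
    refine congrArg cls (Obj.ext' ?_)
    ext z
    simp only [Obj.reindex, Obj.prod, Obj.point, Set.mem_univ, and_true, Set.mem_ofPred_eq]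
    refine iff_of_eq (congrArg (· ∈ X.carrier) (funext fun i => congrArg z ?_))
    ext; simp
  mul_assoc := by
    rintro ⟨n, x⟩ ⟨m, y⟩ ⟨k, w⟩
    refine (mk_castHom (Nat.add_assoc n m k) _).trans (congrArg (GradedMonoid.mk _) ?_)
    have key : ∀ (X : Obj A n) (Y : Obj A m) (W : Obj A k),
        castHom A (Nat.add_assoc n m k) (mulHom A _ k (mulHom A n m (cls X) (cls Y)) (cls W)) =
          mulHom A n _ (cls X) (mulHom A m k (cls Y) (cls W)) := by
      intro X Y W
      rw [mulHom_cls, mulHom_cls, mulHom_cls, mulHom_cls,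
        castHom_cls _ (finCongr (Nat.add_assoc n m k))]
      refine congrArg cls (Obj.ext' ?_)
      ext z
      simp only [Obj.reindex, Obj.prod, Set.mem_ofPred_eq, and_assoc]
      refine and_congr (iff_of_eq (congrArg (· ∈ X.carrier) (funext fun i => congrArg z ?_)))
        (and_congr (iff_of_eq (congrArg (· ∈ Y.carrier) (funext fun i => congrArg z ?_)))
          (iff_of_eq (congrArg (· ∈ W.carrier) (funext fun i => congrArg z ?_))))
      · ext; simp
      · ext; simp
      · ext; simp [Nat.add_assoc]
    have key2 : ∀ (X : Obj A n) (Y : Obj A m) (w : SG A k),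
        castHom A (Nat.add_assoc n m k) (mulHom A _ k (mulHom A n m (cls X) (cls Y)) w) =
          mulHom A n _ (cls X) (mulHom A m k (cls Y) w) := fun X Y w =>
      DFunLike.congr_fun (f := (castHom A (Nat.add_assoc n m k)).comp
        (mulHom A _ k (mulHom A n m (cls X) (cls Y))))
        (g := (mulHom A n _ (cls X)).comp (mulHom A m k (cls Y))) (hom_ext (key X Y)) w
    have key3 : ∀ (X : Obj A n) (y : SG A m) (w : SG A k),
        castHom A (Nat.add_assoc n m k) (mulHom A _ k (mulHom A n m (cls X) y) w) =
          mulHom A n _ (cls X) (mulHom A m k y w) := fun X y w =>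
      DFunLike.congr_fun (f := (castHom A (Nat.add_assoc n m k)).comp
        (((mulHom A _ k).flip w).comp (mulHom A n m (cls X))))
        (g := (mulHom A n _ (cls X)).comp ((mulHom A m k).flip w))
        (hom_ext fun Y => key2 X Y w) y
    exact DFunLike.congr_fun (f := (castHom A (Nat.add_assoc n m k)).comp
        (((mulHom A _ k).flip w).comp ((mulHom A n m).flip y)))
        (g := (mulHom A n _).flip (mulHom A m k y w)) (hom_ext fun X => key3 X y w) x
  mul_comm := by
    rintro ⟨n, x⟩ ⟨m, y⟩
    refine (mk_castHom (Nat.add_comm n m) _).trans (congrArg (GradedMonoid.mk _) ?_)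
    have key : ∀ (X : Obj A n) (Y : Obj A m),
        castHom A (Nat.add_comm n m) (mulHom A n m (cls X) (cls Y)) =
          mulHom A m n (cls Y) (cls X) := by
      intro X Y
      rw [mulHom_cls, mulHom_cls, castHom_cls _ finAddFlip]
      refine congrArg cls (Obj.ext' ?_)
      ext z
      simp only [Obj.reindex, Obj.prod, Set.mem_ofPred_eq]
      rw [and_comm]
      refine and_congr (iff_of_eq (congrArg (· ∈ Y.carrier) (funext fun i => congrArg z ?_)))
        (iff_of_eq (congrArg (· ∈ X.carrier) (funext fun i => congrArg z ?_)))
      · simp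
      · simp
    have key2 : ∀ (X : Obj A n) (y : SG A m),
        castHom A (Nat.add_comm n m) (mulHom A n m (cls X) y) =
          mulHom A m n y (cls X) := fun X y =>
      DFunLike.congr_fun (f := (castHom A (Nat.add_comm n m)).comp (mulHom A n m (cls X)))
        (g := (mulHom A m n).flip (cls X)) (hom_ext (key X)) y
    exact DFunLike.congr_fun (f := (castHom A (Nat.add_comm n m)).comp ((mulHom A n m).flip y))
        (g := mulHom A m n y) (hom_ext fun X => key2 X y) x
  natCast k := k • cls (Obj.point A)
  natCast_zero := zero_nsmul _
  natCast_succ k := succ_nsmul _ _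

end SG

end Semiring

/-! ## The dimension-free part of a graded semiring, and the ring of a semiring -/

section DimensionFree

variable {R : ℕ → Type*} [∀ i, AddCommMonoid (R i)] [DirectSum.GCommSemiring R]

/-- For a graded commutative semiring `R = ⨁ R_n` and `a ∈ R_1`, the component of degree `0` of the
`ℤ`-graded localization `R[a⁻¹]`, that is, the set of all `r / a^n` with `r ∈ R_n`. -/
def dimFree (a : R 1) :
    Subsemiring (Localization (Submonoid.powers (DirectSum.of R 1 a))) where
  carrier := {x | ∃ (n : ℕ) (r : R n), x = Localization.mk (DirectSum.of R n r)
    (Submonoid.pow (DirectSum.of R 1 a) n)}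
  mul_mem' := by
    rintro _ _ ⟨n, r, rfl⟩ ⟨m, s, rfl⟩
    refine ⟨n + m, GradedMonoid.GMul.mul r s, ?_⟩
    rw [Localization.mk_mul, DirectSum.of_mul_of]
    exact congrArg (Localization.mk _) (Subtype.ext (pow_add _ n m).symm)
  one_mem' := by
    refine ⟨0, GradedMonoid.GOne.one, ?_⟩
    rw [← Localization.mk_one]
    exact congrArg (Localization.mk _) (Subtype.ext (pow_zero (DirectSum.of R 1 a)).symm)
  add_mem' := by
    rintro _ _ ⟨n, r, rfl⟩ ⟨m, s, rfl⟩
    have hpow : ∀ (k : ℕ), ∃ t : R k, DirectSum.of R 1 a ^ k = DirectSum.of R k t := by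
      intro k
      induction k with
      | zero => exact ⟨GradedMonoid.GOne.one, pow_zero _⟩
      | succ k ih =>
        obtain ⟨t, ht⟩ := ih
        exact ⟨GradedMonoid.GMul.mul t a, by rw [pow_succ, ht, DirectSum.of_mul_of]⟩
    obtain ⟨t, ht⟩ := hpow n
    obtain ⟨u, hu⟩ := hpow m
    have hcast : ∃ v : R (n + m), DirectSum.of R (m + n) (GradedMonoid.GMul.mul u r) =
        DirectSum.of R (n + m) v := by
      rw [Nat.add_comm n m]
      exact ⟨_, rfl⟩
    obtain ⟨v, hv⟩ := hcast
    refine ⟨n + m, GradedMonoid.GMul.mul t s + v, ?_⟩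
    rw [Localization.add_mk]
    refine congrArg₂ Localization.mk ?_ (Subtype.ext (pow_add _ n m).symm)
    rw [map_add, ← hv, ← DirectSum.of_mul_of, ← DirectSum.of_mul_of, ← ht, ← hu]
    rfl
  zero_mem' := by
    refine ⟨0, 0, ?_⟩
    rw [map_zero, Localization.mk_zero]

/-- The quotient `r / a^n` in the dimension-free part, for `r ∈ R_n`. -/
def dimFree.frac (a : R 1) {n : ℕ} (r : R n) : dimFree a :=
  ⟨Localization.mk (DirectSum.of R n r) (Submonoid.pow (DirectSum.of R 1 a) n), n, r, rfl⟩

theorem dimFree.frac_add (a : R 1) {n : ℕ} (r s : R n) :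
    frac a (r + s) = frac a r + frac a s := by
  apply Subtype.ext
  change Localization.mk _ _ = Localization.mk _ _ + Localization.mk _ _
  rw [map_add, Localization.add_mk_self]

theorem dimFree.frac_zero (a : R 1) (n : ℕ) : frac a (0 : R n) = 0 := by
  apply Subtype.ext
  change Localization.mk _ _ = 0
  rw [map_zero, Localization.mk_zero]

/-- The ring obtained from a commutative semiring `S` by introducing additive inverses,
`ℤ ⊗_ℕ S`. -/
def RingOf (S : Type*) [CommSemiring S] : Type _ := ℤ ⊗[ℕ] S

instance (S : Type*) [CommSemiring S] : CommRing (RingOf S) :=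
  inferInstanceAs (CommRing (ℤ ⊗[ℕ] S))

/-- The canonical homomorphism from a commutative semiring to its ring. -/
def RingOf.of (S : Type*) [CommSemiring S] : S →+* RingOf S :=
  (Algebra.TensorProduct.includeRight : S →ₐ[ℕ] ℤ ⊗[ℕ] S).toRingHom

end DimensionFree

/-! ## The dimension-free Grothendieck ring and the homomorphism from the symmetric algebra -/

section Main

variable {Γ : Type*} [AddCommGroup Γ] [LinearOrder Γ] [IsOrderedAddMonoid Γ]
variable (A : AddSubgroup Γ)

/-- The dimension-free Grothendieck semiring: the degree `0` part of the localization at `[0]_1` of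
the graded semiring `⨁ n, SG A n`. -/
abbrev SGdf : Type _ := dimFree (R := SG A) (cls (Obj.zero A))

/-- The dimension-free Grothendieck ring. -/
abbrev Kdf : Type _ := RingOf (SGdf A)

/-- The dimension-free Grothendieck ring with rational coefficients. -/
abbrev KQdf : Type _ := ℚ ⊗[ℤ] Kdf A

variable {A}

/-- The class `[X]_n / [0]_1^n` of a bounded definable `X ⊆ Γ^n` in `K^df`. -/
def Kdf.cls {n : ℕ} (X : Obj A n) : Kdf A :=
  RingOf.of _ (dimFree.frac (R := SG A) (BoundedPolytopes.cls (Obj.zero A))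
    (BoundedPolytopes.cls X))

/-- The element `ι(a)`: it is `[0, a)_1 / [0]_1` if `a > 0`, `- ι(-a)` if `a < 0`, and `0` if
`a = 0`. -/
def iota (a : A) : Kdf A :=
  if 0 < a then Kdf.cls (Obj.interval a)
  else if a < 0 then - Kdf.cls (Obj.interval (-a))
  else 0

theorem Kdf.cls_interval_of_nonpos {a : A} (ha : a ≤ 0) : Kdf.cls (Obj.interval a) = 0 := by
  have h : Obj.interval a = Obj.empty A 1 := by
    refine Obj.ext' (Set.eq_empty_of_forall_notMem fun x hx => ?_)
    exact absurd (hx.1.trans_lt hx.2) (not_lt.2 ha)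
  rw [Kdf.cls, h, cls_empty, dimFree.frac_zero, map_zero]

theorem Kdf.cls_interval_add {a b : A} (ha : 0 ≤ a) (hb : 0 ≤ b) :
    Kdf.cls (Obj.interval (a + b)) = Kdf.cls (Obj.interval a) + Kdf.cls (Obj.interval b) := by
  have ha' : (0 : Γ) ≤ a := ha
  have hb' : (0 : Γ) ≤ b := hb
  let Z₂ : Obj A 1 :=
    { carrier := {x | (a : Γ) ≤ x 0 ∧ x 0 < ((a + b : A) : Γ)}
      definable := by
        convert (IsDefinable.ge (A := A) (n := 1) 1 a).inter _ _
          (IsDefinable.lt (A := A) 1 (a + b)) using 1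
        ext x
        simp
      bounded := by
        obtain ⟨γ, hγ⟩ := (Obj.interval (a + b)).bounded
        exact ⟨γ, fun x hx => hγ x ⟨ha'.trans hx.1, hx.2⟩⟩ }
  have h := cls_add (Obj.interval a) (Obj.interval b) (Obj.interval (a + b)) (Obj.interval a) Z₂
    (by
      ext x
      simp only [Obj.interval, Z₂, Set.mem_union, Set.mem_ofPred_eq, AddSubgroup.coe_add]
      constructor
      · rintro ⟨h1, h2⟩
        rcases lt_or_ge (x 0) (a : Γ) with h | h
        · exact Or.inl ⟨h1, h⟩
        · exact Or.inr ⟨h, h2⟩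
      · rintro (⟨h1, h2⟩ | ⟨h1, h2⟩)
        · exact ⟨h1, h2.trans_le (le_add_of_nonneg_right hb')⟩
        · exact ⟨ha'.trans h1, h2⟩)
    (Set.disjoint_left.2 fun x hx hx' => absurd hx.2 (not_lt.2 hx'.1))
    (Iso.refl (Obj.interval a).definable)
    (by
      refine ⟨fun x j => x j + a, ⟨?_, ?_, ?_⟩, Unit, inferInstance,
        fun _ => (Obj.interval b).carrier, fun _ => (Obj.interval b).definable,
        fun k l h => (h rfl).elim, Set.iUnion_const _, fun _ => ⟨1, fun _ => a, fun x _ j => ?_⟩⟩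
      · rintro x ⟨h1, h2⟩
        refine ⟨le_add_of_nonneg_left h1, ?_⟩
        change x 0 + (a : Γ) < (a : Γ) + b
        rw [add_comm (a : Γ)]
        exact add_lt_add_left h2 _
      · intro x _ y _ hxy
        funext j
        exact add_right_cancel (congrFun hxy j)
      · rintro x ⟨h1, h2⟩
        refine ⟨fun j => x j - a, ⟨sub_nonneg.2 h1, ?_⟩, by simp⟩
        exact sub_lt_iff_lt_add'.2 h2
      · have : j = 0 := Subsingleton.elim _ _
        subst this
        simp [Matrix.one_apply])
  rw [Kdf.cls, ← h, dimFree.frac_add, map_add]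
  rfl

theorem iota_eq (a : A) : iota a = Kdf.cls (Obj.interval a) - Kdf.cls (Obj.interval (-a)) := by
  rcases lt_trichotomy a 0 with h | h | h
  · rw [iota, if_neg (not_lt.2 h.le), if_pos h, Kdf.cls_interval_of_nonpos h.le, zero_sub]
  · subst h
    simp [iota, Kdf.cls_interval_of_nonpos]
  · rw [iota, if_pos h, Kdf.cls_interval_of_nonpos (neg_nonpos.2 h.le), sub_zero]

theorem iota_sub {a b : A} (ha : 0 ≤ a) (hb : 0 ≤ b) :
    iota (a - b) = Kdf.cls (Obj.interval a) - Kdf.cls (Obj.interval b) := by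
  rw [iota_eq, neg_sub]
  rcases le_total a b with h | h
  · have := Kdf.cls_interval_add ha (sub_nonneg.2 h)
    rw [add_sub_cancel] at this
    rw [Kdf.cls_interval_of_nonpos (sub_nonpos.2 h), this]
    ring
  · have := Kdf.cls_interval_add hb (sub_nonneg.2 h)
    rw [add_sub_cancel] at this
    rw [Kdf.cls_interval_of_nonpos (a := b - a) (sub_nonpos.2 h), this]
    ring

theorem iota_add (a b : A) : iota (a + b) = iota a + iota b := by
  have key : ∀ c : A, ∃ p q : A, 0 ≤ p ∧ 0 ≤ q ∧ c = p - q := fun c =>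
    ⟨max c 0, max c 0 - c, le_max_right _ _, sub_nonneg.2 (le_max_left _ _), by abel⟩
  obtain ⟨p, q, hp, hq, rfl⟩ := key a
  obtain ⟨r, s, hr, hs, rfl⟩ := key b
  rw [show p - q + (r - s) = (p + r) - (q + s) by abel, iota_sub (add_nonneg hp hr)
    (add_nonneg hq hs), iota_sub hp hq, iota_sub hr hs, Kdf.cls_interval_add hp hr,
    Kdf.cls_interval_add hq hs]
  ring

variable (A)

/-- The map `a ↦ ι(a)` as a homomorphism from `A` to `K_ℚ^df`. -/
def iotaHom : A →+ KQdf A :=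
  AddMonoidHom.mk' (fun a => (1 : ℚ) ⊗ₜ[ℤ] iota a) fun a b => by
    rw [iota_add, TensorProduct.tmul_add]

/-- `T_A`, the symmetric algebra over `ℚ` of the rational vector space `ℚ ⊗ A`. -/
abbrev T : Type _ := SymmetricAlgebra ℚ (ℚ ⊗[ℤ] A)

/-- The natural homomorphism `φ_A : T_A → K_ℚ^df`, the homomorphism of `ℚ`-algebras that sends
`a ∈ A` to `ι(a)`. -/
def phi : T A →ₐ[ℚ] KQdf A :=
  SymmetricAlgebra.lift (LinearMap.liftBaseChange ℚ (iotaHom A).toIntLinearMap)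

theorem phi_apply (a : A) :
    phi A (SymmetricAlgebra.ι ℚ (ℚ ⊗[ℤ] A) (1 ⊗ₜ[ℤ] a)) = (1 : ℚ) ⊗ₜ[ℤ] iota a := by
  simp [phi, iotaHom]

end Main

end BoundedPolytopes

end

open scoped TensorProduct

noncomputable section

namespace BoundedPolytopes

/-! ## Ordered rational vector spaces -/

/-! Injectivity comes from counting lattice points. A functional `h : Γ →ₗ[ℚ] ℚ` turns a formula
with parameters in `Γ` into a linear system over `ℚ`. By elimination of variables, a bounded system
without solutions in `Γ` has none in `ℚ` either, as soon as `h` is positive on finitely many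
suitable positive elements (`Fml.eventually_real_inter_box_eq_empty`). Hence the number of integral
points of `X` is well defined as a germ in `h`. It is additive and multiplicative, and it is
invariant under isomorphism because the translation parts eventually become integral. This gives
`countMeasure`, a homomorphism from `KQdf A` to a ring of germs that sends `ι(a)` to `h ↦ h a`. If
`φ_A(t) = 0`, the polynomial function defined by `t` vanishes at all sufficiently positive and
integral `h`. Polynomiality along lines makes it vanish at every functional
(`evalT_eq_zero_of_eventually`), so `t = 0`.

For surjectivity, `InS A X` says that the class of `X` lies in the image of `φ_A`. The image is a
`ℚ`-subalgebra in which `[0]_1` has become `1`. Such sets are therefore stable under disjoint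
unions, products, removal of a piece and integral affine maps; coordinates may be added or deleted;
and equal pieces may be divided by their number. Intervals give tuples of distinct elements, these
give increasing chains after division by `k!`, and partial sums turn chains into unimodular
simplices. A lattice simplex with larger determinant is treated by induction on the determinant: a
lattice point with small barycentric coordinates forms a circuit with the vertices, and of the two
dissections of their convex hull one contains the given simplex, while all other full-dimensional
pieces have smaller determinant (`InS.openSimplex_of_det_ne_zero`).

If `A` is divisible, the indicator function of a bounded definable set is an integral combination of
indicator functions of simplicial cones with apex in `A^n` and lexicographically positive directions
(`indicator_mem_coneSpan`). The finitely many directions that occur are positive under one integral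
functional, so one half space contains the set and cuts every cone down to a bounded piece built
from lattice simplices (`InS.truncatedCone`). A linear relation between indicator functions gives
the same relation between classes (`InS.of_indicator_mem`). -/

/-- A divisible ordered abelian group is a rational vector space. -/
theorem exists_rat_module {G : Type*} [AddCommGroup G] [LinearOrder G] [IsOrderedAddMonoid G]
    (hG : ∀ n : ℕ, n ≠ 0 → ∀ x : G, ∃ y : G, n • y = x) : Nonempty (Module ℚ G) := by
  -- An ordered group is torsion-free, so it embeds in its divisible hull; divisibility makes the
  -- embedding onto, and the scalar action is pulled back.
  have hbij : Function.Bijective (DivisibleHull.coeAddMonoidHom G) := by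
    refine ⟨DivisibleHull.coe_injective, fun z => ?_⟩
    induction z using DivisibleHull.ind with
    | mk m s =>
      obtain ⟨y, hy⟩ := hG s s.ne_zero m
      refine ⟨y, ?_⟩
      change DivisibleHull.mk y 1 = _
      rw [DivisibleHull.mk_eq_mk_iff_smul_eq_smul]
      simp [hy]
  let e := AddEquiv.ofBijective _ hbij
  let _ : SMul ℚ G := ⟨fun q x => e.symm (q • e x)⟩
  exact ⟨e.injective.module ℚ e.toAddMonoidHom fun q x => e.apply_symm_apply _⟩

section RatModule

variable {G : Type*} [AddCommGroup G] [LinearOrder G] [IsOrderedAddMonoid G] [Module ℚ G]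

/-- Multiplying `q • x` by the denominator of `q` gives the numerator times `x`, so positivity
reduces to integer multiples. -/
instance strictOrderedModule_rat : IsStrictOrderedModule ℚ G := by
  have key : ∀ (q : ℚ), 0 < q → ∀ x : G, 0 < x → 0 < q • x := by
    intro q hq x hx
    have hden : 0 < q.den := q.den_pos
    have h1 : q.den • (q • x) = q.num • x := by
      rw [← Nat.cast_smul_eq_nsmul ℚ, smul_smul, mul_comm, Rat.mul_den_eq_num,
        Int.cast_smul_eq_zsmul]
    have h2 : 0 < q.den • (q • x) := by
      rw [h1]
      exact zsmul_pos hx (Rat.num_pos.2 hq)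
    by_contra h
    exact absurd (nsmul_nonpos (not_lt.1 h) q.den) (not_le.2 h2)
  refine { smul_lt_smul_of_pos_left := ?_, smul_lt_smul_of_pos_right := ?_ }
  · intro q hq x y hxy
    have := key q hq (y - x) (sub_pos.2 hxy)
    rwa [smul_sub, sub_pos] at this
  · intro x hx p q hpq
    have := key (q - p) (sub_pos.2 hpq) x hx
    rwa [sub_smul, sub_pos] at this

/-- The nearest members `l ≤ y ≤ u` of the list have a midpoint that lies in the same gap as `y`; if
`y` is itself a member, then `l = u = y`. Midpoints of pairs are thus finitely many test points,
which is what eliminates a variable. -/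
theorem exists_midpoint_like (T : List G) (y : G) (hl : ∃ t ∈ T, t ≤ y) (hu : ∃ t ∈ T, y ≤ t) :
    ∃ l ∈ T, ∃ u ∈ T, l ≤ y ∧ y ≤ u ∧ ∀ t ∈ T,
      (y < t ↔ (2⁻¹ : ℚ) • (l + u) < t) ∧ (t < y ↔ t < (2⁻¹ : ℚ) • (l + u)) := by
  obtain ⟨l, ⟨hlT, hly⟩, hlmax⟩ := Set.exists_max_image {t | t ∈ T ∧ t ≤ y} id
    ((List.finite_toSet T).subset fun t ht => ht.1) hl
  obtain ⟨u, ⟨huT, huy⟩, humin⟩ := Set.exists_min_image {t | t ∈ T ∧ y ≤ t} id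
    ((List.finite_toSet T).subset fun t ht => ht.1) hu
  simp only [id, Set.mem_ofPred_eq, and_imp] at hlmax humin
  refine ⟨l, hlT, u, huT, hly, huy, ?_⟩
  have hmid : ∀ a : G, (2⁻¹ : ℚ) • (a + a) = a := fun a => by
    rw [← two_smul ℚ, smul_smul]; norm_num
  rcases hly.eq_or_lt with rfl | hly'
  · have : u = l := le_antisymm (humin l hlT le_rfl) huy
    subst this
    intro t _
    rw [hmid]
    simp
  rcases huy.eq_or_lt with h | huy'
  · subst h
    exact absurd (hlmax y huT le_rfl) (not_le.2 hly')
  have h1 : l < (2⁻¹ : ℚ) • (l + u) := by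
    conv_lhs => rw [← hmid l]
    exact smul_lt_smul_of_pos_left ((add_lt_add_iff_left l).2 (hly'.trans huy')) (by norm_num)
  have h2 : (2⁻¹ : ℚ) • (l + u) < u := by
    conv_rhs => rw [← hmid u]
    exact smul_lt_smul_of_pos_left ((add_lt_add_iff_right u).2 (hly'.trans huy')) (by norm_num)
  intro t ht
  constructor
  · constructor
    · intro h; exact h2.trans_le (humin t ht h.le)
    · intro h
      by_contra h'
      exact absurd (hlmax t ht (not_lt.1 h')) (not_le.2 (h1.trans h))
  · constructor
    · intro h; exact (hlmax t ht h.le).trans_lt h1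
    · intro h
      by_contra h'
      exact absurd (humin t ht (not_lt.1 h')) (not_le.2 (h.trans h2))

end RatModule

/-! ## Formulas over an ordered rational vector space -/

/-- Affine forms with rational linear part and constant term in `G`. -/
abbrev Aff (G : Type*) (n : ℕ) : Type _ := (Fin n → ℚ) × G

/-- Quantifier free formulas in `n` variables with parameters in `G`; the atomic formulas say that
an affine form is negative. -/
inductive Fml (G : Type*) (n : ℕ) : Type _
  | neg (f : Aff G n) : Fml G n
  | compl (φ : Fml G n) : Fml G n
  | inter (φ ψ : Fml G n) : Fml G n

/-- The box `[-γ, γ]^n`. -/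
def box {H : Type*} [AddCommGroup H] [LinearOrder H] (n : ℕ) (γ : H) : Set (Fin n → H) :=
  {x | ∀ i, -γ ≤ x i ∧ x i ≤ γ}

section Formulas

variable {G : Type*} [AddCommGroup G] [Module ℚ G]
variable {H : Type*} [AddCommGroup H] [LinearOrder H] [IsOrderedAddMonoid H] [Module ℚ H]

namespace Aff

/-- Evaluation of an affine form, the parameters being interpreted by `h`. -/
def eval {n : ℕ} (h : G →ₗ[ℚ] H) (f : Aff G n) (x : Fin n → H) : H :=
  ∑ i, f.1 i • x i + h f.2

theorem eval_add {n : ℕ} (h : G →ₗ[ℚ] H) (f g : Aff G n) (x : Fin n → H) :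
    eval h (f + g) x = eval h f x + eval h g x := by
  simp only [eval, Prod.fst_add, Prod.snd_add, Pi.add_apply, add_smul, Finset.sum_add_distrib,
    map_add]
  abel

theorem eval_smul {n : ℕ} (h : G →ₗ[ℚ] H) (q : ℚ) (f : Aff G n) (x : Fin n → H) :
    eval h (q • f) x = q • eval h f x := by
  simp only [eval, Prod.smul_fst, Prod.smul_snd, Pi.smul_apply, smul_eq_mul, mul_smul, smul_add,
    Finset.smul_sum, map_smul]

theorem eval_neg {n : ℕ} (h : G →ₗ[ℚ] H) (f : Aff G n) (x : Fin n → H) :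
    eval h (-f) x = - eval h f x := by
  rw [← neg_one_smul ℚ f, eval_smul, neg_one_smul]

theorem eval_sub {n : ℕ} (h : G →ₗ[ℚ] H) (f g : Aff G n) (x : Fin n → H) :
    eval h (f - g) x = eval h f x - eval h g x := by
  rw [sub_eq_add_neg, eval_add, eval_neg, sub_eq_add_neg]

/-- The restriction of an affine form in `n + 1` variables to the first `n` variables. -/
def init {n : ℕ} (f : Aff G (n + 1)) : Aff G n := (fun i => f.1 i.castSucc, f.2)

theorem eval_snoc {n : ℕ} (h : G →ₗ[ℚ] H) (f : Aff G (n + 1)) (x : Fin n → H) (y : H) :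
    eval h f (Fin.snoc (α := fun _ => H) x y) = eval h f.init x + f.1 (Fin.last n) • y := by
  simp only [eval, Fin.sum_univ_castSucc, Fin.snoc_castSucc, Fin.snoc_last, init]
  abel

/-- The affine form `l` in `n` variables such that `f (x, y) = 0` is equivalent to `y = l x`. -/
def root {n : ℕ} (f : Aff G (n + 1)) : Aff G n := (-(f.1 (Fin.last n))⁻¹) • f.init

theorem eval_snoc_root {n : ℕ} (h : G →ₗ[ℚ] H) (f : Aff G (n + 1)) (x : Fin n → H) (y : H)
    (hf : f.1 (Fin.last n) ≠ 0) : eval h f (Fin.snoc (α := fun _ => H) x y) =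
      f.1 (Fin.last n) • (y - eval h f.root x) := by
  rw [eval_snoc, root, eval_smul, smul_sub, smul_smul, mul_neg, mul_inv_cancel₀ hf, neg_one_smul]
  abel

theorem eval_snoc_neg_iff_of_pos {n : ℕ} (h : G →ₗ[ℚ] H) (f : Aff G (n + 1)) (x : Fin n → H)
    (y : H) (hf : 0 < f.1 (Fin.last n)) :
    eval h f (Fin.snoc (α := fun _ => H) x y) < 0 ↔ y < eval h f.root x := by
  rw [eval_snoc_root h f x y hf.ne', ← sub_neg (a := y)]
  exact smul_neg_iff_of_pos_left hf

theorem eval_snoc_neg_iff_of_neg {n : ℕ} (h : G →ₗ[ℚ] H) (f : Aff G (n + 1)) (x : Fin n → H)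
    (y : H) (hf : f.1 (Fin.last n) < 0) :
    eval h f (Fin.snoc (α := fun _ => H) x y) < 0 ↔ eval h f.root x < y := by
  rw [eval_snoc_root h f x y hf.ne, ← sub_pos (b := eval h f.root x)]
  have := smul_pos_iff_of_pos_left (b := y - eval h f.root x) (neg_pos.2 hf)
  rwa [neg_smul, neg_pos] at this

end Aff

namespace Fml

/-- The set defined by a formula. -/
def real {n : ℕ} (h : G →ₗ[ℚ] H) : Fml G n → Set (Fin n → H)
  | neg f => {x | f.eval h x < 0}
  | compl φ => (real h φ)ᶜ
  | inter φ ψ => real h φ ∩ real h ψ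

/-- Substitution of an affine form for the last variable. -/
def subst {n : ℕ} (l : Aff G n) : Fml G (n + 1) → Fml G n
  | neg f => neg (f.init + f.1 (Fin.last n) • l)
  | compl φ => compl (subst l φ)
  | inter φ ψ => inter (subst l φ) (subst l ψ)

theorem mem_real_subst {n : ℕ} (h : G →ₗ[ℚ] H) (l : Aff G n) (φ : Fml G (n + 1))
    (x : Fin n → H) : x ∈ (φ.subst l).real h ↔
      Fin.snoc (α := fun _ => H) x (l.eval h x) ∈ φ.real h := by
  induction φ with
  | neg f => simp [subst, real, Aff.eval_snoc, Aff.eval_add, Aff.eval_smul]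
  | compl φ ih => simp [subst, real, ih]
  | inter φ ψ ih₁ ih₂ => simp [subst, real, ih₁, ih₂]

/-- A finite list of affine forms in the first `n` variables, such that the truth of the formula
at `(x, y)` depends only on `x` and on the position of `y` relative to their values at `x`. -/
def breakpoints {n : ℕ} : Fml G (n + 1) → List (Aff G n)
  -- If the last coefficient is `0`, then `0⁻¹ = 0` makes the root the zero form, a superfluous but
  -- harmless breakpoint.
  | neg f => [f.root]
  | compl φ => breakpoints φ
  | inter φ ψ => breakpoints φ ++ breakpoints ψ

/-- An atomic formula compares `y` with its root, in a direction given by the sign of the last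
coefficient, or does not involve `y` at all. -/
theorem mem_real_congr {n : ℕ} (h : G →ₗ[ℚ] H) (φ : Fml G (n + 1)) (x : Fin n → H) (y y' : H)
    (hy : ∀ l ∈ φ.breakpoints, (y < l.eval h x ↔ y' < l.eval h x) ∧
      (l.eval h x < y ↔ l.eval h x < y')) :
    Fin.snoc (α := fun _ => H) x y ∈ φ.real h ↔ Fin.snoc (α := fun _ => H) x y' ∈ φ.real h := by
  induction φ with
  | neg f =>
    obtain ⟨h1, h2⟩ := hy f.root (by simp [breakpoints])
    simp only [real, Set.mem_ofPred_eq]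
    rcases lt_trichotomy (f.1 (Fin.last n)) 0 with hf | hf | hf
    · rw [Aff.eval_snoc_neg_iff_of_neg _ _ _ _ hf, Aff.eval_snoc_neg_iff_of_neg _ _ _ _ hf, h2]
    · rw [Aff.eval_snoc, Aff.eval_snoc, hf, zero_smul, zero_smul]
    · rw [Aff.eval_snoc_neg_iff_of_pos _ _ _ _ hf, Aff.eval_snoc_neg_iff_of_pos _ _ _ _ hf, h1]
  | compl φ ih => exact not_congr (ih hy)
  | inter φ ψ ih₁ ih₂ =>
    exact and_congr (ih₁ fun l hl => hy l (List.mem_append_left _ hl))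
      (ih₂ fun l hl => hy l (List.mem_append_right _ hl))

/-- If `y` lies between the values at `x` of two members of a list of affine forms that contains
the breakpoints, it can be replaced by the midpoint of the values of two members. -/
theorem exists_midpoint {n : ℕ} (h : G →ₗ[ℚ] H) (φ : Fml G (n + 1)) (T : List (Aff G n))
    (hT : ∀ l ∈ φ.breakpoints, l ∈ T) (x : Fin n → H) (y : H)
    (hy : Fin.snoc (α := fun _ => H) x y ∈ φ.real h)
    (hl : ∃ t ∈ T, t.eval h x ≤ y) (hu : ∃ t ∈ T, y ≤ t.eval h x) :
    ∃ l ∈ T, ∃ u ∈ T, l.eval h x ≤ y ∧ y ≤ u.eval h x ∧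
      x ∈ (φ.subst ((2⁻¹ : ℚ) • (l + u))).real h ∧ ∀ t ∈ T,
        (y < t.eval h x ↔ Aff.eval h ((2⁻¹ : ℚ) • (l + u)) x < t.eval h x) ∧
        (t.eval h x < y ↔ t.eval h x < Aff.eval h ((2⁻¹ : ℚ) • (l + u)) x) := by
  obtain ⟨l', hl', u', hu', h1, h2, h3⟩ := exists_midpoint_like (T.map fun t => t.eval h x) y
    (by simpa using hl) (by simpa using hu)
  obtain ⟨l, hl, rfl⟩ := List.mem_map.1 hl'
  obtain ⟨u, hu, rfl⟩ := List.mem_map.1 hu'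
  have h4 : ∀ t ∈ T, (y < t.eval h x ↔ Aff.eval h ((2⁻¹ : ℚ) • (l + u)) x < t.eval h x) ∧
        (t.eval h x < y ↔ t.eval h x < Aff.eval h ((2⁻¹ : ℚ) • (l + u)) x) := by
    intro t ht
    rw [Aff.eval_smul, Aff.eval_add]
    exact h3 _ (List.mem_map_of_mem ht)
  refine ⟨l, hl, u, hu, h1, h2, ?_, h4⟩
  rw [mem_real_subst]
  exact (mem_real_congr h φ x y _ fun t ht => h4 t (hT t ht)).1 hy

/-- The formula `-γ ≤ y ≤ γ` on the last variable `y`. -/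
def lastBox (n : ℕ) (γ : G) : Fml G (n + 1) :=
  inter (compl (neg (Pi.single (Fin.last n) 1, γ))) (compl (neg (Pi.single (Fin.last n) (-1), γ)))

theorem mem_real_lastBox {n : ℕ} (h : G →ₗ[ℚ] H) (γ : G) (x : Fin n → H) (y : H) :
    Fin.snoc (α := fun _ => H) x y ∈ (lastBox n γ).real h ↔ -h γ ≤ y ∧ y ≤ h γ := by
  simp only [lastBox, real, Set.mem_inter_iff, Set.mem_compl_iff, Set.mem_ofPred_eq, not_lt,
    Aff.eval_snoc]
  simp only [Aff.eval, Aff.init, Pi.single_eq_same, one_smul, neg_smul,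
    Pi.single_eq_of_ne (Fin.castSucc_lt_last _).ne, zero_smul, Finset.sum_const_zero, zero_add]
  exact and_congr (neg_le_iff_add_nonneg').symm (by rw [← sub_eq_add_neg, sub_nonneg])

end Fml

end Formulas

/-! ### Transfer of unsolvable bounded systems to another ordered vector space -/

section Transfer

variable {G : Type*} [AddCommGroup G] [LinearOrder G] [IsOrderedAddMonoid G] [Module ℚ G]
variable {H : Type*} [AddCommGroup H] [LinearOrder H] [IsOrderedAddMonoid H] [Module ℚ H]

theorem mem_box_snoc {n : ℕ} (γ : H) (x : Fin n → H) (y : H) :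
    Fin.snoc (α := fun _ => H) x y ∈ box (n + 1) γ ↔ x ∈ box n γ ∧ -γ ≤ y ∧ y ≤ γ := by
  simp [box, Fin.forall_fin_succ']

/-- A bounded system of linear inequalities without solutions in `G` has no solutions in `H`, for
all sufficiently positive interpretations of the parameters. -/
theorem Fml.eventually_real_inter_box_eq_empty {I : Type*} {F : Filter I} {h : I → G →ₗ[ℚ] H}
    (hpos : ∀ p : G, 0 < p → ∀ᶠ i in F, 0 < h i p) {n : ℕ} (φ : Fml G n) (γ : G)
    (hφ : ∀ x ∈ φ.real LinearMap.id, x ∉ box n γ) :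
    ∀ᶠ i in F, ∀ x ∈ φ.real (h i), x ∉ box n (h i γ) := by
  induction n with
  | zero =>
    -- Without variables a formula is a Boolean combination of signs of parameters, and each sign is
    -- eventually preserved.
    have key : ∀ ψ : Fml G 0, ∀ᶠ i in F,
        ((default : Fin 0 → H) ∈ ψ.real (h i) ↔ (default : Fin 0 → G) ∈ ψ.real LinearMap.id) := by
      intro ψ
      induction ψ with
      | neg f =>
        simp only [Fml.real, Aff.eval, Finset.univ_eq_empty, Finset.sum_empty, zero_add,
          Set.mem_ofPred_eq, LinearMap.id_apply]
        rcases lt_trichotomy f.2 0 with hf | hf | hf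
        · filter_upwards [hpos (-f.2) (neg_pos.2 hf)] with i hi
          rw [map_neg, neg_pos] at hi
          exact iff_of_true hi hf
        · filter_upwards with i
          simp [hf]
        · filter_upwards [hpos f.2 hf] with i hi
          exact iff_of_false hi.not_gt hf.not_gt
      | compl ψ ih =>
        filter_upwards [ih] with i hi
        exact not_congr hi
      | inter ψ χ ih₁ ih₂ =>
        filter_upwards [ih₁, ih₂] with i h1 h2
        exact and_congr h1 h2
    filter_upwards [key φ] with i hi x hx _
    rw [Subsingleton.elim x default] at hx
    exact hφ default (hi.1 hx) fun j => j.elim0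
  | succ n ih =>
    -- The bounds `γ` and `-γ` join the breakpoints for two reasons: every `y` in the box then has
    -- neighbours on both sides, and the test point that replaces `y` stays in the box.
    set T : List (Aff G n) := φ.breakpoints ++ [(0, γ), (0, -γ)] with hT
    -- For each of the finitely many pairs, substituting the midpoint removes the last variable, and
    -- induction applies. The condition `lastBox` is substituted as well, since it is needed to
    -- contradict the hypothesis on `φ`.
    have h1 : ∀ l ∈ {l | l ∈ T}, ∀ u ∈ {u | u ∈ T}, ∀ᶠ i in F,
        ∀ x ∈ ((φ.inter (Fml.lastBox n γ)).subst ((2⁻¹ : ℚ) • (l + u))).real (h i),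
          x ∉ box n (h i γ) := by
      intro l _ u _
      refine ih _ fun x hx hx' => ?_
      rw [Fml.mem_real_subst] at hx
      have h2 := (Fml.mem_real_lastBox _ _ _ _).1 hx.2
      exact hφ _ hx.1 ((mem_box_snoc _ _ _).2 ⟨hx', h2⟩)
    have h2 := (Filter.eventually_all_finite (List.finite_toSet T)).2 fun l hl =>
      (Filter.eventually_all_finite (List.finite_toSet T)).2 (h1 l hl)
    filter_upwards [h2] with i hi z hz hzb
    obtain ⟨x, y, rfl⟩ : ∃ x y, z = Fin.snoc (α := fun _ => H) x y :=
      ⟨Fin.init z, z (Fin.last n), (Fin.snoc_init_self z).symm⟩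
    rw [mem_box_snoc] at hzb
    have ev : ∀ δ : G, Aff.eval (h i) ((0, δ) : Aff G n) x = h i δ := fun δ => by simp [Aff.eval]
    obtain ⟨l, hl, u, hu, -, -, h3, h4⟩ := Fml.exists_midpoint (h i) φ T
      (fun l hl => List.mem_append_left _ hl) x y hz
      ⟨(0, -γ), by simp [hT], by rw [ev, map_neg]; exact hzb.2.1⟩
      ⟨(0, γ), by simp [hT], by rw [ev]; exact hzb.2.2⟩
    refine hi l hl u hu x ?_ hzb.1
    rw [Fml.mem_real_subst] at h3 ⊢
    refine ⟨h3, (Fml.mem_real_lastBox _ _ _ _).2 ?_⟩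
    have h5 := h4 (0, -γ) (by simp [hT])
    have h6 := h4 (0, γ) (by simp [hT])
    rw [ev, map_neg] at h5
    rw [ev] at h6
    exact ⟨not_lt.1 fun h' => absurd (h5.1.2 h') (not_lt.2 hzb.2.1),
      not_lt.1 fun h' => absurd (h6.2.2 h') (not_lt.2 hzb.2.2)⟩

end Transfer

end BoundedPolytopes

namespace BoundedPolytopes

/-! ## Ring homomorphisms on the dimension-free Grothendieck ring -/

section Measures

variable {Γ : Type*} [AddCommGroup Γ] [LinearOrder Γ] [IsOrderedAddMonoid Γ]

/-- An additive and multiplicative invariant of bounded definable sets that takes the value `1` at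
the point `0` of `Γ`. -/
structure DFMeasure (A : AddSubgroup Γ) (R : Type*) [CommRing R] where
  toFun : ∀ {n : ℕ}, Obj A n → R
  empty' : ∀ n, toFun (Obj.empty A n) = 0
  add' : ∀ {n : ℕ} (X₁ X₂ Z : Obj A n), Z.carrier = X₁.carrier ∪ X₂.carrier →
    Disjoint X₁.carrier X₂.carrier → toFun X₁ + toFun X₂ = toFun Z
  iso' : ∀ {n : ℕ} (X Y : Obj A n), Iso A X.carrier Y.carrier → toFun X = toFun Y
  prod' : ∀ {n m : ℕ} (X : Obj A n) (Y : Obj A m), toFun (X.prod Y) = toFun X * toFun Y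
  zero' : toFun (Obj.zero A) = 1
  point' : toFun (Obj.point A) = 1

namespace DFMeasure

variable {A : AddSubgroup Γ} {R : Type*} [CommRing R] (μ : DFMeasure A R)

/-- The additive map on the Grothendieck semigroup. -/
def onSG (n : ℕ) : SG A n →+ R :=
  SG.lift (fun X => μ.toFun X) (μ.empty' n) fun X₁ X₂ Z Z₁ Z₂ hZ hd h₁ h₂ => by
    rw [μ.iso' _ _ h₁, μ.iso' _ _ h₂, μ.add' Z₁ Z₂ Z hZ hd]

theorem onSG_cls {n : ℕ} (X : Obj A n) : μ.onSG n (cls X) = μ.toFun X :=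
  SG.lift_cls _ _ _ _

theorem onSG_mul {n m : ℕ} (x : SG A n) (y : SG A m) :
    μ.onSG (n + m) (SG.mulHom A n m x y) = μ.onSG n x * μ.onSG m y := by
  have key : ∀ (X : Obj A n), ((μ.onSG (n + m)).comp (SG.mulHom A n m (cls X))) =
      (AddMonoidHom.mulLeft (μ.onSG n (cls X))).comp (μ.onSG m) := fun X =>
    SG.hom_ext fun Y => by
      simp [SG.mulHom_cls, onSG_cls, μ.prod']
  have key2 : (μ.onSG (n + m)).comp ((SG.mulHom A n m).flip y) =
      (AddMonoidHom.mulRight (μ.onSG m y)).comp (μ.onSG n) :=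
    SG.hom_ext fun X => DFunLike.congr_fun (key X) y
  exact DFunLike.congr_fun key2 x

/-- The ring homomorphism on the graded Grothendieck semiring. -/
def onDirectSum : DirectSum ℕ (SG A) →+* R :=
  DirectSum.toSemiring (fun n => μ.onSG n) ((μ.onSG_cls _).trans μ.point') fun x y =>
    μ.onSG_mul x y

theorem onDirectSum_of {n : ℕ} (x : SG A n) : μ.onDirectSum (DirectSum.of _ n x) = μ.onSG n x :=
  DirectSum.toSemiring_of _ _ _ _ _

/-- The ring homomorphism on the localization of the graded Grothendieck semiring. -/
def onLocalization :
    Localization (Submonoid.powers (DirectSum.of (SG A) 1 (cls (Obj.zero A)))) →+* R :=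
  IsLocalization.lift (M := Submonoid.powers (DirectSum.of (SG A) 1 (cls (Obj.zero A))))
    (g := μ.onDirectSum) (by
      rintro ⟨_, k, rfl⟩
      simp [onDirectSum_of, onSG_cls, μ.zero'])

theorem onLocalization_frac {n : ℕ} (x : SG A n) :
    μ.onLocalization (dimFree.frac (R := SG A) (cls (Obj.zero A)) x).1 = μ.onSG n x := by
  change μ.onLocalization (Localization.mk (DirectSum.of (SG A) n x) (Submonoid.pow _ n)) = _
  rw [← onDirectSum_of, onLocalization, Localization.mk_eq_mk', IsLocalization.lift_mk'_spec]
  simp [Submonoid.pow, onDirectSum_of, onSG_cls, μ.zero']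

/-- The ring homomorphism on the dimension-free Grothendieck ring. -/
def onKdf : Kdf A →+* R :=
  (Algebra.TensorProduct.lift (Int.castRingHom R).toNatAlgHom
    (μ.onLocalization.comp (dimFree (R := SG A) (cls (Obj.zero A))).subtype).toNatAlgHom
    fun _ _ => Commute.all _ _ : ℤ ⊗[ℕ] SGdf A →ₐ[ℕ] R).toRingHom

theorem onKdf_cls {n : ℕ} (X : Obj A n) : μ.onKdf (Kdf.cls X) = μ.toFun X := by
  rw [← onSG_cls, ← onLocalization_frac]
  change Algebra.TensorProduct.lift _ _ _ ((1 : ℤ) ⊗ₜ[ℕ] _) = _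
  rw [Algebra.TensorProduct.lift_tmul, map_one, one_mul]
  rfl

/-- The homomorphism of `ℚ`-algebras on the dimension-free Grothendieck ring with rational
coefficients. -/
def onKQdf [Algebra ℚ R] : KQdf A →ₐ[ℚ] R :=
  Algebra.TensorProduct.lift (Algebra.ofId ℚ R) μ.onKdf.toIntAlgHom fun _ _ => Commute.all _ _

theorem onKQdf_iota [Algebra ℚ R] (a : A) : μ.onKQdf ((1 : ℚ) ⊗ₜ[ℤ] iota a) =
    μ.toFun (Obj.interval a) - μ.toFun (Obj.interval (-a)) := by
  rw [onKQdf, Algebra.TensorProduct.lift_tmul, map_one, one_mul]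
  change μ.onKdf (iota a) = _
  rw [iota_eq, map_sub, onKdf_cls, onKdf_cls]

end DFMeasure

end Measures

end BoundedPolytopes

namespace BoundedPolytopes

/-! ## Integral matrices acting on tuples -/

section IntAct

variable {G : Type*} [AddCommGroup G]

/-- The action of an integral matrix on tuples of elements of an abelian group. -/
def intAct {m n : ℕ} (M : Matrix (Fin m) (Fin n) ℤ) (x : Fin n → G) : Fin m → G :=
  fun j => ∑ l, M j l • x l

theorem intAct_intAct {k m n : ℕ} (M : Matrix (Fin k) (Fin m) ℤ) (N : Matrix (Fin m) (Fin n) ℤ)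
    (x : Fin n → G) : intAct M (intAct N x) = intAct (M * N) x := by
  funext j
  simp only [intAct, Finset.smul_sum, Matrix.mul_apply, Finset.sum_smul, mul_smul]
  exact Finset.sum_comm

theorem intAct_one {n : ℕ} (x : Fin n → G) : intAct (1 : Matrix (Fin n) (Fin n) ℤ) x = x := by
  funext j
  simp [intAct, Matrix.one_apply]

theorem intAct_add {m n : ℕ} (M : Matrix (Fin m) (Fin n) ℤ) (x y : Fin n → G) :
    intAct M (x + y) = intAct M x + intAct M y := by
  funext j
  simp [intAct, Finset.sum_add_distrib]

theorem intAct_sub {m n : ℕ} (M : Matrix (Fin m) (Fin n) ℤ) (x y : Fin n → G) :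
    intAct M (x - y) = intAct M x - intAct M y := by
  funext j
  simp [intAct, smul_sub]

theorem intAct_inv_intAct {n : ℕ} (M : Matrix.GeneralLinearGroup (Fin n) ℤ) (x : Fin n → G) :
    intAct (M⁻¹).1 (intAct M.1 x) = x := by
  rw [intAct_intAct, ← Units.val_mul, inv_mul_cancel, Units.val_one, intAct_one]

theorem intAct_intAct_inv {n : ℕ} (M : Matrix.GeneralLinearGroup (Fin n) ℤ) (x : Fin n → G) :
    intAct M.1 (intAct (M⁻¹).1 x) = x := by
  rw [intAct_intAct, ← Units.val_mul, mul_inv_cancel, Units.val_one, intAct_one]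

/-- The affine permutation `x ↦ M x + b` of `G^n`. -/
def affEquiv {n : ℕ} (M : Matrix.GeneralLinearGroup (Fin n) ℤ) (b : Fin n → G) :
    (Fin n → G) ≃ (Fin n → G) where
  toFun x := intAct M.1 x + b
  invFun y := intAct (M⁻¹).1 (y - b)
  left_inv x := by beta_reduce; rw [add_sub_cancel_right, intAct_inv_intAct]
  right_inv y := by beta_reduce; rw [intAct_intAct_inv, sub_add_cancel]

end IntAct

/-! ## More on formulas -/

section Formulas

variable {G : Type*} [AddCommGroup G] [Module ℚ G]
variable {H : Type*} [AddCommGroup H] [LinearOrder H] [IsOrderedAddMonoid H] [Module ℚ H]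

namespace Fml

/-- Finite disjunctions. -/
def any {n : ℕ} : List (Fml G n) → Fml G n
  | [] => neg 0
  | φ :: L => compl (inter (compl φ) (compl (any L)))

theorem mem_real_any {n : ℕ} (h : G →ₗ[ℚ] H) (L : List (Fml G n)) (x : Fin n → H) :
    x ∈ (any L).real h ↔ ∃ φ ∈ L, x ∈ φ.real h := by
  induction L with
  | nil => simp [any, real, Aff.eval]
  | cons φ L ih =>
    simp only [any, real, Set.mem_compl_iff, Set.mem_inter_iff, not_and_or, not_not, ih,
      List.exists_mem_cons_iff]

/-- The formula defining the box `[-γ, γ]^n`. -/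
def boxFml (n : ℕ) (γ : G) : Fml G n :=
  compl (any ((List.finRange n).map fun i =>
    compl (inter (compl (neg (Pi.single i 1, γ))) (compl (neg (Pi.single i (-1), γ))))))

theorem real_boxFml {n : ℕ} (h : G →ₗ[ℚ] H) (γ : G) : (boxFml n γ).real h = box n (h γ) := by
  ext x
  have : ∀ (i : Fin n) (q : ℚ), ∑ j, (Pi.single i q : Fin n → ℚ) j • x j = q • x i := by
    intro i q
    rw [Finset.sum_eq_single i (fun j _ hj => by simp [Pi.single_eq_of_ne hj]) (by simp)]
    simp
  simp only [boxFml, real, Set.mem_compl_iff, mem_real_any, List.mem_map, List.mem_finRange,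
    true_and, exists_exists_eq_and, not_exists, Set.mem_inter_iff, Set.mem_ofPred_eq, not_lt,
    Aff.eval, this, one_smul, neg_smul, box, not_not]
  exact forall_congr' fun i =>
    and_congr (neg_le_iff_add_nonneg).symm (by rw [neg_add_eq_sub, sub_nonneg])

/-- Substitution of affine forms for the variables. -/
def comp {n m : ℕ} (L : Fin n → Aff G m) : Fml G n → Fml G m
  | neg f => neg (∑ i, f.1 i • L i + (0, f.2))
  | compl φ => compl (comp L φ)
  | inter φ ψ => inter (comp L φ) (comp L ψ)

theorem mem_real_comp {n m : ℕ} (h : G →ₗ[ℚ] H) (L : Fin n → Aff G m) (φ : Fml G n)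
    (x : Fin m → H) : x ∈ (φ.comp L).real h ↔ (fun i => (L i).eval h x) ∈ φ.real h := by
  induction φ with
  | neg f =>
    have : ∀ s : Finset (Fin n), Aff.eval h (∑ i ∈ s, f.1 i • L i) x =
        ∑ i ∈ s, f.1 i • (L i).eval h x := by
      intro s
      induction s using Finset.induction_on with
      | empty => simp [Aff.eval]
      | insert i s hi ih => rw [Finset.sum_insert hi, Finset.sum_insert hi, Aff.eval_add,
          Aff.eval_smul, ih]
    have h2 : Aff.eval h ((0, f.2) : Aff G m) x = h f.2 := by simp [Aff.eval]
    simp only [comp, real, Set.mem_ofPred_eq, Aff.eval_add, this, h2]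
    rfl
  | compl φ ih => simp [comp, real, ih]
  | inter φ ψ ih₁ ih₂ => simp [comp, real, ih₁, ih₂]

/-- The image of a formula under the affine permutation `x ↦ M x + b`. -/
def image {n : ℕ} (M : Matrix.GeneralLinearGroup (Fin n) ℤ) (b : Fin n → G) (φ : Fml G n) :
    Fml G n :=
  φ.comp fun i => (fun l => ((M⁻¹).1 i l : ℚ), -intAct (M⁻¹).1 b i)

theorem mem_real_image {n : ℕ} (h : G →ₗ[ℚ] H) (M : Matrix.GeneralLinearGroup (Fin n) ℤ)
    (b : Fin n → G) (φ : Fml G n) (x : Fin n → H) :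
    x ∈ (φ.image M b).real h ↔ (affEquiv M fun i => h (b i)).symm x ∈ φ.real h := by
  rw [image, mem_real_comp]
  refine iff_of_eq (congrArg (· ∈ φ.real h) (funext fun i => ?_))
  change _ = intAct (M⁻¹).1 (x - fun i => h (b i)) i
  rw [intAct_sub]
  simp [Aff.eval, intAct, sub_eq_add_neg, Int.cast_smul_eq_zsmul]

theorem mem_real_comp_affEquiv {n : ℕ} (h : G →ₗ[ℚ] H) (M : Matrix.GeneralLinearGroup (Fin n) ℤ)
    (b : Fin n → G) (φ : Fml G n) (x : Fin n → H) :
    x ∈ (φ.comp fun i => (fun l => (M.1 i l : ℚ), b i)).real h ↔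
      affEquiv M (fun i => h (b i)) x ∈ φ.real h := by
  rw [mem_real_comp]
  refine iff_of_eq (congrArg (· ∈ φ.real h) (funext fun i => ?_))
  change _ = intAct M.1 x i + h (b i)
  simp [Aff.eval, intAct, Int.cast_smul_eq_zsmul]

end Fml

end Formulas

theorem IsDefinable.exists_fml {Γ : Type*} [AddCommGroup Γ] [LinearOrder Γ] [IsOrderedAddMonoid Γ]
    [Module ℚ Γ] {A : AddSubgroup Γ} {n : ℕ} {X : Set (Fin n → Γ)} (hX : IsDefinable A X) :
    ∃ φ : Fml Γ n, φ.real LinearMap.id = X := by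
  induction hX with
  | lt c a =>
    refine ⟨Fml.neg (fun i => (c i : ℚ), -(a : Γ)), ?_⟩
    ext x
    simp [Fml.real, Aff.eval, Int.cast_smul_eq_zsmul]
  | compl X _ ih =>
    obtain ⟨φ, rfl⟩ := ih
    exact ⟨φ.compl, rfl⟩
  | inter X Y _ _ ih₁ ih₂ =>
    obtain ⟨φ, rfl⟩ := ih₁
    obtain ⟨ψ, rfl⟩ := ih₂
    exact ⟨φ.inter ψ, rfl⟩

/-! ## Counting integral points -/

section Counting

variable {Γ : Type*} [AddCommGroup Γ] [LinearOrder Γ] [IsOrderedAddMonoid Γ] [Module ℚ Γ]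

open scoped Classical in
variable (Γ) in
/-- The filter of sufficiently positive and sufficiently integral functionals. -/
def posFilter : Filter (Γ →ₗ[ℚ] ℚ) where
  sets := {U | ∃ s t : Finset Γ, (∀ p ∈ s, 0 < p) ∧ ∀ h : Γ →ₗ[ℚ] ℚ, (∀ p ∈ s, 0 < h p) →
    (∀ a ∈ t, ∃ k : ℤ, h a = (k : ℚ)) → h ∈ U}
  univ_sets := ⟨∅, ∅, by simp, by simp⟩
  sets_of_superset := by
    rintro U V ⟨s, t, hs, hU⟩ hUV
    exact ⟨s, t, hs, fun h h1 h2 => hUV (hU h h1 h2)⟩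
  inter_sets := by
    rintro U V ⟨s, t, hs, hU⟩ ⟨s', t', hs', hV⟩
    refine ⟨s ∪ s', t ∪ t', ?_, fun h h1 h2 => ⟨hU h ?_ ?_, hV h ?_ ?_⟩⟩
    · intro p hp
      exact (Finset.mem_union.1 hp).elim (hs p) (hs' p)
    · exact fun p hp => h1 p (Finset.mem_union_left _ hp)
    · exact fun p hp => h2 p (Finset.mem_union_left _ hp)
    · exact fun p hp => h1 p (Finset.mem_union_right _ hp)
    · exact fun p hp => h2 p (Finset.mem_union_right _ hp)

theorem eventually_pos (p : Γ) (hp : 0 < p) : ∀ᶠ h in posFilter Γ, 0 < h p :=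
  ⟨{p}, ∅, by simpa using hp, by simp⟩

theorem eventually_int (a : Γ) : ∀ᶠ h in posFilter Γ, ∃ k : ℤ, h a = (k : ℚ) :=
  ⟨∅, {a}, by simp, by simp⟩

theorem eventually_le {a b : Γ} (hab : a ≤ b) : ∀ᶠ h in posFilter Γ, h a ≤ h b := by
  rcases hab.eq_or_lt with rfl | h
  · simp
  · filter_upwards [eventually_pos (b - a) (sub_pos.2 h)] with f hf
    rw [map_sub, sub_pos] at hf
    exact hf.le

/-- A formula is eventually bounded if so are the sets that it defines in `ℚ^n`. -/
def Fml.EvBdd {n : ℕ} (φ : Fml Γ n) : Prop :=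
  ∃ γ : Γ, ∀ᶠ h in posFilter Γ, φ.real h ⊆ box n (h γ)

/-- The transfer principle is applied to the system `φ ∧ ¬ψ`, which has no solution in `Γ`; only `φ`
has to be bounded. -/
theorem Fml.EvBdd.eventually_subset {n : ℕ} {φ ψ : Fml Γ n} (hφ : φ.EvBdd)
    (h : φ.real LinearMap.id ⊆ ψ.real LinearMap.id) :
    ∀ᶠ h in posFilter Γ, φ.real h ⊆ ψ.real h := by
  obtain ⟨γ, hγ⟩ := hφ
  have := Fml.eventually_real_inter_box_eq_empty (F := posFilter Γ) (h := id)
    (fun p hp => eventually_pos p hp) (φ.inter ψ.compl) γ fun x hx _ => hx.2 (h hx.1)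
  filter_upwards [this, hγ] with f hf hf' x hx
  by_contra hx'
  exact hf x ⟨hx, hx'⟩ (hf' hx)

theorem Fml.EvBdd.inter {n : ℕ} {φ : Fml Γ n} (hφ : φ.EvBdd) (ψ : Fml Γ n) :
    (ψ.inter φ).EvBdd := by
  obtain ⟨γ, hγ⟩ := hφ
  refine ⟨γ, ?_⟩
  filter_upwards [hγ] with f hf x hx
  exact hf hx.2

theorem Fml.EvBdd.eventually_eq {n : ℕ} {φ ψ : Fml Γ n} (hφ : φ.EvBdd) (hψ : ψ.EvBdd)
    (h : φ.real LinearMap.id = ψ.real LinearMap.id) :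
    ∀ᶠ h in posFilter Γ, φ.real h = ψ.real h := by
  filter_upwards [hφ.eventually_subset h.subset, hψ.eventually_subset h.superset] with f h1 h2
  exact h1.antisymm h2

variable {A : AddSubgroup Γ}

/-- Boundedness in `Γ^n` alone does not control the sets that a formula defines over `ℚ`. Adding the
box as a conjunct makes the formula bounded under every interpretation. -/
theorem Obj.exists_fml {n : ℕ} (X : Obj A n) :
    ∃ φ : Fml Γ n, φ.real LinearMap.id = X.carrier ∧ φ.EvBdd := by
  obtain ⟨φ, hφ⟩ := X.definable.exists_fml
  obtain ⟨γ, hγ⟩ := X.bounded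
  have hb : (Fml.boxFml n γ).EvBdd := ⟨γ, Filter.Eventually.of_forall fun f => by
    rw [Fml.real_boxFml]⟩
  refine ⟨φ.inter (Fml.boxFml n γ), ?_, hb.inter φ⟩
  change φ.real _ ∩ (Fml.boxFml n γ).real _ = _
  rw [hφ, Fml.real_boxFml]
  exact Set.inter_eq_left.2 hγ

/-- A formula defining `X`. -/
def Obj.fml {n : ℕ} (X : Obj A n) : Fml Γ n := X.exists_fml.choose

theorem Obj.real_fml {n : ℕ} (X : Obj A n) : X.fml.real LinearMap.id = X.carrier :=
  X.exists_fml.choose_spec.1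

theorem Obj.evBdd_fml {n : ℕ} (X : Obj A n) : X.fml.EvBdd := X.exists_fml.choose_spec.2

/-- The integral points of the set defined by a formula. -/
def Fml.points {n : ℕ} (h : Γ →ₗ[ℚ] ℚ) (φ : Fml Γ n) : Set (Fin n → ℤ) :=
  {z | (fun i => (z i : ℚ)) ∈ φ.real h}

theorem Fml.EvBdd.eventually_finite {n : ℕ} {φ : Fml Γ n} (hφ : φ.EvBdd) :
    ∀ᶠ h in posFilter Γ, (φ.points h).Finite := by
  obtain ⟨γ, hγ⟩ := hφ
  filter_upwards [hγ] with f hf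
  refine (Set.finite_Icc (fun _ : Fin n => ⌊-f γ⌋) (fun _ => ⌈f γ⌉)).subset fun z hz => ?_
  have := hf hz
  refine ⟨fun i => ?_, fun i => ?_⟩
  · exact Int.cast_le.1 ((Int.floor_le _).trans (this i).1)
  · exact Int.cast_le.1 ((this i).2.trans (Int.le_ceil _))

/-- The number of integral points of `X`, as a function of the interpretation of the parameters. -/
def Obj.count {n : ℕ} (X : Obj A n) (h : Γ →ₗ[ℚ] ℚ) : ℕ := (X.fml.points h).ncard

/-- The germ of `count` does not depend on the formula chosen for `X`, so it may be computed with
any convenient bounded formula. -/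
theorem Obj.eventually_count_eq {n : ℕ} (X : Obj A n) {φ : Fml Γ n} (hφ : φ.EvBdd)
    (h : φ.real LinearMap.id = X.carrier) :
    ∀ᶠ h in posFilter Γ, X.count h = (φ.points h).ncard := by
  filter_upwards [X.evBdd_fml.eventually_eq hφ (X.real_fml.trans h.symm)] with f hf
  rw [Obj.count, Fml.points, hf, Fml.points]

theorem Obj.eventually_count_add {n : ℕ} (X₁ X₂ Z : Obj A n)
    (hZ : Z.carrier = X₁.carrier ∪ X₂.carrier) (hd : Disjoint X₁.carrier X₂.carrier) :
    ∀ᶠ h in posFilter Γ, X₁.count h + X₂.count h = Z.count h := by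
  have h1 := X₁.evBdd_fml.eventually_subset (ψ := Z.fml) (by simp [real_fml, hZ])
  have h2 := X₂.evBdd_fml.eventually_subset (ψ := Z.fml) (by simp [real_fml, hZ])
  have h3 := Z.evBdd_fml.eventually_subset (ψ := Fml.any [X₁.fml, X₂.fml]) (by
    intro x hx
    rw [Fml.mem_real_any]
    simpa [real_fml, hZ] using hx)
  have h4 := X₁.evBdd_fml.eventually_subset (ψ := X₂.fml.compl) (by
    change _ ⊆ (X₂.fml.real LinearMap.id)ᶜ
    rw [real_fml, real_fml]
    exact hd.subset_compl_right)
  filter_upwards [h1, h2, h3, h4, X₁.evBdd_fml.eventually_finite,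
    X₂.evBdd_fml.eventually_finite] with f h1 h2 h3 h4 h5 h6
  rw [Obj.count, Obj.count, Obj.count, ← Set.ncard_union_eq _ h5 h6]
  · congr 1
    refine Set.Subset.antisymm (Set.union_subset (fun z hz => h1 hz) (fun z hz => h2 hz)) ?_
    intro z hz
    have := (Fml.mem_real_any _ _ _).1 (h3 hz)
    simp only [List.mem_cons, List.not_mem_nil, or_false, exists_eq_or_imp, exists_eq_left] at this
    exact this
  · exact Set.disjoint_left.2 fun z hz hz' => h4 hz hz'

/-- Once `h` is integral on the finitely many translation parts, each piece of the isomorphism acts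
on `ℤ^n` by a unimodular affine permutation. Partition, injectivity and image are statements about
bounded systems and transfer to `h`. -/
theorem Obj.eventually_count_iso {n : ℕ} (X Y : Obj A n) (hXY : Iso A X.carrier Y.carrier) :
    ∀ᶠ h in posFilter Γ, X.count h = Y.count h := by
  obtain ⟨f, hf, κ, _, P, hPd, hPp, hPX, hPf⟩ := hXY
  choose M a hM using hPf
  choose π hπ using fun k => (hPd k).exists_fml
  have _ := Fintype.ofFinite κ
  have hfP : ∀ k, ∀ x ∈ P k, f x = affEquiv (M k) (fun j => (a k j : Γ)) x := fun k x hx =>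
    funext fun j => hM k x hx j
  -- The conjuncts `X.fml` and `Y.fml` change nothing over `Γ`, but they make the pieces bounded,
  -- and contained in the whole set, for every `h`.
  set π' : κ → Fml Γ n := fun k => (π k).inter X.fml with hπ'
  set ρ : κ → Fml Γ n := fun k => ((π k).image (M k) fun j => (a k j : Γ)).inter Y.fml with hρ
  have hπr : ∀ k, (π' k).real LinearMap.id = P k := fun k => by
    change (π k).real _ ∩ X.fml.real _ = _
    rw [hπ, X.real_fml, ← hPX]
    exact Set.inter_eq_left.2 (Set.subset_iUnion _ _)
  have hρr : ∀ k, (ρ k).real LinearMap.id = f '' P k := fun k => by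
    ext y
    change y ∈ ((π k).image _ _).real _ ∧ y ∈ Y.fml.real _ ↔ _
    rw [Fml.mem_real_image, hπ, Y.real_fml]
    constructor
    · rintro ⟨h1, -⟩
      exact ⟨_, h1, by rw [hfP k _ h1]; exact Equiv.apply_symm_apply _ _⟩
    · rintro ⟨x, hx, rfl⟩
      refine ⟨?_, hf.mapsTo (hPX ▸ Set.mem_iUnion_of_mem k hx)⟩
      rw [hfP k _ hx]
      change (affEquiv (M k) fun j => (a k j : Γ)).symm _ ∈ P k
      rwa [Equiv.symm_apply_apply]
  -- A partition over `Γ` is eventually a partition of the integral points. Cardinalities are taken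
  -- in `ℕ∞`, so that summing over the pieces needs no finiteness.
  have cover : ∀ (Z : Obj A n) (σ : κ → Fml Γ n),
      Z.carrier ⊆ (⋃ k, (σ k).real (LinearMap.id : Γ →ₗ[ℚ] Γ)) →
      (∀ k, (σ k).EvBdd) → Pairwise (fun k l => Disjoint
        ((σ k).real (LinearMap.id : Γ →ₗ[ℚ] Γ)) ((σ l).real (LinearMap.id : Γ →ₗ[ℚ] Γ))) → (∀ (h : Γ →ₗ[ℚ] ℚ) k, (σ k).real h ⊆ Z.fml.real h) →
      ∀ᶠ h in posFilter Γ, (Z.fml.points h).encard = ∑ᶠ k, ((σ k).points h).encard := by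
    intro Z σ hZ hb hd hsub
    have h1 := Z.evBdd_fml.eventually_subset
      (ψ := Fml.any ((Finset.univ : Finset κ).toList.map σ)) (by
        intro x hx
        rw [Fml.mem_real_any]
        rw [Z.real_fml] at hx
        obtain ⟨k, hk⟩ := Set.mem_iUnion.1 (hZ hx)
        exact ⟨σ k, by simp, hk⟩)
    have h2 : ∀ᶠ h in posFilter Γ, ∀ k l, k ≠ l → (σ k).real h ⊆ ((σ l).compl).real h := by
      refine Filter.eventually_all.2 fun k => Filter.eventually_all.2 fun l => ?_
      by_cases hkl : k = l
      · exact Filter.Eventually.of_forall fun h h' => (h' hkl).elim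
      · filter_upwards [(hb k).eventually_subset (ψ := (σ l).compl)
          (hd hkl).subset_compl_right] with h hh _ using hh
    filter_upwards [h1, h2] with h h1 h2
    rw [← Set.encard_iUnion_of_finite]
    · congr 1
      ext z
      rw [Set.mem_iUnion]
      constructor
      · intro hz
        obtain ⟨φ, hφ, hz'⟩ := (Fml.mem_real_any _ _ _).1 (h1 hz)
        obtain ⟨k, -, rfl⟩ := List.mem_map.1 hφ
        exact ⟨k, hz'⟩
      · rintro ⟨k, hk⟩
        exact hsub h k hk
    · exact fun k l hkl => Set.disjoint_left.2 fun z hz hz' => h2 k l hkl hz hz'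
  have eX := cover X π' (by rw [← hPX]; exact Set.iUnion_mono fun k => (hπr k).superset)
    (fun k => X.evBdd_fml.inter _) (fun k l hkl => by
      beta_reduce
      rw [hπr, hπr]; exact hPp hkl) fun h k x hx => hx.2
  have eY := cover Y ρ (by
      rw [← hf.image_eq, ← hPX, Set.image_iUnion]
      exact Set.iUnion_mono fun k => (hρr k).superset)
    (fun k => Y.evBdd_fml.inter _) (fun k l hkl => by
      beta_reduce
      rw [hρr, hρr]
      refine Set.disjoint_image_image fun x hx y hy hxy => ?_
      have := hf.injOn (hPX ▸ Set.mem_iUnion_of_mem k hx) (hPX ▸ Set.mem_iUnion_of_mem l hy) hxy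
      subst this
      exact Set.disjoint_left.1 (hPp hkl) hx hy) fun h k x hx => hx.2
  -- The target pieces were defined by the moved formulas together with `Y.fml`. Here they are seen
  -- to be eventually the exact affine images of the source pieces.
  have hsame : ∀ k, ∀ᶠ h in posFilter Γ,
      (ρ k).real h = ((π' k).image (M k) fun j => (a k j : Γ)).real h := by
    intro k
    have h1 : ∀ᶠ h in posFilter Γ, (π' k).real h ⊆
        (Y.fml.comp fun i => (fun l => ((M k).1 i l : ℚ), (a k i : Γ))).real h := by
      refine (X.evBdd_fml.inter _).eventually_subset fun x hx => ?_
      have hx' : x ∈ P k := by rwa [hπr] at hx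
      rw [Fml.mem_real_comp_affEquiv, Y.real_fml]
      have := hf.mapsTo (hPX ▸ Set.mem_iUnion_of_mem k hx')
      rwa [hfP k x hx'] at this
    have h2 : ∀ᶠ h in posFilter Γ, (ρ k).real h ⊆
        (X.fml.image (M k) fun j => (a k j : Γ)).real h := by
      refine (Y.evBdd_fml.inter _).eventually_subset fun y hy => ?_
      have hy' : y ∈ f '' P k := by rwa [hρr] at hy
      obtain ⟨x, hx, rfl⟩ := hy'
      rw [Fml.mem_real_image, X.real_fml, hfP k _ hx]
      change (affEquiv (M k) fun j => (a k j : Γ)).symm _ ∈ _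
      rw [Equiv.symm_apply_apply]
      exact hPX ▸ Set.mem_iUnion_of_mem k hx
    filter_upwards [h1, h2] with h h1 h2
    ext y
    constructor
    · intro hy
      exact ⟨hy.1, h2 hy⟩
    · intro hy
      refine ⟨hy.1, ?_⟩
      have := h1 ((Fml.mem_real_image _ _ _ _ _).1 hy)
      rwa [Fml.mem_real_comp_affEquiv, Equiv.apply_symm_apply] at this
  -- This is where the integrality part of `posFilter` makes translations preserve `ℤ^n`.
  have hint : ∀ᶠ h in posFilter Γ, ∀ k j, ∃ z : ℤ, h (a k j) = (z : ℚ) :=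
    Filter.eventually_all.2 fun k => Filter.eventually_all.2 fun j => eventually_int _
  filter_upwards [eX, eY, Filter.eventually_all.2 hsame, hint] with h eX eY hs hi
  choose b hb using hi
  rw [Obj.count, Obj.count, Set.ncard_def, Set.ncard_def, eX, eY]
  congr 1
  refine finsum_congr fun k => ?_
  have : (ρ k).points h = (affEquiv (M k) (b k)) '' ((π' k).points h) := by
    ext z
    rw [Equiv.image_eq_preimage_symm]
    change _ ∈ (ρ k).real h ↔ _ ∈ (π' k).real h
    rw [hs, Fml.mem_real_image]
    refine iff_of_eq (congrArg (· ∈ (π' k).real h) (funext fun i => ?_))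
    change intAct _ _ _ = ((intAct _ _ _ : ℤ) : ℚ)
    simp [intAct, hb]
  rw [this, (affEquiv (M k) (b k)).injective.encard_image]

end Counting

end BoundedPolytopes

namespace BoundedPolytopes

/-! ## The measure that counts integral points -/

section CountingMeasure

variable {Γ : Type*} [AddCommGroup Γ] [LinearOrder Γ] [IsOrderedAddMonoid Γ] [Module ℚ Γ]
variable {A : AddSubgroup Γ}

theorem Obj.eventually_count_empty (n : ℕ) :
    ∀ᶠ h in posFilter Γ, (Obj.empty A n).count h = 0 := by
  have := (Obj.empty A n).eventually_count_eq (φ := Fml.neg 0)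
    ⟨0, Filter.Eventually.of_forall fun h x hx => by simp [Fml.real, Aff.eval] at hx⟩
    (by ext x; simp [Fml.real, Aff.eval, Obj.empty])
  filter_upwards [this] with h hh
  rw [hh]
  simp [Fml.points, Fml.real, Aff.eval]

theorem Obj.eventually_count_point : ∀ᶠ h in posFilter Γ, (Obj.point A).count h = 1 := by
  have := (Obj.point A).eventually_count_eq (φ := Fml.compl (Fml.neg 0))
    ⟨0, Filter.Eventually.of_forall fun h x _ i => i.elim0⟩
    (by ext x; simp [Fml.real, Aff.eval, Obj.point])
  filter_upwards [this] with h hh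
  rw [hh, Set.ncard_eq_one]
  refine ⟨default, Set.eq_singleton_iff_unique_mem.2 ⟨?_, fun z _ => Subsingleton.elim _ _⟩⟩
  simp [Fml.points, Fml.real, Aff.eval]

theorem Aff.eval_single {H : Type*} [AddCommGroup H] [LinearOrder H] [Module ℚ H]
    (h : Γ →ₗ[ℚ] H) {n : ℕ} (i : Fin n) (x : Fin n → H) :
    Aff.eval h ((Pi.single i 1, 0) : Aff Γ n) x = x i := by
  rw [Aff.eval, Finset.sum_eq_single i (fun j _ hj => by simp [Pi.single_eq_of_ne hj]) (by simp)]
  simp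

theorem Obj.eventually_count_prod {n m : ℕ} (X : Obj A n) (Y : Obj A m) :
    ∀ᶠ h in posFilter Γ, (X.prod Y).count h = X.count h * Y.count h := by
  let π₁ : Fin n → Aff Γ (n + m) := fun i => (Pi.single (Fin.castAdd m i) 1, 0)
  let π₂ : Fin m → Aff Γ (n + m) := fun i => (Pi.single (Fin.natAdd n i) 1, 0)
  have hb : ((X.fml.comp π₁).inter (Y.fml.comp π₂)).EvBdd := by
    obtain ⟨γ, hγ⟩ := X.evBdd_fml
    obtain ⟨δ, hδ⟩ := Y.evBdd_fml
    refine ⟨max γ δ, ?_⟩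
    filter_upwards [hγ, hδ, eventually_le (le_max_left γ δ), eventually_le (le_max_right γ δ)] with
      h h1 h2 h3 h4 x hx
    have h5 := h1 ((Fml.mem_real_comp _ _ _ _).1 hx.1)
    have h6 := h2 ((Fml.mem_real_comp _ _ _ _).1 hx.2)
    intro i
    refine Fin.addCases (fun i => ?_) (fun i => ?_) i
    · have := h5 i
      simp only [π₁, Aff.eval_single] at this
      exact ⟨(neg_le_neg h3).trans this.1, this.2.trans h3⟩
    · have := h6 i
      simp only [π₂, Aff.eval_single] at this
      exact ⟨(neg_le_neg h4).trans this.1, this.2.trans h4⟩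
  have := (X.prod Y).eventually_count_eq hb (by
    ext x
    change x ∈ (X.fml.comp π₁).real _ ∧ x ∈ (Y.fml.comp π₂).real _ ↔ _
    rw [Fml.mem_real_comp, Fml.mem_real_comp, X.real_fml, Y.real_fml]
    simp only [π₁, π₂, Aff.eval_single]
    rfl)
  filter_upwards [this] with h hh
  rw [hh, Obj.count, Obj.count, ← Set.ncard_prod,
    ← Set.ncard_image_of_injective _ (Fin.appendEquiv n m).injective]
  congr 1
  ext z
  rw [Equiv.image_eq_preimage_symm]
  change _ ∈ (X.fml.comp π₁).real _ ∧ _ ∈ (Y.fml.comp π₂).real _ ↔ _ ∈ X.fml.real _ ∧ _ ∈ Y.fml.real _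
  rw [Fml.mem_real_comp, Fml.mem_real_comp]
  simp only [π₁, π₂, Aff.eval_single]
  rfl

/-- The formula `0 ≤ x < a` in one variable. -/
def Fml.interval (a : Γ) : Fml Γ 1 := (Fml.compl (Fml.neg (1, 0))).inter (Fml.neg (1, -a))

/-- The formula `x = 0` in one variable. -/
def Fml.zero : Fml Γ 1 := (Fml.compl (Fml.neg (1, 0))).inter (Fml.compl (Fml.neg (-1, 0)))

theorem Obj.eventually_count_zero : ∀ᶠ h in posFilter Γ, (Obj.zero A).count h = 1 := by
  have h1 : ∀ h : Γ →ₗ[ℚ] ℚ, (Fml.zero (Γ := Γ)).real h = {x | x 0 = 0} := fun h => by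
    ext x; simp [Fml.zero, Fml.real, Aff.eval, le_antisymm_iff, and_comm]
  have := (Obj.zero A).eventually_count_eq (φ := Fml.zero)
    ⟨0, Filter.Eventually.of_forall fun h x hx i => by
      rw [h1] at hx
      rw [Subsingleton.elim i 0]
      simp [show x 0 = 0 from hx]⟩
    (by ext x; simp [Fml.zero, Fml.real, Aff.eval, Obj.zero, le_antisymm_iff, and_comm])
  filter_upwards [this] with h hh
  rw [hh, Set.ncard_eq_one]
  refine ⟨0, ?_⟩
  ext z
  simp only [Fml.points, h1, Set.mem_ofPred_eq, Int.cast_eq_zero, Set.mem_singleton_iff]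
  constructor
  · intro hz; funext i; rw [Subsingleton.elim i 0]; exact hz
  · intro hz; rw [hz]; rfl

/-- When `h a` is an integer, `[0, h a)` contains exactly `max (h a) 0` integers. Together with the
count for `-a` this makes `ι(a)` correspond to `h a`. -/
theorem Obj.eventually_count_interval (a : A) :
    ∀ᶠ h in posFilter Γ, ((Obj.interval a).count h : ℚ) = max (h a) 0 := by
  have h1 : ∀ h : Γ →ₗ[ℚ] ℚ, (Fml.interval (a : Γ)).real h = {x | 0 ≤ x 0 ∧ x 0 < h a} := fun h => by
    ext x; simp [Fml.interval, Fml.real, Aff.eval, ← sub_eq_add_neg]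
  have := (Obj.interval a).eventually_count_eq (φ := Fml.interval (a : Γ))
    ⟨(a : Γ), Filter.Eventually.of_forall fun h x hx i => by
      rw [h1] at hx
      rw [Subsingleton.elim i 0]
      exact ⟨(neg_nonpos.2 (hx.1.trans hx.2.le)).trans hx.1, hx.2.le⟩⟩
    (by ext x; simp [Fml.interval, Fml.real, Aff.eval, Obj.interval, ← sub_eq_add_neg])
  filter_upwards [this, eventually_int (a : Γ)] with h hh hi
  obtain ⟨k, hk⟩ := hi
  rw [hh, Fml.points, h1, hk]
  have : {z : Fin 1 → ℤ | (fun i => (z i : ℚ)) ∈ {x : Fin 1 → ℚ | 0 ≤ x 0 ∧ x 0 < k}} =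
      (Equiv.funUnique (Fin 1) ℤ) ⁻¹' (Finset.Ico 0 k : Finset ℤ) := by
    ext z
    simp
  rw [this, Set.ncard_def, Set.encard_preimage_of_bijective (Equiv.bijective _), ← Set.ncard_def,
    Set.ncard_coe_finset, Int.card_Ico, sub_zero]
  have h3 : ((k.toNat : ℤ) : ℚ) = ((max k 0 : ℤ) : ℚ) := by rw [Int.toNat_eq_max]
  rw [Int.cast_max, Int.cast_zero, Int.cast_natCast] at h3
  exact h3

/-- The ring of germs at infinity of functions of the interpretation of the parameters. -/
abbrev CountRing (Γ : Type*) [AddCommGroup Γ] [LinearOrder Γ] [IsOrderedAddMonoid Γ]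
    [Module ℚ Γ] : Type _ := Filter.Germ (posFilter Γ) ℚ

instance : Algebra ℚ (CountRing Γ) :=
  ((Filter.Germ.coeRingHom (posFilter Γ)).comp (algebraMap ℚ ((Γ →ₗ[ℚ] ℚ) → ℚ))).toAlgebra

variable (A) in
/-- Counting integral points as a measure. -/
def countMeasure : DFMeasure A (CountRing Γ) where
  toFun X := ((fun h => (X.count h : ℚ) : (Γ →ₗ[ℚ] ℚ) → ℚ) : CountRing Γ)
  empty' n := Filter.Germ.coe_eq.2 <| by
    filter_upwards [Obj.eventually_count_empty (A := A) n] with h hh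
    simp [hh]
  add' X₁ X₂ Z hZ hd := Filter.Germ.coe_eq.2 <| by
    filter_upwards [Obj.eventually_count_add X₁ X₂ Z hZ hd] with h hh
    simp [← hh]
  iso' X Y hXY := Filter.Germ.coe_eq.2 <| by
    filter_upwards [Obj.eventually_count_iso X Y hXY] with h hh
    simp [hh]
  prod' X Y := Filter.Germ.coe_eq.2 <| by
    filter_upwards [Obj.eventually_count_prod X Y] with h hh
    simp [hh]
  zero' := Filter.Germ.coe_eq.2 <| by
    filter_upwards [Obj.eventually_count_zero (A := A)] with h hh
    simp [hh]
  point' := Filter.Germ.coe_eq.2 <| by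
    filter_upwards [Obj.eventually_count_point (A := A)] with h hh
    simp [hh]

variable (A) in
/-- The evaluation of the symmetric algebra at a functional. -/
def evalT (h : Γ →ₗ[ℚ] ℚ) : T A →ₐ[ℚ] ℚ :=
  SymmetricAlgebra.lift (LinearMap.liftBaseChange ℚ
    (h.toAddMonoidHom.comp A.subtype).toIntLinearMap)

theorem evalT_ι (h : Γ →ₗ[ℚ] ℚ) (a : A) :
    evalT A h (SymmetricAlgebra.ι ℚ (ℚ ⊗[ℤ] A) (1 ⊗ₜ[ℤ] a)) = h a := by
  simp [evalT]

theorem T_algHom_ext {R : Type*} [CommRing R] [Algebra ℚ R] {f g : T A →ₐ[ℚ] R}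
    (hfg : ∀ a : A, f (SymmetricAlgebra.ι ℚ (ℚ ⊗[ℤ] A) (1 ⊗ₜ[ℤ] a)) =
      g (SymmetricAlgebra.ι ℚ (ℚ ⊗[ℤ] A) (1 ⊗ₜ[ℤ] a))) : f = g := by
  refine SymmetricAlgebra.algHom_ext (LinearMap.ext fun x => ?_)
  induction x using TensorProduct.induction_on with
  | zero => simp
  | add x y hx hy => rw [map_add, map_add, hx, hy]
  | tmul q a =>
    have : q ⊗ₜ[ℤ] a = q • ((1 : ℚ) ⊗ₜ[ℤ] a) := by rw [TensorProduct.smul_tmul', smul_eq_mul, mul_one]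
    rw [this, map_smul, map_smul]
    exact congrArg (q • ·) (hfg a)

/-- Counting after `φ_A`, and the germ of `h ↦ evalT A h`, are algebra homomorphisms on `T A` that
agree on the generators `a ∈ A`, since `max (h a) 0 - max (-h a) 0 = h a`. -/
theorem eventually_evalT_eq_zero {t : T A} (ht : phi A t = 0) :
    ∀ᶠ h in posFilter Γ, evalT A h t = 0 := by
  have key : (countMeasure A).onKQdf.comp (phi A) =
      ((Filter.Germ.coeRingHom (posFilter Γ)).comp
        (RingHom.pi fun h => (evalT A h).toRingHom)).toRatAlgHom := by
    refine T_algHom_ext fun a => ?_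
    rw [AlgHom.comp_apply, phi_apply, DFMeasure.onKQdf_iota]
    change ((fun h => ((Obj.interval a).count h : ℚ) - ((Obj.interval (-a)).count h : ℚ) :
      (Γ →ₗ[ℚ] ℚ) → ℚ) : CountRing Γ) = ((fun h => evalT A h (SymmetricAlgebra.ι ℚ (ℚ ⊗[ℤ] A) (1 ⊗ₜ[ℤ] a)) : (Γ →ₗ[ℚ] ℚ) → ℚ) : CountRing Γ)
    refine Filter.Germ.coe_eq.2 ?_
    filter_upwards [Obj.eventually_count_interval a, Obj.eventually_count_interval (-a)] with h h1 h2
    rw [h1, h2, evalT_ι, AddSubgroup.coe_neg, map_neg]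
    rcases le_total 0 (h a) with h3 | h3
    · rw [max_eq_left h3, max_eq_right (neg_nonpos.2 h3), sub_zero]
    · rw [max_eq_right h3, max_eq_left (neg_nonneg.2 h3), zero_sub, neg_neg]
  have h1 := DFunLike.congr_fun key t
  rw [AlgHom.comp_apply, ht, map_zero] at h1
  exact Filter.Germ.coe_eq.1 h1.symm

end CountingMeasure

end BoundedPolytopes

namespace BoundedPolytopes

/-! ## Injectivity -/

section Injectivity

variable {Γ : Type*} [AddCommGroup Γ] [LinearOrder Γ] [IsOrderedAddMonoid Γ] [Module ℚ Γ]
variable {A : AddSubgroup Γ}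

/-- Finitely many positive elements are positive under a common functional. -/
theorem exists_functional_pos (s : Finset Γ) (hs : ∀ p ∈ s, 0 < p) :
    ∃ h : Γ →ₗ[ℚ] ℚ, ∀ p ∈ s, 0 < h p := by
  rcases s.eq_empty_or_nonempty with rfl | ⟨p₀, hp₀⟩
  · exact ⟨0, by simp⟩
  let V := Submodule.span ℚ (s : Set Γ)
  have _ : FiniteDimensional ℚ V := FiniteDimensional.span_finset ℚ s
  let b := Module.finBasis ℚ V
  let d := Module.finrank ℚ V
  let c : s → Fin d → ℚ := fun p => b.repr ⟨p, Submodule.subset_span p.2⟩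
  have hc : ∀ p : s, (p : Γ) = ∑ i, c p i • (b i : Γ) := fun p => by
    have := congrArg (Submodule.subtype V) (b.sum_repr ⟨p, Submodule.subset_span p.2⟩)
    rw [map_sum] at this
    simpa using this.symm
  -- In coordinates with respect to a basis of the span of `s`, a suitable functional is a rational
  -- solution of finitely many strict homogeneous inequalities. The basis itself is a solution in
  -- `Γ`.
  let φ : Fml ℚ d := Fml.compl (Fml.any (Finset.univ.toList.map fun p : s =>
    Fml.compl (Fml.neg (-c p, 0))))
  have hφ : ∀ {H : Type _} [AddCommGroup H] [LinearOrder H] [IsOrderedAddMonoid H] [Module ℚ H]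
      (h : ℚ →ₗ[ℚ] H) (x : Fin d → H), x ∈ φ.real h ↔ ∀ p : s, 0 < ∑ i, c p i • x i := by
    intro H _ _ _ _ h x
    change ¬ (x ∈ (Fml.any _).real h) ↔ _
    rw [Fml.mem_real_any]
    simp [Fml.real, Aff.eval]
  have hφ' : ∀ x : Fin d → ℚ, x ∈ φ.real LinearMap.id ↔ ∀ p : s, 0 < ∑ i, c p i • x i := by
    intro x
    change ¬ (x ∈ (Fml.any _).real LinearMap.id) ↔ _
    rw [Fml.mem_real_any]
    simp [Fml.real, Aff.eval]
  obtain ⟨y, hy⟩ : ∃ y : Fin d → ℚ, ∀ p : s, 0 < ∑ i, c p i • y i := by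
    by_contra hno
    -- A bound for the basis vectors that is strictly positive because of `p₀`. The transfer runs
    -- from `ℚ` to `Γ` along `r ↦ r • γ`, so the box of size `1` becomes the box of size `γ`.
    let γ : Γ := p₀ + ∑ i, |(b i : Γ)|
    have hsum : ∀ i, |(b i : Γ)| ≤ ∑ i, |(b i : Γ)| := fun i =>
      Finset.single_le_sum (f := fun i => |(b i : Γ)|) (fun _ _ => abs_nonneg _)
        (Finset.mem_univ i)
    have hγ : 0 < γ := add_pos_of_pos_of_nonneg (hs p₀ hp₀)
      (Finset.sum_nonneg fun _ _ => abs_nonneg _)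
    have h1 := Fml.eventually_real_inter_box_eq_empty (F := (⊤ : Filter Unit))
      (h := fun _ => LinearMap.toSpanSingleton ℚ Γ γ)
      (fun p hp => Filter.Eventually.of_forall fun _ => smul_pos hp hγ) φ 1
      fun x hx _ => hno ⟨x, (hφ' x).1 hx⟩
    rw [Filter.eventually_top] at h1
    refine h1 () (fun i => (b i : Γ)) ((hφ _ _).2 fun p => by rw [← hc]; exact hs p p.2) ?_
    intro i
    rw [LinearMap.toSpanSingleton_apply, one_smul, ← abs_le]
    exact (hsum i).trans (le_add_of_nonneg_left (hs p₀ hp₀).le)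
  obtain ⟨h, hh⟩ := LinearMap.exists_extend (b.constr ℚ y)
  refine ⟨h, fun p hp => ?_⟩
  have h2 : ∀ i, h (b i : Γ) = y i := fun i => by
    have := DFunLike.congr_fun hh (b i)
    rwa [b.constr_basis] at this
  have h3 : p = _ := hc ⟨p, hp⟩
  rw [h3, map_sum]
  simpa only [map_smul, h2] using hy ⟨p, hp⟩

/-- The evaluation of an element of the symmetric algebra along a line of functionals is a
polynomial. -/
theorem evalT_line_eq_zero (t : T A) (u v : Γ →ₗ[ℚ] ℚ) (k₀ : ℕ)
    (hk : ∀ k : ℕ, k₀ ≤ k → evalT A ((k : ℚ) • u + v) t = 0) (q : ℚ) :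
    evalT A (q • u + v) t = 0 := by
  let E : T A →ₐ[ℚ] Polynomial ℚ := SymmetricAlgebra.lift (LinearMap.liftBaseChange ℚ
    (AddMonoidHom.mk' (fun a : A => Polynomial.C (v a) + Polynomial.X * Polynomial.C (u a))
      fun a b => by simp only [AddSubgroup.coe_add, map_add]; ring).toIntLinearMap)
  have hE : ∀ q : ℚ, (Polynomial.aeval q).comp E = evalT A (q • u + v) := fun q => by
    refine T_algHom_ext fun a => ?_
    rw [evalT_ι]
    simp [E]
    ring
  have h1 : E t = 0 := by
    refine Polynomial.eq_zero_of_infinite_isRoot _ ?_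
    refine ((Set.infinite_coe_iff.1 (inferInstance : Infinite (Set.Ici k₀))).image
      (f := fun k : ℕ => (k : ℚ)) Nat.cast_injective.injOn).mono ?_
    rintro _ ⟨k, hk', rfl⟩
    have := DFunLike.congr_fun (hE k) t
    rw [AlgHom.comp_apply, hk k hk', Polynomial.coe_aeval_eq_eval] at this
    exact this
  rw [← hE, AlgHom.comp_apply, h1, map_zero]

theorem exists_common_denominator (t : Finset Γ) (u : Γ →ₗ[ℚ] ℚ) :
    ∃ N : ℕ, N ≠ 0 ∧ ∀ a ∈ t, ∃ k : ℤ, (N : ℚ) * u a = (k : ℚ) := by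
  refine ⟨∏ a ∈ t, (u a).den, Finset.prod_ne_zero_iff.2 fun a _ => (u a).den_nz, fun a ha => ?_⟩
  obtain ⟨m, hm⟩ := Finset.dvd_prod_of_mem (fun a => (u a).den) ha
  refine ⟨m * (u a).num, ?_⟩
  rw [hm]
  push_cast
  rw [mul_comm ((u a).den : ℚ), mul_assoc, Rat.den_mul_eq_num]

/-- Two polynomial continuations. For fixed `j` the functional `k N h₀ + j M g` is admissible for
all large `k`, because `h₀` is positive on `s` and the denominators are cleared. Vanishing for these
`k` forces vanishing at `k = 0`. Then the values at `j M g`, for all natural `j`, determine the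
value at `g`. -/
theorem evalT_eq_zero_of_eventually {t : T A} (ht : ∀ᶠ h in posFilter Γ, evalT A h t = 0)
    (g : Γ →ₗ[ℚ] ℚ) : evalT A g t = 0 := by
  obtain ⟨s, r, hs, hsr⟩ := ht
  obtain ⟨h₀, hh₀⟩ := exists_functional_pos s hs
  obtain ⟨N, hN, hNr⟩ := exists_common_denominator r h₀
  obtain ⟨M, hM, hMr⟩ := exists_common_denominator r g
  have hN' : (0 : ℚ) < N := by exact_mod_cast Nat.pos_of_ne_zero hN
  have h1 : ∀ j : ℕ, evalT A ((j : ℚ) • ((M : ℚ) • g) + 0) t = 0 := by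
    intro j
    have h2 : ∃ k₀ : ℕ, ∀ p ∈ s, ∀ k : ℕ, k₀ ≤ k →
        0 < ((k : ℚ) • ((N : ℚ) • h₀) + (j : ℚ) • ((M : ℚ) • g)) p := by
      have : ∀ p ∈ s, ∀ᶠ k : ℕ in Filter.atTop,
          0 < ((k : ℚ) • ((N : ℚ) • h₀) + (j : ℚ) • ((M : ℚ) • g)) p := by
        intro p hp
        have hpos : 0 < (N : ℚ) * h₀ p := mul_pos hN' (hh₀ p hp)
        obtain ⟨k₀, hk₀⟩ := exists_nat_gt (-((j : ℚ) * (M * g p)) / (N * h₀ p))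
        filter_upwards [Filter.eventually_ge_atTop k₀] with k hk
        rw [div_lt_iff₀ hpos] at hk₀
        have : (k₀ : ℚ) * (N * h₀ p) ≤ k * (N * h₀ p) :=
          mul_le_mul_of_nonneg_right (by exact_mod_cast hk) hpos.le
        simp only [LinearMap.add_apply, LinearMap.smul_apply, smul_eq_mul]
        linarith
      obtain ⟨k₀, hk₀⟩ := Filter.eventually_atTop.1 ((Finset.eventually_all s).2 this)
      exact ⟨k₀, fun p hp k hk => hk₀ k hk p hp⟩
    obtain ⟨k₀, hk₀⟩ := h2
    have h3 := evalT_line_eq_zero t ((N : ℚ) • h₀) ((j : ℚ) • ((M : ℚ) • g)) k₀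
      (fun k hk => hsr _ (fun p hp => hk₀ p hp k hk) fun a ha => by
        obtain ⟨c, hc⟩ := hNr a ha
        obtain ⟨d, hd⟩ := hMr a ha
        refine ⟨k * c + j * d, ?_⟩
        simp [hc, hd]) 0
    rwa [zero_smul, zero_add, ← add_zero ((j : ℚ) • _)] at h3
  have h4 := evalT_line_eq_zero t ((M : ℚ) • g) 0 0 (fun k _ => h1 k) (M : ℚ)⁻¹
  rwa [smul_smul, inv_mul_cancel₀ (by exact_mod_cast hM), one_smul, add_zero] at h4

/-- Every element of `ℚ ⊗ A` has a nonzero integral multiple of the form `1 ⊗ a`, and on these the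
map is the inclusion of `A`. -/
theorem liftBaseChange_subtype_injective : Function.Injective
    (LinearMap.liftBaseChange ℚ A.subtype.toIntLinearMap : ℚ ⊗[ℤ] A →ₗ[ℚ] Γ) := by
  rw [injective_iff_map_eq_zero]
  intro x hx
  have : ∃ (n : ℤ) (a : A), n ≠ 0 ∧ (n : ℚ) • x = (1 : ℚ) ⊗ₜ[ℤ] a := by
    clear hx
    induction x using TensorProduct.induction_on with
    | zero => exact ⟨1, 0, one_ne_zero, by simp⟩
    | tmul q a =>
      refine ⟨q.den, q.num • a, by exact_mod_cast q.den_nz, ?_⟩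
      rw [TensorProduct.smul_tmul', smul_eq_mul, Int.cast_natCast, Rat.den_mul_eq_num,
        TensorProduct.tmul_smul, TensorProduct.smul_tmul', zsmul_eq_mul, mul_one]
    | add x y hx hy =>
      obtain ⟨n, a, hn, hna⟩ := hx
      obtain ⟨m, b, hm, hmb⟩ := hy
      refine ⟨n * m, m • a + n • b, mul_ne_zero hn hm, ?_⟩
      rw [TensorProduct.tmul_add, TensorProduct.tmul_smul, TensorProduct.tmul_smul, ← hna, ← hmb,
        ← Int.cast_smul_eq_zsmul ℚ, ← Int.cast_smul_eq_zsmul ℚ, smul_smul, smul_smul, smul_add,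
        Int.cast_mul, mul_comm (m : ℚ)]
  obtain ⟨n, a, hn, hna⟩ := this
  have h1 := congrArg (LinearMap.liftBaseChange ℚ A.subtype.toIntLinearMap) hna
  rw [map_smul, hx, smul_zero] at h1
  have h2 : a = 0 := by
    apply Subtype.ext
    simpa using h1.symm
  rw [h2, TensorProduct.tmul_zero] at hna
  exact (smul_eq_zero.1 hna).resolve_left (by exact_mod_cast hn)

/-- A linear left inverse of `ℚ ⊗ A → Γ` extends every functional on `ℚ ⊗ A` to `Γ`. Hence `t`, seen
as a polynomial in the coordinates of a basis, vanishes at all rational points. -/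
theorem eq_zero_of_evalT_eq_zero {t : T A} (ht : ∀ g : Γ →ₗ[ℚ] ℚ, evalT A g t = 0) : t = 0 := by
  let b := Module.Free.chooseBasis ℚ (ℚ ⊗[ℤ] A)
  let e := SymmetricAlgebra.equivMvPolynomial b
  obtain ⟨j', hj'⟩ := LinearMap.exists_leftInverse_of_injective _
    (LinearMap.ker_eq_bot.2 (liftBaseChange_subtype_injective (A := A)))
  suffices e t = 0 from (map_eq_zero_iff e e.injective).1 this
  refine MvPolynomial.funext fun y => ?_
  rw [map_zero, ← ht ((b.constr ℚ y).comp j')]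
  have : (MvPolynomial.aeval y).comp e.toAlgHom = evalT A ((b.constr ℚ y).comp j') := by
    refine SymmetricAlgebra.algHom_ext (b.ext fun i => ?_)
    have h1 : evalT A ((b.constr ℚ y).comp j') ∘ₗ SymmetricAlgebra.ι ℚ (ℚ ⊗[ℤ] A) =
        b.constr ℚ y := by
      refine LinearMap.ext fun x => ?_
      induction x using TensorProduct.induction_on with
      | zero => simp
      | add x y hx hy => rw [map_add, map_add, hx, hy]
      | tmul q a =>
        have h2 : q ⊗ₜ[ℤ] a = q • ((1 : ℚ) ⊗ₜ[ℤ] a) := by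
          rw [TensorProduct.smul_tmul', smul_eq_mul, mul_one]
        rw [h2, map_smul, map_smul]
        refine congrArg (q • ·) ((evalT_ι _ a).trans ?_)
        have h3 := DFunLike.congr_fun hj' ((1 : ℚ) ⊗ₜ[ℤ] a)
        simp only [LinearMap.comp_apply, LinearMap.liftBaseChange_tmul, one_smul] at h3
        exact congrArg (b.constr ℚ y) h3
    refine Eq.trans ?_ (DFunLike.congr_fun h1 (b i)).symm
    rw [b.constr_basis]
    change MvPolynomial.aeval y (e (SymmetricAlgebra.ι ℚ _ (b i))) = y i
    rw [SymmetricAlgebra.equivMvPolynomial_ι_apply, MvPolynomial.aeval_X]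
  exact DFunLike.congr_fun this t

variable (A) in
theorem phi_injective : Function.Injective (phi A) := by
  rw [injective_iff_map_eq_zero]
  exact fun t ht => eq_zero_of_evalT_eq_zero
    (evalT_eq_zero_of_eventually (eventually_evalT_eq_zero ht))

end Injectivity

end BoundedPolytopes

namespace BoundedPolytopes

/-! ## Classes in the dimension-free Grothendieck ring -/

section Classes

variable {Γ : Type*} [AddCommGroup Γ] [LinearOrder Γ] [IsOrderedAddMonoid Γ]
variable {A : AddSubgroup Γ}

theorem dimFree.frac_mul {R : ℕ → Type*} [∀ i, AddCommMonoid (R i)] [DirectSum.GCommSemiring R]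
    (a : R 1) {n m : ℕ} (r : R n) (s : R m) :
    frac a (GradedMonoid.GMul.mul r s) = frac a r * frac a s := by
  apply Subtype.ext
  change Localization.mk _ _ = Localization.mk _ _ * Localization.mk _ _
  rw [Localization.mk_mul, DirectSum.of_mul_of]
  exact congrArg (Localization.mk _) (Subtype.ext (pow_add _ n m))

theorem dimFree.frac_self {R : ℕ → Type*} [∀ i, AddCommMonoid (R i)] [DirectSum.GCommSemiring R]
    (a : R 1) : frac a a = 1 := by
  apply Subtype.ext
  change Localization.mk _ _ = 1
  rw [← Localization.mk_self (Submonoid.pow (DirectSum.of R 1 a) 1)]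
  exact congrArg (fun x => Localization.mk x _) (pow_one _).symm

theorem dimFree.frac_one {R : ℕ → Type*} [∀ i, AddCommMonoid (R i)] [DirectSum.GCommSemiring R]
    (a : R 1) : frac a (GradedMonoid.GOne.one : R 0) = 1 := by
  apply Subtype.ext
  change Localization.mk _ _ = 1
  rw [← Localization.mk_one]
  exact congrArg (Localization.mk _) (Subtype.ext (pow_zero (DirectSum.of R 1 a)))

theorem Kdf.cls_eq_of_iso {n : ℕ} {X Y : Obj A n} (h : Iso A X.carrier Y.carrier) :
    Kdf.cls X = Kdf.cls Y := by
  rw [Kdf.cls, Kdf.cls, BoundedPolytopes.cls_eq_of_iso h]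

theorem Kdf.cls_union {n : ℕ} {X Y Z : Obj A n} (hZ : Z.carrier = X.carrier ∪ Y.carrier)
    (hd : Disjoint X.carrier Y.carrier) : Kdf.cls Z = Kdf.cls X + Kdf.cls Y := by
  rw [Kdf.cls, ← cls_add X Y Z X Y hZ hd (Iso.refl X.definable) (Iso.refl Y.definable),
    dimFree.frac_add, map_add]
  rfl

theorem Kdf.cls_prod {n m : ℕ} (X : Obj A n) (Y : Obj A m) :
    Kdf.cls (X.prod Y) = Kdf.cls X * Kdf.cls Y := by
  rw [Kdf.cls, ← SG.mulHom_cls, Kdf.cls, Kdf.cls, ← map_mul, ← dimFree.frac_mul]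
  rfl

theorem Kdf.cls_zero : Kdf.cls (Obj.zero A) = 1 := by
  rw [Kdf.cls, dimFree.frac_self, map_one]

theorem Kdf.cls_point : Kdf.cls (Obj.point A) = 1 := by
  rw [Kdf.cls, ← map_one (RingOf.of _)]
  exact congrArg _ (dimFree.frac_one _)

theorem Kdf.cls_empty (n : ℕ) : Kdf.cls (Obj.empty A n) = 0 := by
  rw [Kdf.cls, BoundedPolytopes.cls_empty, dimFree.frac_zero, map_zero]

variable (A) in
/-- The class of `X` in `K_ℚ^df` is in the image of the symmetric algebra. -/
def InS {n : ℕ} (X : Set (Fin n → Γ)) : Prop :=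
  ∃ Y : Obj A n, Y.carrier = X ∧ (1 : ℚ) ⊗ₜ[ℤ] Kdf.cls Y ∈ (phi A).range

theorem SG.cls_induction {n : ℕ} {p : SG A n → Prop} (h0 : p 0) (hcls : ∀ X : Obj A n, p (cls X))
    (hadd : ∀ x y, p x → p y → p (x + y)) (x : SG A n) : p x := by
  let S : AddSubmonoid (SG A n) :=
    { carrier := {x | p x}, zero_mem' := h0, add_mem' := fun {x y} hx hy => hadd x y hx hy }
  let f : SG A n →+ S := SG.lift (fun X => ⟨cls X, hcls X⟩)
    (Subtype.ext (BoundedPolytopes.cls_empty n)) fun X₁ X₂ Z Z₁ Z₂ hZ hd h₁ h₂ =>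
      Subtype.ext (cls_add X₁ X₂ Z Z₁ Z₂ hZ hd h₁ h₂)
  have : S.subtype.comp f = AddMonoidHom.id _ := SG.hom_ext fun X => by
    rw [AddMonoidHom.comp_apply, SG.lift_cls]
    rfl
  have h := DFunLike.congr_fun this x
  rw [AddMonoidHom.comp_apply, AddMonoidHom.id_apply] at h
  exact h ▸ (f x).2

/-- Every element of `K^df` is an integral combination of fractions `[X]_n / [0]_1^n`, so it
suffices to reach the classes of objects. -/
theorem phi_surjective_of_inS (h : ∀ (n : ℕ) (X : Obj A n), InS A X.carrier) :
    Function.Surjective (phi A) := by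
  have h1 : ∀ (n : ℕ) (X : Obj A n), (1 : ℚ) ⊗ₜ[ℤ] Kdf.cls X ∈ (phi A).range := fun n X => by
    obtain ⟨Y, hY, hY'⟩ := h n X
    rwa [Obj.ext' hY] at hY'
  let H : AddSubgroup (Kdf A) := (phi A).range.toSubring.toAddSubgroup.comap
    (Algebra.TensorProduct.includeRight : Kdf A →ₐ[ℤ] KQdf A).toAddMonoidHom
  have h2 : ∀ s : SGdf A, RingOf.of _ s ∈ H := by
    rintro ⟨_, n, r, rfl⟩
    change RingOf.of _ (dimFree.frac (R := SG A) (cls (Obj.zero A)) r) ∈ H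
    refine SG.cls_induction (p := fun r => RingOf.of _ (dimFree.frac (R := SG A)
      (cls (Obj.zero A)) r) ∈ H) ?_ (fun X => h1 n X) (fun x y hx hy => ?_) r
    · rw [dimFree.frac_zero, map_zero]; exact zero_mem _
    · rw [dimFree.frac_add, map_add]; exact add_mem hx hy
  have h3 : ∀ k : Kdf A, k ∈ H := fun k =>
    TensorProduct.induction_on (motive := fun k : ℤ ⊗[ℕ] SGdf A => (show Kdf A from k) ∈ H) k
      H.zero_mem (fun z s => by
        have h4 : (z ⊗ₜ[ℕ] s : ℤ ⊗[ℕ] SGdf A) = z • ((1 : ℤ) ⊗ₜ[ℕ] s) := by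
          rw [TensorProduct.smul_tmul', smul_eq_mul, mul_one]
        rw [h4]
        exact H.zsmul_mem (h2 s) z) fun x y hx hy => H.add_mem hx hy
  intro k
  change k ∈ (phi A).range
  induction k using TensorProduct.induction_on with
  | zero => exact zero_mem _
  | add x y hx hy => exact add_mem hx hy
  | tmul q k =>
    have : q ⊗ₜ[ℤ] k = q • ((1 : ℚ) ⊗ₜ[ℤ] k) := by
      rw [TensorProduct.smul_tmul', smul_eq_mul, mul_one]
    rw [this]
    exact Subalgebra.smul_mem _ (h3 k) q

/-! ## Definable sets under integral affine maps -/

theorem IsDefinable.union {n : ℕ} {X Y : Set (Fin n → Γ)} (hX : IsDefinable A X)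
    (hY : IsDefinable A Y) : IsDefinable A (X ∪ Y) := by
  have := (hX.compl.inter _ _ hY.compl).compl
  rwa [Set.compl_inter, compl_compl, compl_compl] at this

theorem IsDefinable.diff {n : ℕ} {X Y : Set (Fin n → Γ)} (hX : IsDefinable A X)
    (hY : IsDefinable A Y) : IsDefinable A (X \ Y) :=
  hX.inter _ _ hY.compl

theorem IsDefinable.affine_preimage {n m : ℕ} (N : Matrix (Fin m) (Fin n) ℤ) (b : Fin m → A)
    {X : Set (Fin m → Γ)} (hX : IsDefinable A X) :
    IsDefinable A {x : Fin n → Γ | (intAct N x + fun j => (b j : Γ)) ∈ X} := by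
  induction hX with
  | lt c a =>
    have := IsDefinable.lt (A := A) (fun l => ∑ j, c j * N j l) (a - ∑ j, c j • b j)
    convert this using 1
    ext x
    have h1 : ∑ l, (∑ j, c j * N j l) • x l = ∑ j, c j • intAct N x j := by
      simp only [Finset.sum_smul, intAct, Finset.smul_sum, mul_smul]
      exact Finset.sum_comm
    simp only [Set.mem_ofPred_eq, h1, Pi.add_apply, smul_add, Finset.sum_add_distrib]
    rw [AddSubgroup.coe_sub, lt_sub_iff_add_lt, AddSubgroup.val_finsetSum]
    rfl
  | compl X _ ih => exact ih.compl
  | inter X Y _ _ ih₁ ih₂ => exact ih₁.inter _ _ ih₂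

theorem IsBounded.mono {n : ℕ} {X Y : Set (Fin n → Γ)} (hY : IsBounded Y) (h : X ⊆ Y) :
    IsBounded X := by
  obtain ⟨γ, hγ⟩ := hY
  exact ⟨γ, fun x hx => hγ x (h hx)⟩

theorem IsBounded.union {n : ℕ} {X Y : Set (Fin n → Γ)} (hX : IsBounded X) (hY : IsBounded Y) :
    IsBounded (X ∪ Y) := by
  obtain ⟨γ, hγ⟩ := hX
  obtain ⟨δ, hδ⟩ := hY
  refine ⟨max γ δ, ?_⟩
  rintro x (hx | hx) i
  · exact ⟨(neg_le_neg (le_max_left _ _)).trans (hγ x hx i).1, (hγ x hx i).2.trans (le_max_left _ _)⟩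
  · exact ⟨(neg_le_neg (le_max_right _ _)).trans (hδ x hx i).1,
      (hδ x hx i).2.trans (le_max_right _ _)⟩

theorem abs_intAct_le {n m : ℕ} (N : Matrix (Fin m) (Fin n) ℤ) (x : Fin n → Γ) (γ : Γ)
    (hx : ∀ i, |x i| ≤ γ) (j : Fin m) : |intAct N x j| ≤ ∑ l, |N j l| • γ := by
  refine (Finset.abs_sum_le_sum_abs _ _).trans (Finset.sum_le_sum fun l _ => ?_)
  rw [abs_zsmul]
  exact zsmul_le_zsmul_right (abs_nonneg _) (hx l)

theorem IsBounded.affine_image {n m : ℕ} (N : Matrix (Fin m) (Fin n) ℤ) (b : Fin m → Γ)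
    {X : Set (Fin n → Γ)} (hX : IsBounded X) :
    IsBounded ((fun x => intAct N x + b) '' X) := by
  obtain ⟨γ, hγ⟩ := hX
  refine ⟨∑ j, |∑ l, |N j l| • (|γ|)| + ∑ j, |b j|, ?_⟩
  rintro _ ⟨x, hx, rfl⟩ j
  rw [← abs_le]
  refine (abs_add_le _ _).trans (add_le_add ?_ ?_)
  · refine (abs_intAct_le N x |γ| (fun i => (abs_le.2 (hγ x hx i)).trans (le_abs_self _)) j).trans ?_
    refine (le_abs_self _).trans ?_
    exact Finset.single_le_sum (f := fun j => |∑ l, |N j l| • (|γ|)|) (fun _ _ => abs_nonneg _)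
      (Finset.mem_univ j)
  · exact Finset.single_le_sum (f := fun j => |b j|) (fun _ _ => abs_nonneg _) (Finset.mem_univ j)

theorem affEquiv_image_eq {n : ℕ} (M : Matrix.GeneralLinearGroup (Fin n) ℤ) (b : Fin n → Γ)
    (X : Set (Fin n → Γ)) : affEquiv M b '' X =
      {y | intAct (M⁻¹).1 y + (fun j => -intAct (M⁻¹).1 b j) ∈ X} := by
  rw [Equiv.image_eq_preimage_symm]
  ext y
  change intAct (M⁻¹).1 (y - b) ∈ X ↔ _
  rw [intAct_sub, sub_eq_add_neg]
  rfl

/-- The image of an object under an integral affine permutation. -/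
def Obj.affine {n : ℕ} (M : Matrix.GeneralLinearGroup (Fin n) ℤ) (b : Fin n → A) (X : Obj A n) :
    Obj A n where
  carrier := affEquiv M (fun j => (b j : Γ)) '' X.carrier
  definable := by
    rw [affEquiv_image_eq]
    have := X.definable.affine_preimage (M⁻¹).1 (fun j => -intAct (M⁻¹).1 b j)
    convert this using 5
    simp [intAct]
  bounded := X.bounded.affine_image _ _

theorem Obj.iso_affine {n : ℕ} (M : Matrix.GeneralLinearGroup (Fin n) ℤ) (b : Fin n → A)
    (X : Obj A n) : Iso A X.carrier (X.affine M b).carrier :=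
  ⟨affEquiv M fun j => (b j : Γ), (affEquiv M fun j => (b j : Γ)).injective.injOn.bijOn_image,
    Unit, inferInstance, fun _ => X.carrier, fun _ => X.definable, fun _ _ h => (h rfl).elim,
    Set.iUnion_const _, fun _ => ⟨M, b, fun _ _ _ => rfl⟩⟩

/-! ## Closure properties of the sets with class in the image -/

namespace InS

theorem of_obj {n : ℕ} {X : Set (Fin n → Γ)} (h : InS A X) (Y : Obj A n) (hY : Y.carrier = X) :
    (1 : ℚ) ⊗ₜ[ℤ] Kdf.cls Y ∈ (phi A).range := by
  obtain ⟨Z, hZ, hZ'⟩ := h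
  rwa [Obj.ext' (hY.trans hZ.symm)]

theorem isDefinable {n : ℕ} {X : Set (Fin n → Γ)} (h : InS A X) : IsDefinable A X := by
  obtain ⟨Y, rfl, -⟩ := h
  exact Y.definable

theorem isBounded {n : ℕ} {X : Set (Fin n → Γ)} (h : InS A X) : IsBounded X := by
  obtain ⟨Y, rfl, -⟩ := h
  exact Y.bounded

theorem empty (n : ℕ) : InS A (∅ : Set (Fin n → Γ)) :=
  ⟨Obj.empty A n, rfl, by rw [Kdf.cls_empty, TensorProduct.tmul_zero]; exact zero_mem _⟩

theorem union {n : ℕ} {X Y : Set (Fin n → Γ)} (hX : InS A X) (hY : InS A Y) (hd : Disjoint X Y) :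
    InS A (X ∪ Y) := by
  obtain ⟨X, rfl, hX⟩ := hX
  obtain ⟨Y, rfl, hY⟩ := hY
  refine ⟨⟨_, X.definable.union Y.definable, X.bounded.union Y.bounded⟩, rfl, ?_⟩
  rw [Kdf.cls_union (X := X) (Y := Y) rfl hd, TensorProduct.tmul_add]
  exact add_mem hX hY

/-- The image of `φ_A` is closed under subtraction. This removal of a known piece is the step used
for open intervals, distinct tuples and simplices. -/
theorem of_union_left {n : ℕ} {X Y : Set (Fin n → Γ)} (hXY : InS A (X ∪ Y)) (hX : InS A X)
    (hd : Disjoint X Y) : InS A Y := by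
  have hY : Y = (X ∪ Y) \ X := (Set.union_sdiff_cancel_left hd.le_bot).symm
  let Y' : Obj A n := ⟨Y, by rw [hY]; exact hXY.isDefinable.diff hX.isDefinable,
    hXY.isBounded.mono Set.subset_union_right⟩
  obtain ⟨Z, hZ, hZ'⟩ := hXY
  obtain ⟨X, rfl, hX⟩ := hX
  refine ⟨Y', rfl, ?_⟩
  rw [Kdf.cls_union (X := X) (Y := Y') hZ hd, TensorProduct.tmul_add] at hZ'
  exact (add_mem_cancel_left hX).1 hZ'

theorem biUnion {n : ℕ} {ι : Type*} (s : Finset ι) (f : ι → Set (Fin n → Γ))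
    (h : ∀ i ∈ s, InS A (f i)) (hd : (s : Set ι).PairwiseDisjoint f) :
    InS A (⋃ i ∈ s, f i) := by
  classical
  induction s using Finset.induction_on with
  | empty => simpa using InS.empty n
  | insert i s hi ih =>
    rw [Finset.set_biUnion_insert]
    refine (h i (Finset.mem_insert_self _ _)).union
      (ih (fun j hj => h j (Finset.mem_insert_of_mem hj))
        (hd.subset (by simp [Set.subset_insert]))) ?_
    rw [Set.disjoint_iUnion₂_right]
    intro j hj
    exact hd (by simp) (by simp [hj]) fun hij => hi (hij ▸ hj)

theorem affine {n : ℕ} {X : Set (Fin n → Γ)} (hX : InS A X)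
    (M : Matrix.GeneralLinearGroup (Fin n) ℤ) (b : Fin n → A) :
    InS A (affEquiv M (fun j => (b j : Γ)) '' X) := by
  obtain ⟨X, rfl, hX⟩ := hX
  exact ⟨X.affine M b, rfl, by rwa [← Kdf.cls_eq_of_iso (X.iso_affine M b)]⟩

theorem of_affine {n : ℕ} {X : Set (Fin n → Γ)} (M : Matrix.GeneralLinearGroup (Fin n) ℤ)
    (b : Fin n → A) (hX : InS A (affEquiv M (fun j => (b j : Γ)) '' X)) : InS A X := by
  have := hX.affine M⁻¹ (fun j => -intAct (M⁻¹).1 b j)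
  convert this
  rw [Set.image_image]
  refine (Set.image_id X).symm.trans (Set.image_congr fun x _ => Eq.symm ?_)
  change intAct (M⁻¹).1 (intAct M.1 x + _) + _ = x
  rw [intAct_add, intAct_inv_intAct, add_assoc]
  convert add_zero x
  funext j
  simp [intAct]

theorem prod {n m : ℕ} {X : Set (Fin n → Γ)} {Y : Set (Fin m → Γ)} (hX : InS A X) (hY : InS A Y) :
    InS A {z : Fin (n + m) → Γ | z ∘ Fin.castAdd m ∈ X ∧ z ∘ Fin.natAdd n ∈ Y} := by
  obtain ⟨X, rfl, hX⟩ := hX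
  obtain ⟨Y, rfl, hY⟩ := hY
  refine ⟨X.prod Y, rfl, ?_⟩
  rw [Kdf.cls_prod, ← mul_one (1 : ℚ), ← Algebra.TensorProduct.tmul_mul_tmul]
  exact mul_mem hX hY

end InS

/-- The copy of `X` at height `c`. -/
def level {n : ℕ} (X : Set (Fin n → Γ)) (c : Γ) : Set (Fin (n + 1) → Γ) :=
  {z | Fin.init z ∈ X ∧ z (Fin.last n) = c}

theorem level_eq_image {n : ℕ} (X : Set (Fin n → Γ)) (c : Γ) :
    level X c = affEquiv 1 (Pi.single (Fin.last n) c) '' level X 0 := by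
  rw [Equiv.image_eq_preimage_symm]
  ext z
  change _ ∧ _ ↔ Fin.init (intAct (1 : Matrix.GeneralLinearGroup (Fin (n + 1)) ℤ)⁻¹.1
    (z - Pi.single (Fin.last n) c)) ∈ X ∧ _ = _
  have : (1 : Matrix.GeneralLinearGroup (Fin (n + 1)) ℤ)⁻¹.1 = 1 := by simp
  rw [this, intAct_one]
  have h1 : Fin.init (z - Pi.single (Fin.last n) c) = Fin.init z := by
    funext i
    simp [Fin.init]
  rw [h1]
  refine and_congr_right fun _ => ?_
  change _ ↔ intAct _ _ (Fin.last n) = 0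
  rw [this, intAct_one]
  simp [sub_eq_zero]

namespace InS

/-- `[X × {0}] = [X] [0]_1`, and `[0]_1` is `1` in the dimension-free ring, so a zero coordinate may
be appended or dropped. -/
theorem level_zero_iff {n : ℕ} {X : Set (Fin n → Γ)} : InS A (level X 0) ↔ InS A X := by
  have key : ∀ Y : Obj A n, (Y.prod (Obj.zero A)).carrier = level Y.carrier 0 := fun Y => rfl
  have key2 : ∀ Y : Obj A n, (1 : ℚ) ⊗ₜ[ℤ] Kdf.cls (Y.prod (Obj.zero A)) =
      (1 : ℚ) ⊗ₜ[ℤ] Kdf.cls Y := fun Y => by rw [Kdf.cls_prod, Kdf.cls_zero, mul_one]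
  constructor
  · intro h
    have hd : IsDefinable A X := by
      have := h.isDefinable.affine_preimage (fun j l => if j = l.castSucc then 1 else 0) 0
      convert this
      ext x
      have h1 : (intAct (fun (j : Fin (n + 1)) (l : Fin n) => if j = l.castSucc then 1 else 0) x +
          fun j => (((0 : Fin (n + 1) → A) j : A) : Γ)) = Fin.snoc (α := fun _ => Γ) x 0 := by
        funext j
        refine Fin.lastCases ?_ (fun j => ?_) j
        · simp [intAct, (Fin.castSucc_lt_last _).ne']
        · simp [intAct]
      rw [Set.mem_ofPred_eq, h1]
      simp [level]
    have hb : IsBounded X := by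
      obtain ⟨γ, hγ⟩ := h.isBounded
      refine ⟨γ, fun x hx i => ?_⟩
      have := hγ (Fin.snoc (α := fun _ => Γ) x 0) (by simp [level, hx]) i.castSucc
      simpa using this
    refine ⟨⟨X, hd, hb⟩, rfl, ?_⟩
    rw [← key2]
    exact h.of_obj _ (key _)
  · rintro ⟨Y, rfl, hY⟩
    exact ⟨Y.prod (Obj.zero A), key Y, by rwa [key2]⟩

theorem level_iff {n : ℕ} {X : Set (Fin n → Γ)} (c : A) : InS A (level X (c : Γ)) ↔ InS A X := by
  rw [← level_zero_iff (X := X), level_eq_image]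
  have h1 : (Pi.single (Fin.last n) (c : Γ) : Fin (n + 1) → Γ) =
      fun j => ((Pi.single (Fin.last n) c : Fin (n + 1) → A) j : Γ) := by
    funext j
    refine Fin.lastCases ?_ (fun j => ?_) j
    · simp
    · simp
  rw [h1]
  exact ⟨of_affine _ _, fun h => h.affine _ _⟩

end InS

end Classes

end BoundedPolytopes

namespace BoundedPolytopes

/-! ## Chains and unimodular simplices -/

section Unimodular

variable {Γ : Type*} [AddCommGroup Γ] [LinearOrder Γ] [IsOrderedAddMonoid Γ]
variable {A : AddSubgroup Γ}

theorem Kdf.cls_biUnion {n : ℕ} {ι : Type*} (s : Finset ι) (f : ι → Obj A n) (Z : Obj A n)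
    (hZ : Z.carrier = ⋃ i ∈ s, (f i).carrier)
    (hd : (s : Set ι).PairwiseDisjoint fun i => (f i).carrier) :
    Kdf.cls Z = ∑ i ∈ s, Kdf.cls (f i) := by
  classical
  induction s using Finset.induction_on generalizing Z with
  | empty =>
    rw [Finset.sum_empty, ← Kdf.cls_empty n]
    exact congrArg _ (Obj.ext' (hZ.trans (by simp [Obj.empty])))
  | insert i s hi ih =>
    have hsub : (⋃ j ∈ s, (f j).carrier) ⊆ Z.carrier := by
      rw [hZ, Finset.set_biUnion_insert]
      exact Set.subset_union_right
    have hdisj : Disjoint (f i).carrier (⋃ j ∈ s, (f j).carrier) := by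
      rw [Set.disjoint_iUnion₂_right]
      intro j hj
      exact hd (by simp) (by simp [hj]) fun hij => hi (hij ▸ hj)
    rw [Finset.set_biUnion_insert] at hZ
    let Y : Obj A n := ⟨⋃ j ∈ s, (f j).carrier, by
      rw [← Set.union_sdiff_cancel_left hdisj.le_bot, ← hZ]
      exact Z.definable.diff (f i).definable, Z.bounded.mono hsub⟩
    rw [Finset.sum_insert hi, Kdf.cls_union (X := f i) (Y := Y) hZ hdisj,
      ih Y rfl (hd.subset (by simp [Set.subset_insert]))]

theorem InS.zero : InS A {x : Fin 1 → Γ | x 0 = 0} :=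
  ⟨Obj.zero A, rfl, by rw [Kdf.cls_zero]; exact one_mem _⟩

theorem InS.univ_zero : InS A (Set.univ : Set (Fin 0 → Γ)) :=
  ⟨Obj.point A, rfl, by rw [Kdf.cls_point]; exact one_mem _⟩

/-- The interval `[0, a)` has class `φ_A(a)` by construction, and removing `0` subtracts `1`. -/
theorem InS.openInterval (a : A) (ha : 0 < a) :
    InS A {x : Fin 1 → Γ | 0 < x 0 ∧ x 0 < (a : Γ)} := by
  have ha' : (0 : Γ) < a := ha
  have h1 : InS A (Obj.interval a).carrier := by
    refine ⟨_, rfl, ?_⟩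
    have h := phi_apply A a
    rw [iota, if_pos ha] at h
    exact ⟨_, h⟩
  refine InS.of_union_left (X := {x : Fin 1 → Γ | x 0 = 0}) ?_ InS.zero ?_
  · convert h1 using 1
    ext x
    simp only [Obj.interval, Set.mem_union, Set.mem_ofPred_eq]
    constructor
    · rintro (h | h)
      · exact ⟨h.ge, h ▸ ha'⟩
      · exact ⟨h.1.le, h.2⟩
    · rintro ⟨h, h'⟩
      rcases h.eq_or_lt with h0 | h0
      · exact Or.inl h0.symm
      · exact Or.inr ⟨h0, h'⟩
  · exact Set.disjoint_left.2 fun x hx hx' => absurd hx (ne_of_gt hx'.1)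

/-- The tuples of distinct elements of `(0, a)`. -/
def injCube (k : ℕ) (a : Γ) : Set (Fin k → Γ) :=
  {x | Function.Injective x ∧ ∀ i, 0 < x i ∧ x i < a}

/-- The strictly increasing tuples of elements of `(0, a)`. -/
def chain (k : ℕ) (a : Γ) : Set (Fin k → Γ) :=
  {x | StrictMono x ∧ ∀ i, 0 < x i ∧ x i < a}

/-- An integral matrix with invertible determinant as an element of `GL_n(ℤ)`. -/
def toGL {n : ℕ} (M : Matrix (Fin n) (Fin n) ℤ) (hM : IsUnit M.det) :
    Matrix.GeneralLinearGroup (Fin n) ℤ := Matrix.nonsingInvUnit M hM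

theorem InS.image_intAct_iff {n : ℕ} (M : Matrix (Fin n) (Fin n) ℤ) (hM : IsUnit M.det)
    {X : Set (Fin n → Γ)} : InS A (intAct M '' X) ↔ InS A X := by
  have h : intAct M '' X = affEquiv (toGL M hM) (fun j => (((0 : Fin n → A) j : A) : Γ)) '' X :=
    Set.image_congr fun x _ => by
      change _ = intAct M x + _
      funext j
      simp
  rw [h]
  exact ⟨InS.of_affine _ _, fun h => h.affine _ _⟩

theorem intAct_injective {n : ℕ} (M : Matrix (Fin n) (Fin n) ℤ) (hM : IsUnit M.det) :
    Function.Injective (intAct M : (Fin n → Γ) → (Fin n → Γ)) := fun x y hxy => by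
  have := congrArg (intAct ((toGL M hM)⁻¹).1) hxy
  rwa [show intAct M x = intAct (toGL M hM).1 x from rfl,
    show intAct M y = intAct (toGL M hM).1 y from rfl, intAct_inv_intAct, intAct_inv_intAct] at this

theorem intAct_surjective {n : ℕ} (M : Matrix (Fin n) (Fin n) ℤ) (hM : IsUnit M.det) :
    Function.Surjective (intAct M : (Fin n → Γ) → (Fin n → Γ)) := fun x =>
  ⟨intAct ((toGL M hM)⁻¹).1 x, intAct_intAct_inv (toGL M hM) x⟩

/-- Appending any element of `(0, a)` to a tuple of `k` distinct ones either keeps the entries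
distinct or repeats exactly one entry. The tuples that repeat the `i`-th entry form a sheared copy
of the `k`-dimensional set at level `0`, so the product minus these `k` disjoint pieces remains. -/
theorem InS.injCube (k : ℕ) (a : A) (ha : 0 < a) : InS A (injCube k (a : Γ)) := by
  induction k with
  | zero =>
    convert InS.univ_zero (A := A)
    exact Set.eq_univ_of_forall fun x => ⟨Function.injective_of_subsingleton x, fun i => i.elim0⟩
  | succ k ih =>
    let D : Fin k → Set (Fin (k + 1) → Γ) := fun i =>
      {z | Fin.init z ∈ BoundedPolytopes.injCube k (a : Γ) ∧ z (Fin.last k) = z i.castSucc}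
    have hD : ∀ i, InS A (D i) := by
      intro i
      have hdet : (Matrix.transvection (Fin.last k) i.castSucc (1 : ℤ)).det = 1 :=
        Matrix.det_transvection_of_ne _ _ (Fin.castSucc_lt_last i).ne' _
      have h1 : D i = intAct (Matrix.transvection (Fin.last k) i.castSucc (1 : ℤ)) ''
          level (BoundedPolytopes.injCube k (a : Γ)) 0 := by
        have hact : ∀ z : Fin (k + 1) → Γ,
            intAct (Matrix.transvection (Fin.last k) i.castSucc (1 : ℤ)) z =
              z + Pi.single (Fin.last k) (z i.castSucc) := by
          intro z
          funext j
          simp only [intAct, Matrix.transvection, Matrix.add_apply, add_smul,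
            Finset.sum_add_distrib, Pi.add_apply]
          congr 1
          · exact congrFun (intAct_one z) j
          · by_cases hj : j = Fin.last k
            · subst hj
              rw [Finset.sum_eq_single i.castSucc (fun l _ hl => by
                rw [Matrix.single_apply, if_neg fun h => hl h.2.symm, zero_smul]) (by simp)]
              simp
            · simp [Matrix.single_apply_of_row_ne (Ne.symm hj), Pi.single_eq_of_ne hj]
        have hinit : ∀ (z : Fin (k + 1) → Γ) (c : Γ),
            Fin.init (z + Pi.single (Fin.last k) c) = Fin.init z := by
          intro z c
          funext j
          simp [Fin.init]
        ext z
        constructor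
        · rintro ⟨h1, h2⟩
          refine ⟨z + Pi.single (Fin.last k) (-z i.castSucc), ⟨?_, ?_⟩, ?_⟩
          · rwa [hinit]
          · simp [h2]
          · rw [hact]
            have h3 : (z + Pi.single (Fin.last k) (-z i.castSucc) : Fin (k + 1) → Γ) i.castSucc =
              z i.castSucc := by simp
            rw [h3, add_assoc, ← Pi.single_add, neg_add_cancel, Pi.single_zero, add_zero]
        · rintro ⟨y, ⟨h1, h2⟩, rfl⟩
          rw [hact]
          exact ⟨by rwa [hinit], by simp [h2]⟩
      rw [h1, InS.image_intAct_iff _ (by rw [hdet]; exact isUnit_one)]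
      exact InS.level_zero_iff.2 ih
    refine InS.of_union_left (X := ⋃ i ∈ Finset.univ, D i) ?_ (InS.biUnion _ _ (fun i _ => hD i) ?_)
      ?_
    · convert ih.prod (InS.openInterval a ha) using 1
      have hsnoc : ∀ z : Fin (k + 1) → Γ, Function.Injective z ↔
          Function.Injective (Fin.init z) ∧ ∀ i, z (Fin.last k) ≠ z (Fin.castSucc i) := by
        intro z
        rw [← Fin.snoc_init_self z, Fin.snoc_injective_iff]
        simp [eq_comm]
      ext z
      simp only [D, Set.mem_union, Set.mem_iUnion, Finset.mem_univ, Set.mem_ofPred_eq,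
        BoundedPolytopes.injCube, exists_prop, true_and]
      have e1 : z ∘ Fin.castAdd 1 = Fin.init z := rfl
      have e2 : (z ∘ Fin.natAdd k) (0 : Fin 1) = z (Fin.last k) := rfl
      rw [e1, e2, hsnoc, Fin.forall_fin_succ']
      constructor
      · rintro (⟨i, h1, h2⟩ | ⟨h1, h2, h3⟩)
        · exact ⟨h1, h2 ▸ h1.2 i⟩
        · exact ⟨⟨h1.1, h2⟩, h3⟩
      · rintro ⟨⟨h1, h2⟩, h3⟩
        by_cases h : ∃ i, z (Fin.last k) = z (Fin.castSucc i)
        · obtain ⟨i, hi⟩ := h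
          exact Or.inl ⟨i, ⟨h1, h2⟩, hi⟩
        · exact Or.inr ⟨⟨h1, fun i hi => h ⟨i, hi⟩⟩, h2, h3⟩
    · intro i _ j _ hij
      refine Set.disjoint_left.2 fun z hz hz' => hij ?_
      exact hz.1.1 (hz.2.symm.trans hz'.2)
    · refine Set.disjoint_left.2 fun z hz hz' => ?_
      obtain ⟨i, -, hi⟩ := Set.mem_iUnion₂.1 hz
      exact (Fin.castSucc_lt_last i).ne (hz'.1 hi.2).symm

theorem IsDefinable.iInter {n : ℕ} {ι : Type*} [Finite ι] (f : ι → Set (Fin n → Γ))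
    (h : ∀ i, IsDefinable A (f i)) : IsDefinable A {x | ∀ i, x ∈ f i} := by
  classical
  have _ := Fintype.ofFinite ι
  have : ∀ s : Finset ι, IsDefinable A {x | ∀ i ∈ s, x ∈ f i} := by
    intro s
    induction s using Finset.induction_on with
    | empty => simpa using IsDefinable.univ
    | insert i s hi ih =>
      convert (h i).inter _ _ ih using 1
      ext x
      simp
  simpa using this Finset.univ

theorem isDefinable_chain (k : ℕ) (a : A) : IsDefinable A (chain k (a : Γ)) := by
  have h1 : ∀ i j : Fin k, IsDefinable A {x : Fin k → Γ | i < j → x i < x j} := by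
    intro i j
    by_cases hij : i < j
    · convert IsDefinable.lt (A := A) (Pi.single i 1 - Pi.single j 1 : Fin k → ℤ) 0 using 1
      ext x
      simp [hij, sub_smul, Finset.sum_sub_distrib, Pi.single_apply, ite_smul, sub_neg]
    · simpa [hij] using IsDefinable.univ (A := A) (n := k)
  have h2 : ∀ i : Fin k, IsDefinable A {x : Fin k → Γ | 0 < x i ∧ x i < a} := by
    intro i
    convert (IsDefinable.lt (A := A) (Pi.single i (-1) : Fin k → ℤ) 0).inter _ _
      (IsDefinable.lt (A := A) (Pi.single i 1 : Fin k → ℤ) a) using 1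
    ext x
    simp [Pi.single_apply, ite_smul]
  exact (IsDefinable.iInter _ fun i => IsDefinable.iInter _ (h1 i)).inter _ _
    (IsDefinable.iInter _ h2)

/-- Sorting splits the tuples of distinct elements into `k!` coordinate permutations of the chain,
all with the same class. Rational coefficients allow division by `k!`. -/
theorem InS.chain (k : ℕ) (a : A) (ha : 0 < a) : InS A (chain k (a : Γ)) := by
  let C : Obj A k := ⟨BoundedPolytopes.chain k (a : Γ), isDefinable_chain k a,
    ⟨(a : Γ), fun x hx i => ⟨(neg_nonpos.2 (show (0 : Γ) ≤ a from ha.le)).trans (hx.2 i).1.le, (hx.2 i).2.le⟩⟩⟩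
  obtain ⟨Z, hZ, hZ'⟩ := InS.injCube k a ha
  refine ⟨C, rfl, ?_⟩
  have hmem : ∀ (σ : Equiv.Perm (Fin k)) (x : Fin k → Γ),
      x ∈ (C.reindex σ).carrier ↔ StrictMono (x ∘ σ) ∧ ∀ i, 0 < x i ∧ x i < a := by
    intro σ x
    refine and_congr_right fun _ => ?_
    exact ⟨fun h i => by simpa using h (σ.symm i), fun h i => h (σ i)⟩
  have h1 := Kdf.cls_biUnion (Finset.univ : Finset (Equiv.Perm (Fin k))) (fun σ => C.reindex σ) Z
    (by
      rw [hZ]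
      ext x
      simp only [Set.mem_iUnion, Finset.mem_univ, exists_prop, true_and, hmem]
      constructor
      · rintro ⟨h1, h2⟩
        refine ⟨Tuple.sort x, (Tuple.monotone_sort x).strictMono_of_injective ?_, h2⟩
        exact h1.comp (Tuple.sort x).injective
      · rintro ⟨σ, h1, h2⟩
        refine ⟨?_, h2⟩
        have := h1.injective.comp σ.symm.injective
        rwa [Function.comp_assoc, Equiv.self_comp_symm, Function.comp_id] at this)
    (by
      intro σ _ τ _ hστ
      refine Set.disjoint_left.2 fun x hx hx' => hστ ?_
      have h1 := ((hmem σ x).1 hx).1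
      have h2 := ((hmem τ x).1 hx').1
      have h3 : x ∘ σ = x ∘ τ := (h1.range_inj h2).1 (by
        rw [EquivLike.range_comp, EquivLike.range_comp])
      have h4 : Function.Injective x := by
        have := h1.injective.comp σ.symm.injective
        rwa [Function.comp_assoc, Equiv.self_comp_symm, Function.comp_id] at this
      ext i
      exact congrArg Fin.val (h4 (congrFun h3 i)))
  have h2 : ∀ σ : Equiv.Perm (Fin k), Kdf.cls (C.reindex σ) = Kdf.cls C := fun σ =>
    (Kdf.cls_eq_of_iso (C.iso_reindex σ)).symm
  simp only [h2, Finset.sum_const, Finset.card_univ, Fintype.card_perm, Fintype.card_fin] at h1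
  rw [h1, TensorProduct.tmul_smul, ← Nat.cast_smul_eq_nsmul ℚ] at hZ'
  have h3 := Subalgebra.smul_mem _ hZ' ((k.factorial : ℚ)⁻¹)
  rwa [smul_smul, inv_mul_cancel₀ (by exact_mod_cast k.factorial_ne_zero), one_smul] at h3

/-- The open simplex with vertices `a w_i`. -/
def openSimplex {κ : Type*} [Fintype κ] {m : ℕ} (w : κ → Fin m → ℤ) (a : Γ) : Set (Fin m → Γ) :=
  {x | ∃ t : κ → Γ, (∀ i, 0 < t i) ∧ ∑ i, t i = a ∧ x = fun j => ∑ i, w i j • t i}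

theorem openSimplex_eq_image {k m : ℕ} (w : Fin k → Fin m → ℤ) (a : Γ) : openSimplex w a =
    intAct (Matrix.of w).transpose '' {t : Fin k → Γ | (∀ i, 0 < t i) ∧ ∑ i, t i = a} := by
  ext x
  constructor
  · rintro ⟨t, h1, h2, rfl⟩
    exact ⟨t, ⟨h1, h2⟩, rfl⟩
  · rintro ⟨t, ⟨h1, h2⟩, rfl⟩
    exact ⟨t, h1, h2, rfl⟩

theorem openSimplex_equiv {κ κ' : Type*} [Fintype κ] [Fintype κ'] (e : κ ≃ κ') {m : ℕ}
    (w : κ' → Fin m → ℤ) (a : Γ) : openSimplex (w ∘ e) a = openSimplex w a := by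
  ext x
  constructor
  · rintro ⟨t, h1, h2, rfl⟩
    refine ⟨t ∘ e.symm, fun i => h1 _, by rw [← h2]; exact e.symm.sum_comp t, ?_⟩
    funext j
    rw [← e.sum_comp]
    simp
  · rintro ⟨t, h1, h2, rfl⟩
    refine ⟨t ∘ e, fun i => h1 _, by rw [← h2]; exact e.sum_comp t, ?_⟩
    funext j
    rw [← e.sum_comp]
    rfl

/-- The partial sums of positive barycentric coordinates with total `a` form an increasing chain in
`(0, a)` followed by the last entry `a`, and taking partial sums is unimodular. -/
theorem InS.standardSimplex (k : ℕ) (a : A) (ha : 0 < a) :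
    InS A {t : Fin (k + 1) → Γ | (∀ i, 0 < t i) ∧ ∑ i, t i = (a : Γ)} := by
  let U : Matrix (Fin (k + 1)) (Fin (k + 1)) ℤ := Matrix.of fun j i => if i ≤ j then 1 else 0
  have hU : U.det = 1 := by
    rw [Matrix.det_of_isLowerTriangular U fun i j hij => if_neg (not_le.2 hij)]
    simp [U]
  have hU' : IsUnit U.det := hU ▸ isUnit_one
  rw [← InS.image_intAct_iff U hU']
  convert (InS.level_iff a).2 (InS.chain k a ha) using 1
  have hs : ∀ (t : Fin (k + 1) → Γ) j, intAct U t j = ∑ i with i ≤ j, t i := by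
    intro t j
    simp only [intAct, U, Matrix.of_apply, ite_smul, one_smul, zero_smul, Finset.sum_ite,
      Finset.sum_const_zero, add_zero]
  have hs0 : ∀ t : Fin (k + 1) → Γ, intAct U t 0 = t 0 := by
    intro t
    rw [hs]
    have : (Finset.univ.filter fun i : Fin (k + 1) => i ≤ 0) = {0} := by ext; simp
    rw [this, Finset.sum_singleton]
  have hsucc : ∀ (t : Fin (k + 1) → Γ) (j : Fin k),
      intAct U t j.succ = intAct U t j.castSucc + t j.succ := by
    intro t j
    rw [hs, hs]
    have : (Finset.univ.filter fun i : Fin (k + 1) => i ≤ j.succ) =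
        insert j.succ (Finset.univ.filter fun i : Fin (k + 1) => i ≤ j.castSucc) := by
      ext i
      simp only [Finset.mem_filter, Finset.mem_univ, true_and, Finset.mem_insert, Fin.le_def,
        Fin.ext_iff, Fin.val_succ, Fin.val_castSucc]
      omega
    rw [this, Finset.sum_insert (by simp [Fin.le_def]), add_comm]
  have hlast : ∀ t : Fin (k + 1) → Γ, intAct U t (Fin.last k) = ∑ i, t i := by
    intro t
    rw [hs]
    simp [Fin.le_last]
  have key : ∀ t : Fin (k + 1) → Γ, ((∀ i, 0 < t i) ∧ ∑ i, t i = (a : Γ)) ↔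
      intAct U t ∈ level (BoundedPolytopes.chain k (a : Γ)) (a : Γ) := by
    intro t
    have h1 : (∀ i, 0 < t i) ↔ 0 < intAct U t 0 ∧ StrictMono (intAct U t) := by
      rw [Fin.strictMono_iff_lt_succ, Fin.forall_fin_succ, hs0]
      simp [hsucc]
    rw [h1, ← hlast]
    set s := intAct U t
    change _ ↔ (StrictMono (Fin.init s) ∧ _) ∧ _
    refine and_congr_left fun hsa => ?_
    constructor
    · rintro ⟨h2, h3⟩
      refine ⟨fun i j hij => h3 (Fin.castSucc_lt_castSucc_iff.2 hij), fun i => ⟨?_, ?_⟩⟩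
      · exact h2.trans_le (h3.monotone (Fin.zero_le _))
      · rw [← hsa]
        exact h3 (Fin.castSucc_lt_last i)
    · rintro ⟨h2, h3⟩
      refine ⟨?_, Fin.strictMono_iff_lt_succ.2 fun j => ?_⟩
      · have : ∀ i, 0 < s i := fun i => by
          refine Fin.lastCases ?_ (fun i => (h3 i).1) i
          rw [hsa]
          exact ha
        exact this 0
      · rcases Fin.eq_castSucc_or_eq_last j.succ with ⟨j', hj'⟩ | hj'
        · rw [hj']
          refine h2 ?_
          rw [← Fin.castSucc_lt_castSucc_iff, ← hj']
          exact Fin.castSucc_lt_succ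
        · rw [hj', hsa]
          exact (h3 j).2
  ext x
  obtain ⟨t, rfl⟩ := intAct_surjective U hU' x
  rw [(intAct_injective U hU').mem_set_image]
  exact key t

theorem InS.openSimplex_of_isUnit {m : ℕ} (w : Fin m → Fin m → ℤ) (hw : IsUnit (Matrix.of w).det)
    (a : A) (ha : 0 < a) : InS A (openSimplex w (a : Γ)) := by
  rw [openSimplex_eq_image, InS.image_intAct_iff _ (by rwa [Matrix.det_transpose])]
  cases m with
  | zero =>
    convert InS.empty (A := A) 0
    refine Set.eq_empty_of_forall_notMem fun x hx => ?_
    have := hx.2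
    simp only [Finset.univ_eq_empty, Finset.sum_empty] at this
    exact absurd this (ne_of_lt ha)
  | succ k => exact InS.standardSimplex k a ha

end Unimodular

end BoundedPolytopes

namespace BoundedPolytopes

/-! ## Circuits: two dissections of a cone -/

section Circuits

variable {Γ : Type*} [AddCommGroup Γ] [LinearOrder Γ] [IsOrderedAddMonoid Γ]

/-- The open face spanned by the vectors with index in `J`. -/
def face {ι : Type*} {m : ℕ} (u : ι → Fin m → ℤ) (a : Γ) (J : Finset ι) : Set (Fin m → Γ) :=
  openSimplex (fun i : J => u i) a

/-- The closed simplex spanned by a family of vectors. -/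
def closedSimplex {ι : Type*} [Fintype ι] {m : ℕ} (u : ι → Fin m → ℤ) (a : Γ) :
    Set (Fin m → Γ) :=
  {x | ∃ s : ι → Γ, (∀ i, 0 ≤ s i) ∧ ∑ i, s i = a ∧ x = fun j => ∑ i, u i j • s i}

theorem mem_face_iff {ι : Type*} [Fintype ι] [DecidableEq ι] {m : ℕ} (u : ι → Fin m → ℤ) (a : Γ)
    (J : Finset ι) (x : Fin m → Γ) : x ∈ face u a J ↔ ∃ s : ι → Γ,
      (∀ i ∈ J, 0 < s i) ∧ (∀ i, i ∉ J → s i = 0) ∧ ∑ i, s i = a ∧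
        x = fun j => ∑ i, u i j • s i := by
  have hsum : ∀ f : ι → Γ, (∀ i, i ∉ J → f i = 0) → ∑ i, f i = ∑ i : J, f i := by
    intro f hf
    rw [← Finset.sum_subset (Finset.subset_univ J) fun i _ hi => hf i hi, Finset.sum_coe_sort]
  constructor
  · rintro ⟨t, h1, h2, rfl⟩
    let s : ι → Γ := fun i => if h : i ∈ J then t ⟨i, h⟩ else 0
    have hs : ∀ i : J, s i = t i := fun i => dif_pos i.2
    have hs' : ∀ i, i ∉ J → s i = 0 := fun i hi => dif_neg hi
    refine ⟨s, fun i hi => ?_, hs', ?_, ?_⟩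
    · exact (hs ⟨i, hi⟩).symm ▸ h1 _
    · rw [hsum s hs', ← h2]
      exact Finset.sum_congr rfl fun i _ => hs i
    · funext j
      rw [hsum _ fun i hi => by rw [hs' i hi, smul_zero]]
      exact Finset.sum_congr rfl fun i _ => by rw [hs]
  · rintro ⟨s, h1, h2, h3, rfl⟩
    refine ⟨fun i => s i, fun i => h1 i i.2, by rw [← h3, hsum s h2], ?_⟩
    funext j
    exact hsum _ fun i hi => by rw [h2 i hi, smul_zero]

variable [Module ℚ Γ] {ι : Type*} [Fintype ι] [DecidableEq ι] {m : ℕ}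
  {u : ι → Fin m → ℤ} {z : ι → ℤ}

/-- The coordinates of a point may be shifted by multiples of the relation `z` without changing the
point or their sum. Shifting in the direction of `z` until the first coordinate with `z i < 0`
reaches `0` yields a face that omits such an index. -/
theorem closedSimplex_eq_biUnion_face (hz : ∑ i, z i = 0) (hzu : ∀ j, ∑ i, z i * u i j = 0)
    (hneg : ∃ i, z i < 0) (a : Γ) :
    closedSimplex u a = ⋃ J ∈ Finset.univ.filter (fun J : Finset ι => ∃ i, z i < 0 ∧ i ∉ J),
      face u a J := by
  ext x
  simp only [Set.mem_iUnion, Finset.mem_filter, Finset.mem_univ, true_and, exists_prop]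
  constructor
  · rintro ⟨s, h1, h2, rfl⟩
    -- The ratio test: `i₀` minimizes `s i / (-z i)`, so it is a coordinate that vanishes first, at
    -- the parameter `l`.
    obtain ⟨i₀, hi₀, hmin⟩ := Finset.exists_min_image (Finset.univ.filter fun i => z i < 0)
      (fun i => ((-z i : ℚ)⁻¹) • s i) (by obtain ⟨i, hi⟩ := hneg; exact ⟨i, by simpa using hi⟩)
    simp only [Finset.mem_filter, Finset.mem_univ, true_and] at hi₀ hmin
    set l : Γ := ((-z i₀ : ℚ)⁻¹) • s i₀ with hl
    have hq : ∀ i, z i < 0 → (0 : ℚ) < -z i := fun i hi => by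
      have : (z i : ℚ) < 0 := by exact_mod_cast hi
      linarith
    have hl0 : 0 ≤ l := smul_nonneg (inv_nonneg.2 (hq _ hi₀).le) (h1 i₀)
    have hz0 : s i₀ + z i₀ • l = 0 := by
      rw [hl, ← Int.cast_smul_eq_zsmul ℚ, smul_smul, inv_neg, mul_neg, mul_inv_cancel₀
        (by exact_mod_cast hi₀.ne), neg_one_smul, add_neg_cancel]
    have hnn : ∀ i, 0 ≤ s i + z i • l := by
      intro i
      rcases lt_or_ge (z i) 0 with hi | hi
      · have h3 := smul_le_smul_of_nonneg_left (hmin i hi) (hq i hi).le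
        rw [smul_inv_smul₀ (hq i hi).ne', neg_smul, Int.cast_smul_eq_zsmul] at h3
        exact neg_le_iff_add_nonneg.1 h3
      · exact add_nonneg (h1 i) (zsmul_nonneg hl0 hi)
    refine ⟨Finset.univ.filter fun i => 0 < s i + z i • l, ⟨i₀, hi₀, by simp [hz0]⟩,
      (mem_face_iff _ _ _ _).2 ⟨fun i => s i + z i • l, fun i hi => by simpa using hi,
        fun i hi => ?_, ?_, ?_⟩⟩
    · exact ((hnn i).eq_or_lt.resolve_right (by simpa using hi)).symm
    · rw [Finset.sum_add_distrib, h2, ← Finset.sum_smul, hz, zero_smul, add_zero]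
    · funext j
      simp only [smul_add, Finset.sum_add_distrib, smul_smul]
      rw [← Finset.sum_smul]
      simp only [mul_comm (u _ j)]
      rw [hzu j, zero_smul, add_zero]
  · rintro ⟨J, -, hJ⟩
    obtain ⟨s, h1, h2, h3, rfl⟩ := (mem_face_iff _ _ _ _).1 hJ
    refine ⟨s, fun i => ?_, h3, rfl⟩
    by_cases hi : i ∈ J
    · exact (h1 i hi).le
    · exact (h2 i hi).ge

/-- Two coordinate vectors of the same point differ by `l • z`. If `l ≠ 0`, the index with `z i < 0`
omitted by one of the faces would be negative in the other vector. Hence `l = 0`, and a face is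
recovered as the support of the coordinates. -/
theorem pairwiseDisjoint_face
    (hrel : ∀ s : ι → Γ, (∀ j, ∑ i, u i j • s i = 0) → ∃ l : Γ, ∀ i, s i = z i • l) (a : Γ) :
    ((Finset.univ.filter (fun J : Finset ι => ∃ i, z i < 0 ∧ i ∉ J) : Finset (Finset ι)) :
      Set (Finset ι)).PairwiseDisjoint (face u a) := by
  intro J hJ J' hJ' hne
  simp only [Finset.coe_filter, Finset.mem_univ, true_and, Set.mem_ofPred_eq] at hJ hJ'
  refine Set.disjoint_left.2 fun x hx hx' => hne ?_
  obtain ⟨s, h1, h2, -, rfl⟩ := (mem_face_iff _ _ _ _).1 hx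
  obtain ⟨s', h1', h2', -, hs'⟩ := (mem_face_iff _ _ _ _).1 hx'
  obtain ⟨l, hl⟩ := hrel (fun i => s' i - s i) fun j => by
    have := congrFun hs' j
    simp only [smul_sub, Finset.sum_sub_distrib]
    exact sub_eq_zero.2 this.symm
  have nn : ∀ i, 0 ≤ s i := fun i => by
    by_cases hi : i ∈ J
    · exact (h1 i hi).le
    · exact (h2 i hi).ge
  have nn' : ∀ i, 0 ≤ s' i := fun i => by
    by_cases hi : i ∈ J'
    · exact (h1' i hi).le
    · exact (h2' i hi).ge
  have hl0 : l = 0 := by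
    rcases lt_trichotomy l 0 with h | h | h
    · obtain ⟨i, hi, hiJ⟩ := hJ'
      have h3 := hl i
      rw [h2' i hiJ, zero_sub, neg_eq_iff_eq_neg] at h3
      have h4 : 0 < z i • l := by
        rw [← neg_smul_neg]
        exact zsmul_pos (neg_pos.2 h) (neg_pos.2 hi)
      exact absurd (nn i) (not_le.2 (h3 ▸ neg_neg_of_pos h4))
    · exact h
    · obtain ⟨i, hi, hiJ⟩ := hJ
      have h3 := hl i
      rw [h2 i hiJ, sub_zero] at h3
      have h4 : z i • l < 0 := by
        rw [← neg_pos, ← neg_smul]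
        exact zsmul_pos h (neg_pos.2 hi)
      exact absurd (nn' i) (not_le.2 (h3 ▸ h4))
  have hss : ∀ i, s' i = s i := fun i => sub_eq_zero.1 (by rw [hl, hl0, smul_zero])
  ext i
  constructor
  · intro hi
    by_contra hi'
    exact (h1 i hi).ne' (by rw [← hss, h2' i hi'])
  · intro hi
    by_contra hi'
    exact (h1' i hi).ne' (by rw [hss, h2 i hi'])

end Circuits

/-! ## Integral linear algebra -/

/-- The numbers `e i / d` lie in `[0, 1)`, are not all zero and have an integral sum `s ≥ 1`. More
than `s - 1` of them are nonzero, so lowering `s - 1` nonzero ones by `1` gives sum `1` and keeps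
all absolute values below `1`. -/
theorem exists_sub_mul_sum_eq {m : ℕ} (e : Fin m → ℤ) (d s : ℤ) (hd : 0 < d)
    (h0 : ∀ i, 0 ≤ e i) (h1 : ∀ i, e i < d) (hs : ∑ i, e i = d * s) (he : ∃ i, e i ≠ 0) :
    ∃ f : Fin m → ℤ, ∑ i, (e i - d * f i) = d ∧ ∀ i, |e i - d * f i| < d := by
  have hspos : 0 < s := by
    obtain ⟨i, hi⟩ := he
    have : 0 < ∑ i, e i := Finset.sum_pos' (fun i _ => h0 i)
      ⟨i, Finset.mem_univ _, lt_of_le_of_ne (h0 i) hi.symm⟩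
    rw [hs] at this
    exact pos_of_mul_pos_right this hd.le
  have hcard : s ≤ (Finset.univ.filter fun i => e i ≠ 0).card := by
    have h2 : ∑ i, e i ≤ (Finset.univ.filter fun i => e i ≠ 0).card * d := by
      rw [← Finset.sum_filter_ne_zero, ← nsmul_eq_mul]
      exact Finset.sum_le_card_nsmul _ _ _ fun i _ => (h1 i).le
    rw [hs, mul_comm] at h2
    exact le_of_mul_le_mul_right h2 hd
  obtain ⟨S, hS, hSc⟩ := Finset.exists_subset_card_eq
    (s := Finset.univ.filter fun i => e i ≠ 0) (n := (s - 1).toNat) (by omega)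
  refine ⟨fun i => if i ∈ S then 1 else 0, ?_, fun i => ?_⟩
  · rw [Finset.sum_sub_distrib, hs, ← Finset.mul_sum]
    simp only [Finset.sum_ite_mem, Finset.univ_inter, Finset.sum_const, hSc, nsmul_eq_mul]
    rw [Int.toNat_of_nonneg (by omega)]
    ring
  · dsimp only
    split_ifs with hi
    · have h3 : e i ≠ 0 := by simpa using hS hi
      have h4 := h0 i
      have h5 := h1 i
      rw [abs_lt]
      constructor <;> omega
    · rw [mul_zero, sub_zero, abs_of_nonneg (h0 i)]
      exact h1 i

/-- An integral matrix whose determinant is not invertible has, in the lattice, a vector with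
small barycentric coordinates with respect to the rows. -/
theorem exists_small_vector {m : ℕ} (w : Fin m → Fin m → ℤ) (hdet : (Matrix.of w).det ≠ 0)
    (hunit : ¬ IsUnit (Matrix.of w).det) (τ : (Fin m → ℤ) →ₗ[ℤ] ℤ) (hτ : ∀ i, τ (w i) = 1) :
    ∃ (p : Fin m → ℤ) (e : Fin m → ℤ), |(Matrix.of w).det| • p = ∑ i, e i • w i ∧
      ∑ i, e i = |(Matrix.of w).det| ∧ (∀ i, |e i| < |(Matrix.of w).det|) ∧ τ p = 1 := by
  set W := Matrix.of w with hW
  set d := |W.det| with hd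
  have hdpos : 0 < d := abs_pos.2 hdet
  -- As the determinant is not a unit, the rows generate a proper sublattice; `p₀` lies outside it.
  obtain ⟨p₀, hp₀⟩ : ∃ p₀ : Fin m → ℤ, ∀ t : Fin m → ℤ, Matrix.vecMul t W ≠ p₀ := by
    by_contra hno
    push Not at hno
    exact hunit ((Matrix.isUnit_iff_isUnit_det _).1 (Matrix.vecMul_surjective_iff_isUnit.1 hno))
  have hsum : ∀ t : Fin m → ℤ, Matrix.vecMul t W = ∑ i, t i • w i := fun t => by
    rw [Matrix.vecMul_eq_sum]; rfl
  obtain ⟨c, hc⟩ : ∃ c : Fin m → ℤ, d • p₀ = ∑ i, c i • w i := by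
    have h1 : Matrix.vecMul (Matrix.vecMul p₀ W.adjugate) W = W.det • p₀ := by
      rw [Matrix.vecMul_vecMul, Matrix.adjugate_mul, Matrix.vecMul_smul, Matrix.vecMul_one]
    rcases abs_choice W.det with h | h
    · exact ⟨_, by rw [← hsum, h1, hd, h]⟩
    · refine ⟨-Matrix.vecMul p₀ W.adjugate, ?_⟩
      rw [← hsum, Matrix.neg_vecMul, h1, hd, h, neg_smul]
  have hτsum : ∀ t : Fin m → ℤ, τ (∑ i, t i • w i) = ∑ i, t i := fun t => by
    rw [map_sum]
    exact Finset.sum_congr rfl fun i _ => by rw [map_smul, hτ, smul_eq_mul, mul_one]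
  -- Subtracting a vector of the row lattice reduces the barycentric coordinates `c i / d` to their
  -- fractional parts. The height `τ` shows that their sum is an integer.
  have hdp : d • (p₀ - ∑ i, (c i / d) • w i) = ∑ i, (c i % d) • w i := by
    rw [smul_sub, hc, Finset.smul_sum, ← Finset.sum_sub_distrib]
    refine Finset.sum_congr rfl fun i _ => ?_
    rw [smul_smul, ← sub_smul, Int.emod_def]
  obtain ⟨f, hf, hf'⟩ := exists_sub_mul_sum_eq (fun i => c i % d) d
    (τ (p₀ - ∑ i, (c i / d) • w i)) hdpos (fun i => Int.emod_nonneg _ hdpos.ne')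
    (fun i => Int.emod_lt_of_pos _ hdpos) (by
      rw [← hτsum, ← hdp, map_smul, smul_eq_mul]) (by
      by_contra hno
      push Not at hno
      simp only [hno, zero_smul, Finset.sum_const_zero] at hdp
      have h1 := (smul_eq_zero.1 hdp).resolve_left hdpos.ne'
      exact hp₀ (fun i => c i / d) ((hsum _).trans (sub_eq_zero.1 h1).symm))
  have h1 : d • (p₀ - ∑ i, (c i / d) • w i - ∑ i, f i • w i) =
      ∑ i, (c i % d - d * f i) • w i := by
    rw [smul_sub, hdp, Finset.smul_sum, ← Finset.sum_sub_distrib]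
    exact Finset.sum_congr rfl fun i _ => by rw [smul_smul, ← sub_smul]
  refine ⟨_, _, h1, hf, hf', ?_⟩
  have h2 := congrArg τ h1
  rw [hτsum, hf, map_smul, smul_eq_mul] at h2
  exact mul_left_cancel₀ hdpos.ne' (h2.trans (mul_one d).symm)

/-- Cramer's rule: in the basis `w` the `k`-th coordinate of `p` is `e k / d`, the factor by which
replacing row `k` by `p` changes the determinant, up to sign. -/
theorem abs_det_update {m : ℕ} (w : Fin m → Fin m → ℤ) (hdet : (Matrix.of w).det ≠ 0)
    (p e : Fin m → ℤ) (hp : |(Matrix.of w).det| • p = ∑ i, e i • w i) (k : Fin m) :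
    |(Matrix.of (Function.update w k p)).det| = |e k| := by
  have h1 : Matrix.of (Function.update w k p) = (Matrix.of w).updateRow k p := rfl
  have h2 := Matrix.det_updateRow_sum (Matrix.of w) k e
  have h3 : ∑ i, e i • (Matrix.of w) i = |(Matrix.of w).det| • p := hp.symm
  rw [h3, Matrix.det_updateRow_smul, ← h1] at h2
  have h4 := congrArg abs h2
  rw [abs_mul, smul_eq_mul, abs_mul, abs_abs, mul_comm] at h4
  exact mul_right_cancel₀ (abs_ne_zero.2 hdet) h4

/-- The adjugate turns the system into `det • y = 0`, which a torsion-free group solves only by `0`.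
-/
theorem eq_zero_of_sum_smul_eq_zero {G : Type*} [AddCommGroup G] [IsAddTorsionFree G] {m : ℕ}
    (w : Fin m → Fin m → ℤ) (hdet : (Matrix.of w).det ≠ 0) (y : Fin m → G)
    (hy : ∀ j, ∑ i, w i j • y i = 0) : y = 0 := by
  have h1 : intAct (Matrix.of w).transpose y = 0 := funext hy
  have h2 := congrArg (intAct (Matrix.of w).transpose.adjugate) h1
  rw [intAct_intAct, Matrix.adjugate_mul, Matrix.det_transpose] at h2
  funext j
  have h3 := congrFun h2 j
  simp only [intAct, Matrix.smul_apply, Matrix.one_apply, smul_eq_mul, mul_ite, mul_one, mul_zero,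
    ite_smul, zero_smul, Finset.sum_ite_eq, Finset.mem_univ, if_true, Pi.zero_apply, smul_zero,
    Finset.sum_const_zero] at h3
  exact (IsAddTorsionFree.zsmul_eq_zero_iff_right hdet).1 h3

end BoundedPolytopes

namespace BoundedPolytopes

/-! ## Simplices with vertices in general position -/

section Simplices

variable {Γ : Type*} [AddCommGroup Γ] [LinearOrder Γ] [IsOrderedAddMonoid Γ]

theorem image_intAct_openSimplex {κ : Type*} [Fintype κ] {m l : ℕ} (N : Matrix (Fin l) (Fin m) ℤ)
    (w : κ → Fin m → ℤ) (a : Γ) :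
    intAct N '' openSimplex w a = openSimplex (fun i => N.mulVec (w i)) a := by
  have key : ∀ t : κ → Γ, intAct N (fun j => ∑ i, w i j • t i) =
      fun j => ∑ i, N.mulVec (w i) j • t i := by
    intro t
    funext j
    simp only [intAct, Matrix.mulVec, dotProduct, Finset.smul_sum, Finset.sum_smul, smul_smul]
    exact Finset.sum_comm
  ext x
  constructor
  · rintro ⟨_, ⟨t, h1, h2, rfl⟩, rfl⟩
    exact ⟨t, h1, h2, key t⟩
  · rintro ⟨t, h1, h2, rfl⟩
    exact ⟨_, ⟨t, h1, h2, rfl⟩, key t⟩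

theorem openSimplex_eq_level {κ : Type*} [Fintype κ] {m : ℕ} (w : κ → Fin (m + 1) → ℤ)
    (hw : ∀ i, w i (Fin.last m) = 0) (a : Γ) :
    openSimplex w a = level (openSimplex (fun i => Fin.init (w i)) a) 0 := by
  ext x
  constructor
  · rintro ⟨t, h1, h2, rfl⟩
    exact ⟨⟨t, h1, h2, rfl⟩, by simp [hw]⟩
  · rintro ⟨⟨t, h1, h2, h3⟩, h4⟩
    refine ⟨t, h1, h2, ?_⟩
    funext j
    refine Fin.lastCases ?_ (fun j => ?_) j
    · simp [hw, h4]
    · exact congrFun h3 j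

/-- Smith normal form gives a lattice basis adapted to the span of `w`. By cardinality one basis
vector is not used; its coordinate vanishes on the span and is swapped into the last place. -/
theorem exists_linearEquiv_last_eq_zero {κ : Type*} [Fintype κ] {m : ℕ} (w : κ → Fin (m + 1) → ℤ)
    (hw : LinearIndependent ℤ w) (hc : Fintype.card κ < m + 1) :
    ∃ g : (Fin (m + 1) → ℤ) ≃ₗ[ℤ] (Fin (m + 1) → ℤ), ∀ i, g (w i) (Fin.last m) = 0 := by
  obtain ⟨n, snf⟩ := Submodule.smithNormalForm (Pi.basisFun ℤ (Fin (m + 1)))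
    (Submodule.span ℤ (Set.range w))
  have hn : n < m + 1 := by
    have h1 := Module.finrank_eq_card_basis snf.bN
    rw [finrank_span_eq_card hw, Fintype.card_fin] at h1
    omega
  obtain ⟨i₀, hi₀⟩ : ∃ i₀, i₀ ∉ Set.range snf.f := by
    by_contra hno
    push Not at hno
    have := Fintype.card_le_of_surjective snf.f hno
    simp only [Fintype.card_fin] at this
    omega
  refine ⟨snf.bM.equivFun.trans
    (LinearEquiv.funCongrLeft ℤ ℤ (Equiv.swap i₀ (Fin.last m))), fun i => ?_⟩
  have h2 := snf.repr_eq_zero_of_notMem_range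
    ⟨w i, Submodule.subset_span (Set.mem_range_self i)⟩ hi₀
  simpa [LinearEquiv.funCongrLeft, LinearMap.funLeft] using h2

variable {A : AddSubgroup Γ}

/-- A unimodular change of coordinates moves a simplex with fewer vertices than the rank into a
coordinate hyperplane, and the last coordinate is then dropped. Independence and the height
functional are carried along, so the induction hypothesis on the dimension applies. -/
theorem InS.openSimplex_of_card_lt {m : ℕ} (a : A)
    (ih : ∀ (κ : Type) [Fintype κ] (w : κ → Fin m → ℤ), LinearIndependent ℤ w →
      (∃ τ : (Fin m → ℤ) →ₗ[ℤ] ℤ, ∀ i, τ (w i) = 1) → InS A (openSimplex w (a : Γ)))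
    {κ : Type} [Fintype κ] (w : κ → Fin (m + 1) → ℤ) (hw : LinearIndependent ℤ w)
    (hτ : ∃ τ : (Fin (m + 1) → ℤ) →ₗ[ℤ] ℤ, ∀ i, τ (w i) = 1) (hc : Fintype.card κ < m + 1) :
    InS A (openSimplex w (a : Γ)) := by
  obtain ⟨g, hg⟩ := exists_linearEquiv_last_eq_zero w hw hc
  obtain ⟨τ, hτ⟩ := hτ
  let N := LinearMap.toMatrix' (g : (Fin (m + 1) → ℤ) →ₗ[ℤ] (Fin (m + 1) → ℤ))
  have hN : ∀ x, N.mulVec x = g x := fun x => LinearMap.toMatrix'_mulVec _ x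
  have hdet : IsUnit N.det := by
    rw [LinearMap.det_toMatrix']
    exact g.isUnit_det'
  let ext0 : (Fin m → ℤ) →ₗ[ℤ] (Fin (m + 1) → ℤ) :=
    { toFun := fun x => Fin.snoc x 0
      map_add' := fun x y => by
        funext j
        refine Fin.lastCases ?_ (fun j => ?_) j <;> simp
      map_smul' := fun c x => by
        funext j
        refine Fin.lastCases ?_ (fun j => ?_) j <;> simp }
  have hext : ∀ i, ext0 (Fin.init (g (w i))) = g (w i) := fun i => by
    have h : (Fin.snoc (Fin.init (g (w i))) 0 : Fin (m + 1) → ℤ) = g (w i) := by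
      rw [← hg i, Fin.snoc_init_self]
    exact h
  rw [← InS.image_intAct_iff N hdet, image_intAct_openSimplex]
  simp only [hN]
  rw [openSimplex_eq_level _ hg, InS.level_zero_iff]
  refine ih κ _ (LinearIndependent.of_comp ext0 ?_)
    ⟨τ ∘ₗ (g.symm : (Fin (m + 1) → ℤ) →ₗ[ℤ] (Fin (m + 1) → ℤ)) ∘ₗ ext0, fun i => ?_⟩
  · have : (ext0 ∘ fun i => Fin.init (g (w i)) : κ → Fin (m + 1) → ℤ) = g ∘ w := funext hext
    rw [this]
    exact hw.map' (g : (Fin (m + 1) → ℤ) →ₗ[ℤ] (Fin (m + 1) → ℤ)) g.ker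
  · rw [LinearMap.comp_apply, LinearMap.comp_apply, hext]
    simp [hτ]

/-- Proper faces have fewer than `m` vertices and are known by induction on the dimension; only the
full simplex needs an argument. -/
theorem openSimplex_comp_inS {m : ℕ} (a : A)
    (hA : ∀ (κ : Type) [Fintype κ] (w : κ → Fin m → ℤ), LinearIndependent ℤ w →
      (∃ τ : (Fin m → ℤ) →ₗ[ℤ] ℤ, ∀ i, τ (w i) = 1) → Fintype.card κ < m →
        InS A (openSimplex w (a : Γ)))
    (v : Fin m → Fin m → ℤ) (hv : (Matrix.of v).det ≠ 0)
    (hτ : ∃ τ : (Fin m → ℤ) →ₗ[ℤ] ℤ, ∀ i, τ (v i) = 1) {κ : Type} [Fintype κ] (ψ : κ → Fin m)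
    (hψ : Function.Injective ψ) (h : Function.Bijective ψ → InS A (openSimplex v (a : Γ))) :
    InS A (openSimplex (v ∘ ψ) (a : Γ)) := by
  by_cases hb : Function.Bijective ψ
  · rw [show v ∘ ψ = v ∘ Equiv.ofBijective ψ hb from rfl, openSimplex_equiv]
    exact h hb
  · obtain ⟨τ, hτ⟩ := hτ
    refine hA κ _ ((Matrix.linearIndependent_rows_of_det_ne_zero hv).comp ψ hψ)
      ⟨τ, fun i => hτ _⟩ ?_
    have h1 := Fintype.card_le_of_injective ψ hψ
    rw [Fintype.card_fin] at h1
    refine lt_of_le_of_ne h1 fun h2 => hb ?_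
    exact (Fintype.bijective_iff_injective_and_card ψ).2 ⟨hψ, by rw [h2, Fintype.card_fin]⟩

variable [Module ℚ Γ]

/-- Strong induction on the absolute value of the determinant, starting from unimodular simplices.
Otherwise a small lattice vector `p` of height one satisfies `d p = ∑ e i w i` with `|e i| < d`, and
the hull of `p` and the `w i` is dissected in two ways along this circuit. -/
theorem InS.openSimplex_of_det_ne_zero {m : ℕ} (a : A) (ha : 0 < a)
    (hA : ∀ (κ : Type) [Fintype κ] (w : κ → Fin m → ℤ), LinearIndependent ℤ w →
      (∃ τ : (Fin m → ℤ) →ₗ[ℤ] ℤ, ∀ i, τ (w i) = 1) → Fintype.card κ < m →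
        InS A (openSimplex w (a : Γ)))
    (τ : (Fin m → ℤ) →ₗ[ℤ] ℤ) (N : ℕ) (w : Fin m → Fin m → ℤ)
    (hN : (Matrix.of w).det.natAbs = N) (hw : (Matrix.of w).det ≠ 0) (hτ : ∀ i, τ (w i) = 1) :
    InS A (openSimplex w (a : Γ)) := by
  induction N using Nat.strong_induction_on generalizing w with
  | _ N ih =>
  by_cases hunit : IsUnit (Matrix.of w).det
  · exact InS.openSimplex_of_isUnit w hunit a ha
  obtain ⟨p, e, hp, he, hlt, hτp⟩ := exists_small_vector w hw hunit τ hτ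
  set d := |(Matrix.of w).det| with hd
  have hdpos : 0 < d := abs_pos.2 hw
  have hpj : ∀ j, d * p j = ∑ i, e i * w i j := fun j => by
    simpa using congrFun hp j
  let u : Option (Fin m) → Fin m → ℤ := fun o => o.elim p w
  -- The circuit, with `none` standing for `p`. Its coefficients sum to `0` because `∑ e i = d`,
  -- that is, because all vectors have height one.
  let z : Option (Fin m) → ℤ := fun o => o.elim d fun i => -e i
  have hz : ∑ o, z o = 0 := by
    simp [z, Fintype.sum_option, he]
  have hzu : ∀ j, ∑ o, z o * u o j = 0 := fun j => by
    simp [z, u, Fintype.sum_option, hpj]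
  obtain ⟨i₀, hi₀⟩ : ∃ i, 0 < e i := by
    by_contra hno
    push Not at hno
    exact absurd (Finset.sum_nonpos fun i _ => hno i) (not_le.2 (he ▸ hdpos))
  have hrel : ∀ s : Option (Fin m) → Γ, (∀ j, ∑ o, u o j • s o = 0) →
      ∃ l : Γ, ∀ o, s o = z o • l := by
    intro s hs
    have h1 : (fun i => e i • s none + d • s (some i)) = 0 := by
      refine eq_zero_of_sum_smul_eq_zero w hw _ fun j => ?_
      have h2 := congrArg (fun x => d • x) (hs j)
      simp only [Fintype.sum_option, u, Option.elim, smul_add, smul_zero, smul_smul, hpj,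
        Finset.sum_smul, Finset.smul_sum] at h2
      rw [← Finset.sum_add_distrib] at h2
      simp only [smul_add, smul_smul]
      rw [← h2]
      exact Finset.sum_congr rfl fun i _ => by rw [mul_comm (w i j), mul_comm (w i j)]
    have hdl : ∀ x : Γ, d • ((d : ℚ)⁻¹ • x) = x := fun x => by
      rw [← Int.cast_smul_eq_zsmul ℚ, smul_inv_smul₀ (by exact_mod_cast hdpos.ne')]
    refine ⟨(d : ℚ)⁻¹ • s none, fun o => ?_⟩
    cases o with
    | none => exact (hdl _).symm
    | some i =>
      refine zsmul_right_injective hdpos.ne' ?_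
      change d • s (some i) = d • (-e i) • _
      rw [smul_comm, hdl, neg_smul]
      exact eq_neg_of_add_eq_zero_right (congrFun h1 i)
  let J₀ : Finset (Option (Fin m)) := Finset.univ.map Function.Embedding.some
  -- A face of either dissection omits an index `o` in the support of the circuit. If `o = none`, it
  -- is a face of the given simplex, a proper one unless `J = J₀`. If `o = some k`, it is a face of
  -- the simplex with `w k` replaced by `p`, whose determinant has absolute value `|e k| < d`.
  have hface : ∀ J : Finset (Option (Fin m)), (∃ o, z o ≠ 0 ∧ o ∉ J) → J ≠ J₀ →
      InS A (face u (a : Γ) J) := by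
    rintro J ⟨o, hzo, hoJ⟩ hJ
    cases o with
    | none =>
      have hinj : Function.Injective fun o : J => (o : Option (Fin m)).elim i₀ id := by
        rintro ⟨o | x, h1⟩ ⟨o | y, h2⟩ h3
        · rfl
        · exact absurd h1 hoJ
        · exact absurd h2 hoJ
        · exact Subtype.ext (congrArg some h3)
      have hu : (fun o : J => u o) = w ∘ fun o : J => (o : Option (Fin m)).elim i₀ id := by
        funext ⟨o, ho⟩
        cases o with
        | none => exact absurd ho hoJ
        | some i => rfl
      rw [face, hu]
      refine openSimplex_comp_inS a hA w hw ⟨τ, hτ⟩ _ hinj fun hb => absurd ?_ hJ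
      refine Finset.ext fun o => ?_
      cases o with
      | none => simpa [J₀] using hoJ
      | some i =>
        obtain ⟨⟨o, ho⟩, h⟩ := hb.2 i
        cases o with
        | none => exact absurd ho hoJ
        | some i' =>
          obtain rfl : i' = i := h
          simpa [J₀] using ho
    | some k =>
      have hek : e k ≠ 0 := by simpa [z] using hzo
      have hdet := abs_det_update w hw p e hp k
      have hinj : Function.Injective fun o : J => (o : Option (Fin m)).elim k id := by
        rintro ⟨_ | x, h1⟩ ⟨_ | y, h2⟩ h3
        · rfl
        · obtain rfl : k = y := h3
          exact absurd h2 hoJ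
        · obtain rfl : x = k := h3
          exact absurd h1 hoJ
        · exact Subtype.ext (congrArg some h3)
      have hu : (fun o : J => u o) =
          Function.update w k p ∘ fun o : J => (o : Option (Fin m)).elim k id := by
        funext ⟨o, ho⟩
        cases o with
        | none => simp [u]
        | some i =>
          have hik : i ≠ k := by
            rintro rfl
            exact hoJ ho
          simp [u, hik]
      have hτ' : ∀ i, τ (Function.update w k p i) = 1 := fun i => by
        by_cases hik : i = k
        · subst hik
          simp [hτp]
        · simp [hik, hτ]
      have hdet0 : (Matrix.of (Function.update w k p)).det ≠ 0 :=
        abs_ne_zero.1 (by rw [hdet]; exact abs_ne_zero.2 hek)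
      rw [face, hu]
      refine openSimplex_comp_inS a hA _ hdet0 ⟨τ, hτ'⟩ _ hinj fun _ =>
        ih _ ?_ _ rfl hdet0 hτ'
      have := hlt k
      rw [← hdet, hd, Int.abs_eq_natAbs, Int.abs_eq_natAbs] at this
      omega
  -- Here every face omits a `w i` with `e i > 0`. The given simplex omits only `p`, so it does not
  -- occur, and the hull is known.
  have hclosed : InS A (closedSimplex u (a : Γ)) := by
    rw [closedSimplex_eq_biUnion_face hz hzu ⟨some i₀, by simpa [z] using hi₀⟩]
    refine InS.biUnion _ _ (fun J hJ => ?_) (pairwiseDisjoint_face hrel _)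
    obtain ⟨o, ho, hoJ⟩ := (Finset.mem_filter.1 hJ).2
    refine hface J ⟨o, ho.ne, hoJ⟩ ?_
    rintro rfl
    cases o with
    | none => exact absurd ho (not_lt.2 hdpos.le)
    | some i => exact hoJ (by simp [J₀])
  have hrel' : ∀ s : Option (Fin m) → Γ, (∀ j, ∑ o, u o j • s o = 0) →
      ∃ l : Γ, ∀ o, s o = (-z) o • l := fun s hs => by
    obtain ⟨l, hl⟩ := hrel s hs
    exact ⟨-l, fun o => by rw [hl, Pi.neg_apply, neg_smul_neg]⟩
  -- The opposite sign gives the dissection that contains `J₀`. Subtracting its other faces from the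
  -- hull leaves the given simplex.
  have hdisj := pairwiseDisjoint_face (z := -z) hrel' (a : Γ)
  rw [closedSimplex_eq_biUnion_face (z := -z) (by simp only [Pi.neg_apply, Finset.sum_neg_distrib, hz, neg_zero])
    (by simp only [Pi.neg_apply, neg_mul, Finset.sum_neg_distrib, hzu, neg_zero, implies_true])
    ⟨none, by simpa [z] using hdpos⟩] at hclosed
  set F := Finset.univ.filter fun J : Finset (Option (Fin m)) => ∃ o, (-z) o < 0 ∧ o ∉ J with hF
  have hJ₀ : J₀ ∈ F := by
    rw [hF, Finset.mem_filter]
    exact ⟨Finset.mem_univ _, none, by simpa [z] using hdpos, by simp [J₀]⟩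
  have hrest : InS A (⋃ J ∈ F.erase J₀, face u (a : Γ) J) := by
    refine InS.biUnion _ _ (fun J hJ => ?_) (hdisj.subset (Finset.coe_subset.2 (Finset.erase_subset _ _)))
    obtain ⟨hne, hJF⟩ := Finset.mem_erase.1 hJ
    obtain ⟨o, ho, hoJ⟩ := (Finset.mem_filter.1 hJF).2
    exact hface J ⟨o, fun h => by simp [h] at ho, hoJ⟩ hne
  rw [← Finset.insert_erase hJ₀, Finset.set_biUnion_insert, Set.union_comm] at hclosed
  have h0 := InS.of_union_left hclosed hrest (by
    refine Set.disjoint_left.2 fun x hx hx' => ?_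
    simp only [Set.mem_iUnion] at hx
    obtain ⟨J, hJ, hxJ⟩ := hx
    obtain ⟨hne, hJF⟩ := Finset.mem_erase.1 hJ
    exact Set.disjoint_left.1 (hdisj hJF hJ₀ hne) hxJ hx')
  let ε : Fin m ≃ J₀ := Equiv.ofBijective (fun i => ⟨some i, by simp [J₀]⟩)
    ⟨fun i j h => by simpa using h, fun ⟨o, ho⟩ => by
      obtain ⟨i, -, rfl⟩ := Finset.mem_map.1 ho
      exact ⟨i, rfl⟩⟩
  rwa [face, ← openSimplex_equiv ε] at h0

/-- The class of a lattice simplex of height one, scaled by an element of `A`, lies in the image of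
the symmetric algebra. -/
theorem InS.openSimplex (a : A) (ha : 0 < a) {m : ℕ} {κ : Type} [Fintype κ] (w : κ → Fin m → ℤ)
    (hw : LinearIndependent ℤ w) (hτ : ∃ τ : (Fin m → ℤ) →ₗ[ℤ] ℤ, ∀ i, τ (w i) = 1) :
    InS A (openSimplex w (a : Γ)) := by
  induction m generalizing κ with
  | zero =>
    have : IsEmpty κ := ⟨fun i => hw.ne_zero i (Subsingleton.elim _ _)⟩
    convert InS.empty (A := A) 0
    refine Set.eq_empty_of_forall_notMem fun x ⟨t, _, h2, _⟩ => ?_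
    rw [Finset.univ_eq_empty, Finset.sum_empty] at h2
    exact ha.ne (Subtype.ext h2)
  | succ m ih =>
    have hlt : ∀ (κ : Type) [Fintype κ] (w : κ → Fin (m + 1) → ℤ), LinearIndependent ℤ w →
        (∃ τ : (Fin (m + 1) → ℤ) →ₗ[ℤ] ℤ, ∀ i, τ (w i) = 1) → Fintype.card κ < m + 1 →
          InS A (BoundedPolytopes.openSimplex w (a : Γ)) := fun κ _ w hw hτ hc =>
      InS.openSimplex_of_card_lt a (fun κ _ w hw hτ => ih w hw hτ) w hw hτ hc
    have hle : Fintype.card κ ≤ m + 1 := by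
      simpa using hw.fintype_card_le_finrank
    rcases hle.lt_or_eq with h | h
    · exact hlt κ w hw hτ h
    · let ε : Fin (m + 1) ≃ κ := (Fintype.equivFinOfCardEq h).symm
      obtain ⟨τ, hτ⟩ := hτ
      rw [← openSimplex_equiv ε]
      refine InS.openSimplex_of_det_ne_zero a ha hlt τ _ _ rfl ?_ fun i => hτ _
      intro hdet
      obtain ⟨v, hv, hv'⟩ := Matrix.exists_vecMul_eq_zero_iff.2 hdet
      rw [Matrix.vecMul_eq_sum] at hv'
      exact hv (funext (Fintype.linearIndependent_iff.1 (hw.comp ε ε.injective) v hv'))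

end Simplices

end BoundedPolytopes

namespace BoundedPolytopes

/-! ## Definable sets over a divisible subgroup -/

theorem exists_integral_multiple {ι : Type*} [Fintype ι] (q : ι → ℚ) :
    ∃ (d : ℤ) (c : ι → ℤ), 0 < d ∧ ∀ i, (d : ℚ) * q i = c i := by
  classical
  have h : ∀ i, ∃ k : ℕ, ∏ j, (q j).den = (q i).den * k := fun i =>
    Finset.dvd_prod_of_mem (fun j => (q j).den) (Finset.mem_univ i)
  choose k hk using h
  refine ⟨((∏ j, (q j).den : ℕ) : ℤ), fun i => (q i).num * k i,
    by exact_mod_cast Finset.prod_pos fun j _ => (q j).den_pos, fun i => ?_⟩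
  rw [hk i]
  push_cast
  rw [mul_right_comm, mul_comm ((q i).den : ℚ), Rat.mul_den_eq_num]

section Divisible

variable {Γ : Type*} [AddCommGroup Γ] [LinearOrder Γ] [IsOrderedAddMonoid Γ] [Module ℚ Γ]
variable (A : AddSubgroup Γ) [Module ℚ A]

/-- The inclusion of a divisible subgroup as a linear map. -/
def incl : A →ₗ[ℚ] Γ := A.subtype.toRatLinearMap

variable {A}

theorem incl_apply (a : A) : incl A a = (a : Γ) := rfl

/-- Multiplication by a positive common denominator makes the coefficients integral and preserves
the sign. -/
theorem isDefinable_real {n : ℕ} (φ : Fml A n) : IsDefinable A (φ.real (incl A)) := by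
  induction φ with
  | neg f =>
    obtain ⟨d, c, hd, hc⟩ := exists_integral_multiple f.1
    convert IsDefinable.lt c (-(d • f.2)) using 1
    ext x
    have h1 : d • Aff.eval (incl A) f x = ∑ i, c i • x i + d • (f.2 : Γ) := by
      rw [Aff.eval, smul_add, Finset.smul_sum, incl_apply]
      congr 1
      refine Finset.sum_congr rfl fun i _ => ?_
      rw [← Int.cast_smul_eq_zsmul ℚ, smul_smul, hc, Int.cast_smul_eq_zsmul]
    change Aff.eval (incl A) f x < 0 ↔ _ < _
    rw [← smul_neg_iff_of_pos_left hd, h1]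
    simp [lt_neg_iff_add_neg]
  | compl φ ih => exact ih.compl
  | inter φ ψ ih₁ ih₂ => exact ih₁.inter _ _ ih₂

theorem IsDefinable.exists_fml_subgroup {n : ℕ} {X : Set (Fin n → Γ)} (hX : IsDefinable A X) :
    ∃ φ : Fml A n, φ.real (incl A) = X := by
  induction hX with
  | lt c a =>
    refine ⟨Fml.neg (fun i => (c i : ℚ), -a), ?_⟩
    ext x
    simp [Fml.real, Aff.eval, Int.cast_smul_eq_zsmul, incl_apply]
  | compl X _ ih =>
    obtain ⟨φ, rfl⟩ := ih
    exact ⟨φ.compl, rfl⟩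
  | inter X Y _ _ ih₁ ih₂ =>
    obtain ⟨φ, rfl⟩ := ih₁
    obtain ⟨ψ, rfl⟩ := ih₂
    exact ⟨φ.inter ψ, rfl⟩

theorem isDefinable_eval_lt {n : ℕ} (f g : Aff A n) :
    IsDefinable A {x : Fin n → Γ | f.eval (incl A) x < g.eval (incl A) x} := by
  convert isDefinable_real (Fml.neg (f - g)) using 1
  ext x
  simp [Fml.real, Aff.eval_sub]

theorem isDefinable_eval_eq {n : ℕ} (f g : Aff A n) :
    IsDefinable A {x : Fin n → Γ | f.eval (incl A) x = g.eval (incl A) x} := by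
  convert (isDefinable_eval_lt f g).compl.inter _ _ (isDefinable_eval_lt g f).compl using 1
  ext x
  simp [le_antisymm_iff, and_comm]

theorem Aff.exists_abs_eval_le {n : ℕ} (f : Aff A n) (α : A) :
    ∃ β : A, ∀ x ∈ box n (α : Γ), |f.eval (incl A) x| ≤ β := by
  refine ⟨∑ i, |f.1 i| • α + |f.2|, fun x hx => ?_⟩
  have h1 : ((∑ i, |f.1 i| • α + |f.2| : A) : Γ) = ∑ i, |f.1 i| • (α : Γ) + |(f.2 : Γ)| := by
    rw [← incl_apply, map_add, map_sum]
    simp only [map_smul, incl_apply]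
    rfl
  rw [h1]
  refine (abs_add_le _ _).trans (add_le_add ((Finset.abs_sum_le_sum_abs _ _).trans
    (Finset.sum_le_sum fun i _ => ?_)) le_rfl)
  rw [abs_smul]
  exact smul_le_smul_of_nonneg_left (abs_le.2 (hx i)) (abs_nonneg _)

theorem box_mono {n : ℕ} {α β : Γ} (h : α ≤ β) : box n α ⊆ box n β := fun _ hx i =>
  ⟨(neg_le_neg h).trans (hx i).1, (hx i).2.trans h⟩

open Filter in
-- A bounded set with parameters in `A` is already bounded by an element of `A`. The last coordinate
-- always lies between values of breakpoints, which are bounded over `A` once the remaining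
-- coordinates are; those satisfy one of the formulas obtained by midpoint substitution. Stating it
-- for all large `α` lets finitely many bounds be combined.
theorem Fml.eventually_real_subset_box {n : ℕ} (φ : Fml A n) (γ : Γ)
    (hφ : φ.real (incl A) ⊆ box n γ) : ∀ᶠ α : A in atTop, φ.real (incl A) ⊆ box n (α : Γ) := by
  induction n with
  | zero => exact Eventually.of_forall fun α x _ i => i.elim0
  | succ n ih =>
    rcases subsingleton_or_nontrivial Γ with hΓ | hΓ
    · exact Eventually.of_forall fun α x _ i =>
        ⟨(Subsingleton.elim _ _).le, (Subsingleton.elim _ _).le⟩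
    set T := φ.breakpoints with hT
    have h1 : ∀ᶠ α : A in atTop, ∀ l ∈ {l | l ∈ T}, ∀ u ∈ {u | u ∈ T},
        (φ.subst ((2⁻¹ : ℚ) • (l + u))).real (incl A) ⊆ box n (α : Γ) := by
      refine (eventually_all_finite (List.finite_toSet T)).2 fun l _ =>
        (eventually_all_finite (List.finite_toSet T)).2 fun u _ => ih _ fun x hx => ?_
      rw [Fml.mem_real_subst] at hx
      exact ((mem_box_snoc _ _ _).1 (hφ hx)).1
    obtain ⟨α₀, hα₀⟩ := h1.exists
    have h2 : ∀ᶠ α : A in atTop, ∀ l ∈ {l | l ∈ T}, ∀ x ∈ box n (α₀ : Γ),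
        |l.eval (incl A) x| ≤ α := by
      refine (eventually_all_finite (List.finite_toSet T)).2 fun l _ => ?_
      obtain ⟨β, hβ⟩ := l.exists_abs_eval_le α₀
      filter_upwards [eventually_ge_atTop β] with α hα x hx
      exact (hβ x hx).trans hα
    filter_upwards [h2, eventually_ge_atTop α₀] with α hα hα' z hz
    obtain ⟨x, y, rfl⟩ : ∃ x y, z = Fin.snoc (α := fun _ => Γ) x y :=
      ⟨Fin.init z, z (Fin.last n), (Fin.snoc_init_self z).symm⟩
    -- If `y` were below all breakpoints, it could be moved below `-γ` without leaving the set;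
    -- nontriviality of `Γ` provides such a value.
    have hlow : ∃ t ∈ T, t.eval (incl A) x ≤ y := by
      by_contra hno
      push Not at hno
      obtain ⟨y', hy'⟩ := exists_lt (min y (-γ))
      have h3 := (Fml.mem_real_congr (incl A) φ x y y' fun l hl =>
        ⟨iff_of_true (hno l hl) ((hy'.trans_le (min_le_left _ _)).trans (hno l hl)),
          iff_of_false (hno l hl).not_gt
            ((hy'.trans_le (min_le_left _ _)).trans (hno l hl)).not_gt⟩).1 hz
      exact absurd ((mem_box_snoc _ _ _).1 (hφ h3)).2.1
        (not_le.2 (hy'.trans_le (min_le_right _ _)))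
    have hupp : ∃ t ∈ T, y ≤ t.eval (incl A) x := by
      by_contra hno
      push Not at hno
      obtain ⟨y', hy'⟩ := exists_gt (max y γ)
      have h3 := (Fml.mem_real_congr (incl A) φ x y y' fun l hl =>
        ⟨iff_of_false (hno l hl).not_gt
            ((hno l hl).trans ((le_max_left _ _).trans_lt hy')).not_gt,
          iff_of_true (hno l hl) ((hno l hl).trans ((le_max_left _ _).trans_lt hy'))⟩).1 hz
      exact absurd ((mem_box_snoc _ _ _).1 (hφ h3)).2.2
        (not_le.2 ((le_max_right _ _).trans_lt hy'))
    obtain ⟨l, hl, u, hu, hly, hyu, hx, -⟩ :=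
      Fml.exists_midpoint (incl A) φ T (fun _ h => h) x y hz hlow hupp
    have hx' := hα₀ l hl u hu hx
    refine (mem_box_snoc _ _ _).2 ⟨box_mono (show (α₀ : Γ) ≤ α from hα') hx', ?_, ?_⟩
    · exact (abs_le.1 (hα l hl x hx')).1.trans hly
    · exact hyu.trans (abs_le.1 (hα u hu x hx')).2

theorem IsDefinable.exists_subset_box {n : ℕ} {X : Set (Fin n → Γ)} (hX : IsDefinable A X)
    (hb : IsBounded X) : ∃ α : A, X ⊆ box n (α : Γ) := by
  obtain ⟨φ, rfl⟩ := hX.exists_fml_subgroup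
  obtain ⟨γ, hγ⟩ := hb
  exact (φ.eventually_real_subset_box γ hγ).exists

end Divisible

end BoundedPolytopes

namespace BoundedPolytopes

/-! ## Decomposition into cones -/

/-- The first nonzero coordinate of the vector is positive. -/
def LexPos : {n : ℕ} → (Fin n → ℤ) → Prop
  | 0, _ => False
  | n + 1, w => LexPos (n := n) (Fin.init w) ∨ (Fin.init w = 0 ∧ 0 < w (Fin.last n))

theorem LexPos.smul {n : ℕ} {w : Fin n → ℤ} (hw : LexPos w) {d : ℤ} (hd : 0 < d) :
    LexPos (d • w) := by
  induction n with
  | zero => exact hw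
  | succ n ih =>
    rcases hw with h | ⟨h1, h2⟩
    · exact Or.inl (ih h)
    · refine Or.inr ⟨?_, mul_pos hd h2⟩
      have : Fin.init (d • w) = d • Fin.init w := rfl
      rw [this, h1, smul_zero]

/-- A lexicographic order on finitely many integral vectors is realized by weights that decrease
fast enough. -/
theorem exists_pos_functional {n : ℕ} (S : Finset (Fin n → ℤ)) (hS : ∀ w ∈ S, LexPos w) :
    ∃ c : Fin n → ℤ, ∀ w ∈ S, 0 < ∑ j, c j * w j := by
  classical
  induction n with
  | zero => exact ⟨0, fun w hw => (hS w hw).elim⟩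
  | succ n ih =>
    obtain ⟨c, hc⟩ := ih ((S.image Fin.init).filter LexPos) fun w hw => (Finset.mem_filter.1 hw).2
    -- The weight on the first coordinates exceeds every last entry in absolute value; integrality
    -- makes a positive value of `c` at least `1`, so it dominates.
    refine ⟨Fin.snoc (fun j => (1 + ∑ w ∈ S, |w (Fin.last n)|) * c j) 1, fun w hw => ?_⟩
    simp only [Fin.sum_univ_castSucc, Fin.snoc_castSucc, Fin.snoc_last, one_mul, mul_assoc]
    rw [← Finset.mul_sum]
    rcases hS w hw with h | ⟨h1, h2⟩
    · have h3 : 1 ≤ ∑ j, c j * w (Fin.castSucc j) := hc (Fin.init w)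
        (Finset.mem_filter.2 ⟨Finset.mem_image_of_mem _ hw, h⟩)
      have h4 : |w (Fin.last n)| ≤ ∑ w ∈ S, |w (Fin.last n)| :=
        Finset.single_le_sum (f := fun w : Fin (n + 1) → ℤ => |w (Fin.last n)|)
          (fun _ _ => abs_nonneg _) hw
      have h5 := neg_abs_le (w (Fin.last n))
      nlinarith [abs_nonneg (w (Fin.last n))]
    · have h3 : ∀ j : Fin n, w (Fin.castSucc j) = 0 := fun j => congrFun h1 j
      simpa [h3] using h2

/-- Adding a coordinate to a family of vectors, and possibly a last basis vector, indexed by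
`none`. -/
def extendFamily {κ : Type*} {n : ℕ} (w : κ → Fin n → ℤ) (d : ℤ) (c : κ → ℤ) :
    Option κ → Fin (n + 1) → ℤ
  | none => Fin.snoc (0 : Fin n → ℤ) 1
  | some i => Fin.snoc (d • w i) (c i)

theorem linearIndependent_extendFamily {κ : Type*} [Fintype κ] {n : ℕ} {w : κ → Fin n → ℤ}
    (hw : LinearIndependent ℤ w) {d : ℤ} (hd : d ≠ 0) (c : κ → ℤ) :
    LinearIndependent ℤ (extendFamily w d c) := by
  rw [Fintype.linearIndependent_iff] at hw ⊢
  intro g hg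
  rw [Fintype.sum_option] at hg
  have h1 : ∀ i, g (some i) = 0 := by
    have h2 : ∑ i, (d * g (some i)) • w i = 0 := by
      funext j
      have := congrFun hg j.castSucc
      simp only [extendFamily, Pi.add_apply, Pi.smul_apply, Fin.snoc_castSucc, Pi.zero_apply,
        Finset.sum_apply, smul_eq_mul] at this ⊢
      rw [← this, mul_zero, zero_add]
      exact Finset.sum_congr rfl fun i _ => by ring
    intro i
    exact (mul_eq_zero.1 (hw _ h2 i)).resolve_left hd
  have h3 : g none = 0 := by
    have := congrFun hg (Fin.last n)
    simpa [extendFamily, h1] using this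
  intro i
  cases i with
  | none => exact h3
  | some i => exact h1 i

theorem LexPos.extendFamily {κ : Type*} {n : ℕ} {w : κ → Fin n → ℤ} (hw : ∀ i, LexPos (w i))
    {d : ℤ} (hd : 0 < d) (c : κ → ℤ) (o : Option κ) : LexPos (extendFamily w d c o) := by
  cases o with
  | none =>
    refine Or.inr ⟨?_, ?_⟩
    · simp [BoundedPolytopes.extendFamily]
    · simp [BoundedPolytopes.extendFamily]
  | some i =>
    refine Or.inl ?_
    rw [BoundedPolytopes.extendFamily, Fin.init_snoc]
    exact (hw i).smul hd

section Cones

variable {Γ : Type*} [AddCommGroup Γ] [LinearOrder Γ] [IsOrderedAddMonoid Γ]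

/-- The open simplicial cone with apex `v` spanned by a family of vectors. -/
def cone {κ : Type*} [Fintype κ] {n : ℕ} (v : Fin n → Γ) (w : κ → Fin n → ℤ) :
    Set (Fin n → Γ) :=
  {x | ∃ t : κ → Γ, (∀ i, 0 < t i) ∧ x = fun j => v j + ∑ i, w i j • t i}

theorem cone_smul [Module ℚ Γ] {κ : Type*} [Fintype κ] {n : ℕ} (v : Fin n → Γ)
    (w : κ → Fin n → ℤ) (d : κ → ℤ) (hd : ∀ i, 0 < d i) :
    cone v (fun i => d i • w i) = cone v w := by
  ext x
  constructor
  · rintro ⟨t, ht, rfl⟩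
    refine ⟨fun i => d i • t i, fun i => zsmul_pos (ht i) (hd i), ?_⟩
    funext j
    refine congrArg (v j + ·) (Finset.sum_congr rfl fun i _ => ?_)
    change (d i * w i j) • t i = w i j • d i • t i
    rw [smul_smul, mul_comm]
  · rintro ⟨t, ht, rfl⟩
    have hd' : ∀ i, (0 : ℚ) < d i := fun i => by exact_mod_cast hd i
    refine ⟨fun i => (d i : ℚ)⁻¹ • t i, fun i => smul_pos (inv_pos.2 (hd' i)) (ht i), ?_⟩
    funext j
    refine congrArg (v j + ·) (Finset.sum_congr rfl fun i _ => ?_)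
    change w i j • t i = (d i * w i j) • (d i : ℚ)⁻¹ • t i
    rw [mul_comm, mul_smul, ← Int.cast_smul_eq_zsmul ℚ (d i),
      smul_inv_smul₀ (hd' i).ne']

variable (A : AddSubgroup Γ)

/-- The group of functions generated by the indicator functions of the simplicial cones with apex
in `A^n`, spanned by vectors in `S`. -/
def coneSpan {n : ℕ} (S : Set (Fin n → ℤ)) : AddSubgroup ((Fin n → Γ) → ℤ) :=
  AddSubgroup.closure {f | ∃ (κ : Type) (_ : Fintype κ) (v : Fin n → A) (w : κ → Fin n → ℤ),
    LinearIndependent ℤ w ∧ (∀ i, w i ∈ S) ∧ f = (cone (fun j => (v j : Γ)) w).indicator 1}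

variable {A}

theorem coneSpan_mono {n : ℕ} {S S' : Set (Fin n → ℤ)} (h : S ⊆ S') :
    coneSpan A S ≤ coneSpan A S' :=
  AddSubgroup.closure_mono fun _ ⟨κ, hκ, v, w, h1, h2, h3⟩ =>
    ⟨κ, hκ, v, w, h1, fun i => h (h2 i), h3⟩

theorem indicator_cone_mem {n : ℕ} {S : Set (Fin n → ℤ)} {κ : Type} [Fintype κ] (v : Fin n → A)
    {w : κ → Fin n → ℤ} (hw : LinearIndependent ℤ w) (hS : ∀ i, w i ∈ S) :
    (cone (fun j => (v j : Γ)) w).indicator 1 ∈ coneSpan A S :=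
  AddSubgroup.subset_closure ⟨κ, _, v, w, hw, hS, rfl⟩

/-- Only finitely many directions occur in a given combination, so a single functional can be
positive on all of them. -/
theorem exists_finset_mem_coneSpan {n : ℕ} {S : Set (Fin n → ℤ)} {f : (Fin n → Γ) → ℤ}
    (hf : f ∈ coneSpan A S) : ∃ T : Finset (Fin n → ℤ), ↑T ⊆ S ∧ f ∈ coneSpan A (T : Set _) := by
  classical
  induction hf using AddSubgroup.closure_induction with
  | mem f hf =>
    obtain ⟨κ, _, v, w, h1, h2, rfl⟩ := hf
    refine ⟨Finset.univ.image w, ?_, indicator_cone_mem v h1 fun i => by simp⟩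
    rw [Finset.coe_image, Finset.coe_univ, Set.image_univ]
    exact Set.range_subset_iff.2 h2
  | zero => exact ⟨∅, by simp, zero_mem _⟩
  | add f g _ _ hf hg =>
    obtain ⟨T, hT, hf⟩ := hf
    obtain ⟨T', hT', hg⟩ := hg
    refine ⟨T ∪ T', by simp [hT, hT'], add_mem (coneSpan_mono ?_ hf) (coneSpan_mono ?_ hg)⟩ <;>
      simp
  | neg f _ hf =>
    obtain ⟨T, hT, hf⟩ := hf
    exact ⟨T, hT, neg_mem hf⟩

variable [Module ℚ Γ] [Module ℚ A]

/-- The part of the cylinder over `D` above the graph of an affine form; the graph is included if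
`b` is `false`. -/
def upper {n : ℕ} (D : Set (Fin n → Γ)) (l : Aff A n) (b : Bool) : Set (Fin (n + 1) → Γ) :=
  {z | Fin.init z ∈ D ∧ l.eval (incl A) (Fin.init z) ≤ z (Fin.last n) ∧
    (b = true → l.eval (incl A) (Fin.init z) ≠ z (Fin.last n))}

variable (A) in
/-- The group of functions generated by indicator functions of cylinders truncated from below. -/
def upperSpan (n : ℕ) (α : A) : AddSubgroup ((Fin (n + 1) → Γ) → ℤ) :=
  AddSubgroup.closure {f | ∃ (D : Set (Fin n → Γ)) (l : Aff A n) (b : Bool),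
    IsDefinable A D ∧ (∀ x ∈ D, ∀ i, (α : Γ) ≤ x i) ∧ f = (upper D l b).indicator 1}

theorem indicator_upper_mem {n : ℕ} {α : A} {D : Set (Fin n → Γ)} (hD : IsDefinable A D)
    (hα : ∀ x ∈ D, ∀ i, (α : Γ) ≤ x i) (l : Aff A n) (b : Bool) :
    (upper D l b).indicator 1 ∈ upperSpan A n α :=
  AddSubgroup.subset_closure ⟨D, l, b, hD, hα, rfl⟩

/-- Multiplication by a function preserves the span. -/
theorem mul_mem_upperSpan {n : ℕ} {α : A} (g : (Fin (n + 1) → Γ) → ℤ)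
    (hg : ∀ (D : Set (Fin n → Γ)) (l : Aff A n) (b : Bool), IsDefinable A D →
      (∀ x ∈ D, ∀ i, (α : Γ) ≤ x i) → g * (upper D l b).indicator 1 ∈ upperSpan A n α)
    {f : (Fin (n + 1) → Γ) → ℤ} (hf : f ∈ upperSpan A n α) : g * f ∈ upperSpan A n α := by
  induction hf using AddSubgroup.closure_induction with
  | mem f hf =>
    obtain ⟨D, l, b, h1, h2, rfl⟩ := hf
    exact hg D l b h1 h2
  | zero => rw [mul_zero]; exact zero_mem _
  | add f f' _ _ hf hf' => rw [mul_add]; exact add_mem hf hf'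
  | neg f _ hf => rw [mul_neg]; exact neg_mem hf

/-- Of two lower bounds on the last coordinate only the larger one counts, so the base is split by
comparing them. Where they agree, the bound is strict if either one is. -/
theorem indicator_upper_univ_mul {n : ℕ} (D : Set (Fin n → Γ)) (l l' : Aff A n) (b b' : Bool) :
    ((upper Set.univ l' b').indicator 1 * (upper D l b).indicator 1 : (Fin (n + 1) → Γ) → ℤ) =
      (upper (D ∩ {x | l'.eval (incl A) x < l.eval (incl A) x}) l b).indicator 1 +
      (upper (D ∩ {x | l.eval (incl A) x < l'.eval (incl A) x}) l' b').indicator 1 +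
      (upper (D ∩ {x | l.eval (incl A) x = l'.eval (incl A) x}) l (b || b')).indicator 1 := by
  classical
  funext z
  simp only [Pi.mul_apply, Pi.add_apply, Set.indicator_apply, upper, Set.mem_ofPred_eq,
    Set.mem_univ, true_and, Set.mem_inter_iff, Pi.one_apply]
  generalize l.eval (incl A) (Fin.init z) = p
  generalize l'.eval (incl A) (Fin.init z) = q
  generalize z (Fin.last n) = y
  by_cases hD : Fin.init z ∈ D
  · rcases lt_trichotomy p q with h | h | h <;> cases b <;> cases b' <;>
      simp only [hD] <;> grind
  · simp [hD]

/-- An atomic formula is a lower bound on the last coordinate, a condition on the base, or an upper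
bound. An upper bound is the complement of a lower bound and enters through a difference, so no
truncation from above, and no downward direction, is needed. -/
theorem indicator_mul_mem_upperSpan {n : ℕ} {α : A} (φ : Fml A (n + 1))
    {f : (Fin (n + 1) → Γ) → ℤ} (hf : f ∈ upperSpan A n α) :
    (φ.real (incl A)).indicator 1 * f ∈ upperSpan A n α := by
  classical
  have hupper : ∀ (l' : Aff A n) (b' : Bool) {f : (Fin (n + 1) → Γ) → ℤ}, f ∈ upperSpan A n α →
      (upper Set.univ l' b').indicator 1 * f ∈ upperSpan A n α := by
    intro l' b' f hf
    refine mul_mem_upperSpan _ (fun D l b hD hα => ?_) hf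
    rw [indicator_upper_univ_mul]
    have h1 : ∀ E : Set (Fin n → Γ), ∀ x ∈ D ∩ E, ∀ i, (α : Γ) ≤ x i := fun E x hx => hα x hx.1
    exact add_mem (add_mem
      (indicator_upper_mem (hD.inter _ _ (isDefinable_eval_lt _ _)) (h1 _) _ _)
      (indicator_upper_mem (hD.inter _ _ (isDefinable_eval_lt _ _)) (h1 _) _ _))
      (indicator_upper_mem (hD.inter _ _ (isDefinable_eval_eq _ _)) (h1 _) _ _)
  have hcompl : ∀ X : Set (Fin (n + 1) → Γ),
      (∀ f ∈ upperSpan A n α, X.indicator 1 * f ∈ upperSpan A n α) →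
      ∀ f ∈ upperSpan A n α, Xᶜ.indicator 1 * f ∈ upperSpan A n α := by
    intro X hX f hf
    rw [Set.indicator_compl, sub_mul, one_mul]
    exact sub_mem hf (hX f hf)
  induction φ generalizing f with
  | neg g =>
    rcases lt_trichotomy (g.1 (Fin.last n)) 0 with hg | hg | hg
    · have h1 : (Fml.neg g).real (incl A) = upper Set.univ g.root true := by
        ext z
        rw [← Fin.snoc_init_self z]
        refine (Aff.eval_snoc_neg_iff_of_neg _ _ _ _ hg).trans ?_
        simp [upper, lt_iff_le_and_ne]
      rw [h1]
      exact hupper _ _ hf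
    · have h1 : (Fml.neg g).real (incl A) =
          {z : Fin (n + 1) → Γ | g.init.eval (incl A) (Fin.init z) < 0} := by
        ext z
        change Aff.eval _ _ _ < 0 ↔ _
        conv_lhs => rw [← Fin.snoc_init_self z, Aff.eval_snoc, hg, zero_smul, add_zero]
        rfl
      rw [h1]
      refine mul_mem_upperSpan _ (fun D l b hD hα => ?_) hf
      convert indicator_upper_mem (hD.inter _ _ (isDefinable_real (Fml.neg g.init)))
        (fun x hx => hα x hx.1) l b using 1
      rw [← Set.inter_indicator_one]
      congr 1
      ext z
      simp only [upper, Set.mem_inter_iff, Set.mem_ofPred_eq, Fml.real]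
      tauto
    · have h1 : (Fml.neg g).real (incl A) = (upper Set.univ g.root false)ᶜ := by
        ext z
        rw [← Fin.snoc_init_self z]
        refine (Aff.eval_snoc_neg_iff_of_pos _ _ _ _ hg).trans ?_
        simp [upper]
      rw [h1]
      exact hcompl _ (fun f hf => hupper _ _ hf) f hf
  | compl φ ih => exact hcompl _ (fun f hf => ih hf) f hf
  | inter φ ψ ih₁ ih₂ =>
    have h1 : ((φ.inter ψ).real (incl A)).indicator (1 : (Fin (n + 1) → Γ) → ℤ) =
        (φ.real (incl A)).indicator 1 * (ψ.real (incl A)).indicator 1 := by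
      rw [← Set.inter_indicator_one]
      rfl
    rw [h1, mul_assoc]
    exact ih₁ (ih₂ hf)

/-- The graph of an affine form over a cone is the cone spanned by the rays lifted along its linear
part, scaled by `d` to be integral; the region strictly above it has the vertical unit vector as one
further ray. The apex stays in `A` because `A` is a rational vector space. -/
theorem cone_extend {κ : Type} [Fintype κ] {n : ℕ} (v : Fin n → A) (w : κ → Fin n → ℤ)
    (l : Aff A n) : ∃ (d : ℤ) (c : κ → ℤ) (v' : Fin (n + 1) → A), 0 < d ∧
      upper (cone (fun j => (v j : Γ)) w) l true =
        cone (fun j => (v' j : Γ)) (extendFamily w d c) ∧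
      upper (cone (fun j => (v j : Γ)) w) l false \ upper (cone (fun j => (v j : Γ)) w) l true =
        cone (fun j => (v' j : Γ)) (extendFamily w d c ∘ some) := by
  obtain ⟨d, p, hd, hp⟩ := exists_integral_multiple l.1
  obtain ⟨a, ha⟩ : ∃ a : A, (a : Γ) = l.eval (incl A) (fun j => (v j : Γ)) :=
    ⟨l.eval LinearMap.id v, by
      simp only [Aff.eval, LinearMap.id_apply]
      rw [← incl_apply, map_add, map_sum]
      simp only [map_smul]
      rfl⟩
  have hev : ∀ t : κ → Γ, l.eval (incl A) (fun j => (v j : Γ) + ∑ i, (d • w i) j • t i) =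
      a + ∑ i, (∑ j, p j * w i j) • t i := by
    intro t
    rw [ha]
    simp only [Aff.eval, smul_add, Finset.sum_add_distrib, Finset.smul_sum, Pi.smul_apply,
      smul_eq_mul]
    have h1 : ∀ (i : κ) (j : Fin n), l.1 j • ((d * w i j) • t i) =
        (p j * w i j) • t i := fun i j => by
      rw [← Int.cast_smul_eq_zsmul ℚ, ← Int.cast_smul_eq_zsmul ℚ, smul_smul]
      congr 1
      simp only [Int.cast_mul, ← hp]
      ring
    simp only [h1, Finset.sum_smul]
    rw [Finset.sum_comm]
    abel
  rw [← cone_smul _ w (fun _ => d) fun _ => hd]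
  refine ⟨d, fun i => ∑ j, p j * w i j, Fin.snoc v a, hd, ?_, ?_⟩
  · ext z
    constructor
    · rintro ⟨⟨t, ht, hz⟩, h1, h2⟩
      rw [hz, hev] at h1 h2
      refine ⟨fun o => o.elim (z (Fin.last n) - (a + ∑ i, (∑ j, p j * w i j) • t i)) t, ?_, ?_⟩
      · rintro (_ | i)
        · exact sub_pos.2 (lt_of_le_of_ne h1 (h2 rfl))
        · exact ht i
      · rw [← Fin.snoc_init_self z, hz]
        funext j
        refine Fin.lastCases ?_ (fun j => ?_) j
        · simp only [Fin.snoc_last, extendFamily, Fintype.sum_option, Option.elim, one_smul]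
          abel
        · simp [extendFamily, Fintype.sum_option]
    · rintro ⟨t, ht, rfl⟩
      have h0 : Fin.init (fun j => ((Fin.snoc v a : Fin (n + 1) → A) j : Γ) +
          ∑ i, extendFamily w d (fun i => ∑ j, p j * w i j) i j • t i) =
            fun j => (v j : Γ) + ∑ i, (d • w i) j • t (some i) := by
        funext j
        simp [Fin.init, extendFamily, Fintype.sum_option]
      have h3 : ∀ s : Γ, s + t none + ∑ i, (∑ j, p j * w i j) • t (some i) =
          s + ∑ i, (∑ j, p j * w i j) • t (some i) + t none := fun s => by abel
      have h4 : (a : Γ) + ∑ i, (∑ j, p j * w i j) • t (some i) <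
          (fun j => ((Fin.snoc v a : Fin (n + 1) → A) j : Γ) +
          ∑ i, extendFamily w d (fun i => ∑ j, p j * w i j) i j • t i) (Fin.last n) := by
        simp only [extendFamily, Fintype.sum_option, Fin.snoc_last, one_smul, ← add_assoc, h3]
        exact lt_add_of_pos_right _ (ht none)
      refine ⟨?_, ?_, ?_⟩
      · rw [h0]
        exact ⟨fun i => t (some i), fun i => ht _, rfl⟩
      · rw [h0, hev]
        exact h4.le
      · rw [h0, hev]
        exact fun _ => h4.ne
  · ext z
    constructor
    · rintro ⟨⟨⟨t, ht, hz⟩, h1, -⟩, h2⟩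
      have h3 : l.eval (incl A) (Fin.init z) = z (Fin.last n) := by
        by_contra hne
        exact h2 ⟨⟨t, ht, hz⟩, h1, fun _ => hne⟩
      rw [hz, hev] at h3
      refine ⟨t, ht, ?_⟩
      rw [← Fin.snoc_init_self z, hz, ← h3]
      funext j
      refine Fin.lastCases ?_ (fun j => ?_) j
      · simp [extendFamily]
      · simp [extendFamily]
    · rintro ⟨t, ht, rfl⟩
      have h0 : Fin.init (fun j => ((Fin.snoc v a : Fin (n + 1) → A) j : Γ) +
          ∑ i, (extendFamily w d (fun i => ∑ j, p j * w i j) ∘ some) i j • t i) =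
            fun j => (v j : Γ) + ∑ i, (d • w i) j • t i := by
        funext j
        simp [Fin.init, extendFamily]
      have h1 : l.eval (incl A) (Fin.init (fun j => ((Fin.snoc v a : Fin (n + 1) → A) j : Γ) +
          ∑ i, (extendFamily w d (fun i => ∑ j, p j * w i j) ∘ some) i j • t i)) =
            (fun j => ((Fin.snoc v a : Fin (n + 1) → A) j : Γ) +
          ∑ i, (extendFamily w d (fun i => ∑ j, p j * w i j) ∘ some) i j • t i) (Fin.last n) := by
        rw [h0, hev]
        simp [extendFamily]
      refine ⟨⟨?_, h1.le, fun h => by cases h⟩, fun h => h.2.2 rfl h1⟩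
      rw [h0]
      exact ⟨t, ht, rfl⟩

/-- By linearity the base may be taken to be a cone, which `cone_extend` lifts; a non-strict bound
contributes the graph as a second cone. -/
theorem upperSpan_le_coneSpan {n : ℕ} {α : A}
    (ih : ∀ D : Set (Fin n → Γ), IsDefinable A D → (∀ x ∈ D, ∀ i, (α : Γ) ≤ x i) →
      D.indicator 1 ∈ coneSpan A {w : Fin n → ℤ | LexPos w}) :
    upperSpan A n α ≤ coneSpan A {w : Fin (n + 1) → ℤ | LexPos w} := by
  classical
  refine (AddSubgroup.closure_le _).2 ?_
  rintro _ ⟨D, l, b, hD, hα, rfl⟩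
  have key : ∀ f ∈ coneSpan A {w : Fin n → ℤ | LexPos w},
      (fun z : Fin (n + 1) → Γ => f (Fin.init z) * (upper Set.univ l b).indicator 1 z) ∈
        coneSpan A {w : Fin (n + 1) → ℤ | LexPos w} := by
    intro f hf
    induction hf using AddSubgroup.closure_induction with
    | mem f hf =>
      obtain ⟨κ, _, v, w, h1, h2, rfl⟩ := hf
      obtain ⟨d, c, v', hd, h3, h4⟩ := cone_extend v w l
      have h5 : ∀ b : Bool, (fun z : Fin (n + 1) → Γ =>
          (cone (fun j => (v j : Γ)) w).indicator (1 : (Fin n → Γ) → ℤ) (Fin.init z) *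
            (upper Set.univ l b).indicator 1 z) =
          (upper (cone (fun j => (v j : Γ)) w) l b).indicator 1 := by
        intro b
        funext z
        simp only [Set.indicator_apply, upper, Set.mem_ofPred_eq, Set.mem_univ, true_and,
          Pi.one_apply]
        by_cases h : Fin.init z ∈ cone (fun j => (v j : Γ)) w <;> simp [h]
      have h6 := linearIndependent_extendFamily h1 hd.ne' c
      have h7 : (upper (cone (fun j => (v j : Γ)) w) l true).indicator 1 ∈
          coneSpan A {w : Fin (n + 1) → ℤ | LexPos w} := by
        rw [h3]
        exact indicator_cone_mem v' h6 (LexPos.extendFamily h2 hd c)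
      rw [h5]
      cases b with
      | true => exact h7
      | false =>
        have h8 := indicator_cone_mem v' (h6.comp _ (Option.some_injective κ))
          (S := {w : Fin (n + 1) → ℤ | LexPos w}) (fun i => LexPos.extendFamily h2 hd c (some i))
        have hsub : upper (cone (fun j => (v j : Γ)) w) l true ⊆
            upper (cone (fun j => (v j : Γ)) w) l false :=
          fun z hz => ⟨hz.1, hz.2.1, fun h => by cases h⟩
        rw [← h4, Set.indicator_sdiff hsub] at h8
        have h9 := add_mem h8 h7
        rwa [sub_add_cancel] at h9
    | zero =>
      convert zero_mem (coneSpan A {w : Fin (n + 1) → ℤ | LexPos w}) using 1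
      funext z
      simp
    | add f g _ _ hf hg =>
      convert add_mem hf hg using 1
      funext z
      simp [add_mul]
    | neg f _ hf =>
      convert neg_mem hf using 1
      funext z
      simp
  have h0 := key _ (ih D hD hα)
  refine (congrArg (· ∈ coneSpan A {w : Fin (n + 1) → ℤ | LexPos w}) ?_).mp h0
  funext z
  simp only [Set.indicator_apply, upper, Set.mem_ofPred_eq, Set.mem_univ, true_and, Pi.one_apply]
  by_cases h : Fin.init z ∈ D <;> simp [h]

/-- The indicator function of a definable set that is bounded below is a combination of indicator
functions of cones. -/
theorem indicator_mem_coneSpan {n : ℕ} (α : A) (X : Set (Fin n → Γ)) (hX : IsDefinable A X)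
    (hα : ∀ x ∈ X, ∀ i, (α : Γ) ≤ x i) :
    X.indicator 1 ∈ coneSpan A {w : Fin n → ℤ | LexPos w} := by
  induction n with
  | zero =>
    rcases Set.eq_empty_or_nonempty X with rfl | h
    · rw [Set.indicator_empty]
      exact zero_mem _
    · have h1 : X = cone (fun j : Fin 0 => ((0 : Fin 0 → A) j : Γ))
          (fun i : Empty => i.elim) := by
        rw [Subsingleton.eq_univ_of_nonempty h, eq_comm, Set.eq_univ_iff_forall]
        exact fun x => ⟨fun i => i.elim, fun i => i.elim, Subsingleton.elim _ _⟩
      rw [h1]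
      exact indicator_cone_mem 0 linearIndependent_empty_type fun i => i.elim
  | succ n ih =>
    obtain ⟨φ, rfl⟩ := hX.exists_fml_subgroup
    have hD : IsDefinable A {x : Fin n → Γ | ∀ i, (α : Γ) ≤ x i} := by
      refine IsDefinable.iInter (fun i : Fin n => {x | (α : Γ) ≤ x i}) fun i => ?_
      convert IsDefinable.ge (Pi.single i 1) α using 1
      ext x
      simp [Pi.single_apply, ite_smul]
    -- The orthant of points with all coordinates at least `α` contains the set and belongs to the
    -- span, so multiplying its indicator by that of the formula returns the set.
    have h1 := indicator_mul_mem_upperSpan φ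
      (indicator_upper_mem hD (fun x hx => hx) (0, α) false)
    have h2 := upperSpan_le_coneSpan ih h1
    convert h2 using 1
    rw [← Set.inter_indicator_one, Set.inter_eq_left.2]
    intro z hz
    exact ⟨fun i => hα z hz _, by simpa [Aff.eval, incl_apply] using hα z hz (Fin.last n),
      fun h => by cases h⟩

end Cones

end BoundedPolytopes

namespace BoundedPolytopes

/-! ## Generation by simplices -/

/-- Independence over `ℤ` passes to torsion-free coefficients because the Gram matrix of the family
has nonzero determinant, which reduces the claim to the square case. -/
theorem LinearIndependent.eq_zero_of_sum_smul_eq_zero {G : Type*} [AddCommGroup G]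
    [IsAddTorsionFree G] {κ : Type*} [Fintype κ] {n : ℕ} {w : κ → Fin n → ℤ}
    (hw : LinearIndependent ℤ w) (y : κ → G) (hy : ∀ j, ∑ i, w i j • y i = 0) : y = 0 := by
  classical
  let e := (Fintype.equivFin κ).symm
  let W : Matrix (Fin (Fintype.card κ)) (Fin n) ℤ := Matrix.of (w ∘ e)
  have hdet : (W * W.transpose).det ≠ 0 := by
    intro h0
    obtain ⟨v, hv, hv'⟩ := Matrix.exists_vecMul_eq_zero_iff.2 h0
    have h1 : Matrix.vecMul v W = 0 := by
      rw [← Matrix.vecMul_vecMul] at hv'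
      have h2 := congrArg (fun u => dotProduct u v) hv'
      simp only [zero_dotProduct, ← Matrix.dotProduct_mulVec, Matrix.mulVec_transpose] at h2
      rw [Matrix.dotProduct_mulVec] at h2
      exact dotProduct_self_eq_zero.1 h2
    rw [Matrix.vecMul_eq_sum] at h1
    exact hv (funext (Fintype.linearIndependent_iff.1 (hw.comp e e.injective) v h1))
  have h3 := BoundedPolytopes.eq_zero_of_sum_smul_eq_zero (fun i j => (W * W.transpose) i j) hdet
    (y ∘ e) fun k => by
      simp only [Matrix.mul_apply, Matrix.transpose_apply, Finset.sum_smul, Function.comp_apply]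
      rw [Finset.sum_comm]
      refine Finset.sum_eq_zero fun j _ => ?_
      have h4 : ∀ i, (W i j * W k j) • y (e i) = W k j • (w (e i) j • y (e i)) := fun i => by
        rw [mul_comm, mul_smul]
        rfl
      simp only [h4]
      rw [← Finset.smul_sum, e.sum_comp (fun i => w i j • y i), hy, smul_zero]
  funext i
  have := congrFun h3 (e.symm i)
  simpa using this

section Generation

variable {Γ : Type*} [AddCommGroup Γ] [LinearOrder Γ] [IsOrderedAddMonoid Γ]
variable {A : AddSubgroup Γ}

theorem InS.singleton_zero (n : ℕ) : InS A ({0} : Set (Fin n → Γ)) := by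
  induction n with
  | zero =>
    convert InS.univ_zero (A := A)
    exact Set.eq_univ_of_forall fun x => Subsingleton.elim x 0
  | succ n ih =>
    convert InS.level_zero_iff.2 ih using 1
    ext z
    constructor
    · rintro rfl
      exact ⟨rfl, rfl⟩
    · rintro ⟨h1, h2⟩
      rw [Set.mem_singleton_iff, ← Fin.snoc_init_self z, h2, show Fin.init z = 0 from h1]
      funext j
      refine Fin.lastCases ?_ (fun j => ?_) j <;> simp

theorem InS.translate {n : ℕ} {X : Set (Fin n → Γ)} (hX : InS A X) (v : Fin n → A) :
    InS A {x | (fun j => x j - v j) ∈ X} := by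
  convert hX.affine 1 v using 1
  rw [Equiv.image_eq_preimage_symm]
  ext x
  have : (affEquiv 1 fun j => (v j : Γ)).symm x = fun j => x j - v j := by
    rw [Equiv.symm_apply_eq]
    change x = intAct (1 : Matrix (Fin n) (Fin n) ℤ) _ + _
    rw [intAct_one]
    funext j
    simp
  rw [Set.mem_preimage, this]
  rfl

variable [Module ℚ Γ]

/-- The simplex spanned by the origin and linearly independent vectors, without the faces
containing the origin. -/
theorem InS.truncatedSimplex (a : A) {n : ℕ} {κ : Type} [Fintype κ] {w : κ → Fin n → ℤ}
    (hw : LinearIndependent ℤ w) :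
    InS A {x : Fin n → Γ | ∃ t : κ → Γ, (∀ i, 0 < t i) ∧ ∑ i, t i ≤ (a : Γ) ∧
      x = fun j => ∑ i, w i j • t i} := by
  rcases le_or_gt a 0 with ha | ha
  -- For `a ≤ 0` only the empty family can contribute, and it contributes at most the origin.
  · have hsub : {x : Fin n → Γ | ∃ t : κ → Γ, (∀ i, 0 < t i) ∧ ∑ i, t i ≤ (a : Γ) ∧
        x = fun j => ∑ i, w i j • t i} ⊆ {0} := by
      rintro x ⟨t, h1, h2, rfl⟩
      rcases isEmpty_or_nonempty κ with h | h
      · funext j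
        simp
      · exact absurd (Finset.sum_pos (fun i _ => h1 i) Finset.univ_nonempty)
          (not_lt.2 (h2.trans ha))
    rcases Set.subset_singleton_iff_eq.1 hsub with h | h
    · rw [h]
      exact InS.empty n
    · rw [h]
      exact InS.singleton_zero n
  -- The vectors `(w i, 1)` and `(0, 1)` have height one for the last coordinate. At level `a` the
  -- set is the open simplex on all of them (`∑ t < a`) together with the face opposite the origin
  -- (`∑ t = a`).
  · have h1 := linearIndependent_extendFamily hw one_ne_zero 1
    have hτ : ∀ o, (LinearMap.proj (Fin.last n) : (Fin (n + 1) → ℤ) →ₗ[ℤ] ℤ)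
        (extendFamily w 1 1 o) = 1 := by
      rintro (_ | i) <;> simp [extendFamily]
    have h2 := InS.openSimplex a ha _ h1 ⟨_, hτ⟩
    have h3 := InS.openSimplex a ha _ (h1.comp _ (Option.some_injective κ))
      ⟨_, fun i => hτ (some i)⟩
    have hd : Disjoint (BoundedPolytopes.openSimplex (extendFamily w 1 1) (a : Γ))
        (BoundedPolytopes.openSimplex (extendFamily w 1 1 ∘ some) (a : Γ)) := by
      refine Set.disjoint_left.2 ?_
      rintro _ ⟨t, ht, -, rfl⟩ ⟨s, -, -, hs⟩
      have h4 := LinearIndependent.eq_zero_of_sum_smul_eq_zero h1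
        (fun o => o.elim (t none) fun i => t (some i) - s i) fun j => by
          have := congrFun hs j
          simp only [Fintype.sum_option, Function.comp_apply] at this
          simp only [Fintype.sum_option, Option.elim, smul_sub, Finset.sum_sub_distrib]
          rw [← this]
          abel
      exact (ht none).ne' (congrFun h4 none)
    rw [← InS.level_iff a]
    convert h2.union h3 hd using 1
    ext z
    constructor
    · rintro ⟨⟨t, h1, h2, h3⟩, h4⟩
      rcases h2.lt_or_eq with h | h
      · refine Or.inl ⟨fun o => o.elim (a - ∑ i, t i) t, ?_, ?_, ?_⟩
        · rintro (_ | i)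
          · exact sub_pos.2 h
          · exact h1 i
        · simp [Fintype.sum_option]
        · rw [← Fin.snoc_init_self z, h3, h4]
          funext j
          refine Fin.lastCases ?_ (fun j => ?_) j <;> simp [extendFamily, Fintype.sum_option]
      · refine Or.inr ⟨t, h1, h, ?_⟩
        rw [← Fin.snoc_init_self z, h3, h4]
        funext j
        refine Fin.lastCases ?_ (fun j => ?_) j <;> simp [extendFamily, h]
    · rintro (⟨t, h1, h2, rfl⟩ | ⟨t, h1, h2, rfl⟩)
      · rw [Fintype.sum_option] at h2
        refine ⟨⟨fun i => t (some i), fun i => h1 _, ?_, ?_⟩, ?_⟩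
        · rw [← h2]
          exact le_add_of_nonneg_left (h1 none).le
        · funext j
          simp [Fin.init, extendFamily, Fintype.sum_option]
        · simp [extendFamily, Fintype.sum_option, h2]
      · refine ⟨⟨t, h1, h2.le, ?_⟩, ?_⟩
        · funext j
          simp [Fin.init, extendFamily]
        · simp [extendFamily, h2]

/-- Rescaling the rays so that `c` takes the same value `N` on all of them makes the truncation a
condition on the sum of the coordinates. The piece is then a translated truncated simplex of size
`(M - c · v) / N`, an element of `A` by divisibility. -/
theorem InS.truncatedCone [Module ℚ A] {n : ℕ} {κ : Type} [Fintype κ] (v : Fin n → A)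
    {w : κ → Fin n → ℤ} (hw : LinearIndependent ℤ w) (c : Fin n → ℤ)
    (hc : ∀ i, 0 < ∑ j, c j * w i j) (M : A) :
    InS A (cone (fun j => (v j : Γ)) w ∩ {x | ∑ j, c j • x j ≤ (M : Γ)}) := by
  classical
  let ξ : κ → ℤ := fun i => ∑ j, c j * w i j
  let d : κ → ℤ := fun i => ∏ k ∈ Finset.univ.erase i, ξ k
  let N : ℤ := ∏ k, ξ k
  have hd : ∀ i, 0 < d i := fun i => Finset.prod_pos fun k _ => hc k
  have hN : 0 < N := Finset.prod_pos fun k _ => hc k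
  have hdN : ∀ i, ∑ j, c j * (d i * w i j) = N := fun i => by
    change _ = ∏ k, ξ k
    rw [← Finset.prod_erase_mul Finset.univ ξ (Finset.mem_univ i), Finset.mul_sum]
    exact Finset.sum_congr rfl fun j _ => by ring
  have hwd : LinearIndependent ℤ fun i => d i • w i := by
    rw [Fintype.linearIndependent_iff] at hw ⊢
    intro g hg i
    simp only [smul_smul] at hg
    exact (mul_eq_zero.1 (hw _ hg i)).resolve_right (hd i).ne'
  let a : A := (N : ℚ)⁻¹ • (M - ∑ j, c j • v j)
  have ha : N • (a : Γ) = M - ∑ j, c j • (v j : Γ) := by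
    have : N • a = M - ∑ j, c j • v j := by
      rw [← Int.cast_smul_eq_zsmul ℚ, smul_inv_smul₀ (by exact_mod_cast hN.ne')]
    have := congrArg (fun x : A => (x : Γ)) this
    simpa using this
  have hsum : ∀ t : κ → Γ, ∑ j, c j • ((v j : Γ) + ∑ i, (d i • w i) j • t i) =
      ∑ j, c j • (v j : Γ) + N • ∑ i, t i := by
    intro t
    simp only [smul_add, Finset.sum_add_distrib, Finset.smul_sum, smul_smul, Pi.smul_apply,
      smul_eq_mul]
    rw [Finset.sum_comm]
    simp only [← Finset.sum_smul, hdN]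
  have hle : ∀ t : κ → Γ, ∑ j, c j • ((v j : Γ) + ∑ i, (d i • w i) j • t i) ≤ M ↔
      ∑ i, t i ≤ a := by
    intro t
    rw [hsum, ← le_sub_iff_add_le', ← ha]
    exact smul_le_smul_iff_of_pos_left hN
  convert (InS.truncatedSimplex a hwd).translate v using 1
  rw [← cone_smul _ w d hd]
  ext x
  constructor
  · rintro ⟨⟨t, ht, rfl⟩, hx⟩
    exact ⟨t, ht, (hle t).1 hx, by funext j; simp⟩
  · rintro ⟨t, ht, ht', hx⟩
    have hx' : x = fun j => (v j : Γ) + ∑ i, (d i • w i) j • t i := by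
      funext j
      rw [← sub_eq_iff_eq_add']
      exact congrFun hx j
    exact ⟨⟨t, ht, hx'⟩, by rw [hx']; exact (hle t).2 ht'⟩

end Generation

/-! ### From relations between indicator functions to relations between classes -/

section Relations

variable {Γ : Type*} [AddCommGroup Γ] [LinearOrder Γ] [IsOrderedAddMonoid Γ]
variable {A : AddSubgroup Γ}

/-- The union of two objects. -/
def Obj.union {n : ℕ} (X Y : Obj A n) : Obj A n :=
  ⟨X.carrier ∪ Y.carrier, X.definable.union Y.definable, X.bounded.union Y.bounded⟩

/-- The intersection of two objects. -/
def Obj.inter {n : ℕ} (X Y : Obj A n) : Obj A n :=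
  ⟨X.carrier ∩ Y.carrier, X.definable.inter _ _ Y.definable, X.bounded.mono Set.inter_subset_left⟩

/-- The difference of two objects. -/
def Obj.sdiff {n : ℕ} (X Y : Obj A n) : Obj A n :=
  ⟨X.carrier \ Y.carrier, X.definable.diff Y.definable, X.bounded.mono Set.sdiff_subset⟩

theorem Kdf.cls_inter_add_cls_sdiff {n : ℕ} (X Y : Obj A n) :
    Kdf.cls X = Kdf.cls (X.inter Y) + Kdf.cls (X.sdiff Y) :=
  Kdf.cls_union (Set.inter_union_sdiff _ _).symm
    (Set.disjoint_left.2 fun _ h h' => h'.2 h.2)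

/-- A combination of indicator functions that is constant on `W` gives a relation between
classes. -/
theorem sum_cls_inter_eq {n : ℕ} (L : List (ℤ × Obj A n)) (W : Obj A n) (c : ℤ)
    (h : ∀ x ∈ W.carrier, (L.map fun p => p.1 * p.2.carrier.indicator 1 x).sum = c) :
    (L.map fun p => p.1 • Kdf.cls (p.2.inter W)).sum = c • Kdf.cls W := by
  induction L generalizing W c with
  | nil =>
    rcases Set.eq_empty_or_nonempty W.carrier with hW | ⟨x, hx⟩
    · rw [show W = Obj.empty A n from Obj.ext' hW, Kdf.cls_empty, smul_zero]
      rfl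
    · rw [← h x hx]
      simp
  | cons p L ih =>
    obtain ⟨m, T⟩ := p
    -- On `W ∩ T` and on `W \ T` the first summand is constant, so the remaining sum is constant on
    -- each part and induction applies.
    have h1 := ih (W.inter T) (c - m) fun x hx => by
      have := h x hx.1
      rw [List.map_cons, List.sum_cons, Set.indicator_of_mem hx.2] at this
      rw [← this]
      simp
    have h2 := ih (W.sdiff T) c fun x hx => by
      have := h x hx.1
      rw [List.map_cons, List.sum_cons, Set.indicator_of_notMem hx.2] at this
      rw [← this]
      simp
    have h3 : (L.map fun p => p.1 • Kdf.cls (p.2.inter W)).sum =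
        (L.map fun p => p.1 • Kdf.cls (p.2.inter (W.inter T))).sum +
          (L.map fun p => p.1 • Kdf.cls (p.2.inter (W.sdiff T))).sum := by
      rw [← List.sum_map_add]
      congr 1
      refine List.map_congr_left fun p _ => ?_
      rw [Kdf.cls_inter_add_cls_sdiff (p.2.inter W) T, smul_add]
      congr 3
      · exact Obj.ext' (Set.inter_assoc _ _ _)
      · exact Obj.ext' (Set.inter_sdiff_assoc _ _ _)
    rw [List.map_cons, List.sum_cons, h3, h1, h2, Kdf.cls_inter_add_cls_sdiff W T,
      show T.inter W = W.inter T from Obj.ext' (Set.inter_comm _ _), sub_smul, smul_add]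
    abel

/-- Moving `X` to the other side gives a combination that vanishes on an object containing all sets
involved. The resulting relation writes `[X]` as an integral combination of classes in the image. -/
theorem InS.of_indicator_mem {n : ℕ} (X : Obj A n)
    (h : X.carrier.indicator 1 ∈ AddSubgroup.closure {f : (Fin n → Γ) → ℤ |
      ∃ T : Obj A n, InS A T.carrier ∧ f = T.carrier.indicator 1}) : InS A X.carrier := by
  have key : ∀ f ∈ AddSubgroup.closure {f : (Fin n → Γ) → ℤ |
      ∃ T : Obj A n, InS A T.carrier ∧ f = T.carrier.indicator 1},
      ∃ L : List (ℤ × Obj A n), (∀ p ∈ L, InS A p.2.carrier) ∧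
        ∀ x, f x = (L.map fun p => p.1 * p.2.carrier.indicator 1 x).sum := by
    intro f hf
    induction hf using AddSubgroup.closure_induction with
    | mem f hf =>
      obtain ⟨T, hT, rfl⟩ := hf
      exact ⟨[(1, T)], by simpa using hT, fun x => by simp⟩
    | zero => exact ⟨[], by simp, fun x => by simp⟩
    | add f g _ _ hf hg =>
      obtain ⟨L, hL, hf⟩ := hf
      obtain ⟨L', hL', hg⟩ := hg
      refine ⟨L ++ L', fun p hp => ?_, fun x => by simp [hf, hg]⟩
      exact (List.mem_append.1 hp).elim (hL p) (hL' p)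
    | neg f _ hf =>
      obtain ⟨L, hL, hf⟩ := hf
      refine ⟨L.map fun p => (-p.1, p.2), fun p hp => ?_, fun x => ?_⟩
      · obtain ⟨q, hq, rfl⟩ := List.mem_map.1 hp
        exact hL q hq
      · rw [Pi.neg_apply, hf, List.map_map, ← neg_one_mul, ← List.sum_map_mul_left]
        congr 1
        refine List.map_congr_left fun p _ => ?_
        simp
  obtain ⟨L, hL, hLX⟩ := key _ h
  have hW : ∀ L : List (ℤ × Obj A n), ∃ W : Obj A n, X.carrier ⊆ W.carrier ∧
      ∀ p ∈ L, p.2.carrier ⊆ W.carrier := by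
    intro L
    induction L with
    | nil => exact ⟨X, subset_rfl, by simp⟩
    | cons p L ih =>
      obtain ⟨W, h1, h2⟩ := ih
      refine ⟨W.union p.2, h1.trans Set.subset_union_left, fun q hq => ?_⟩
      rcases List.mem_cons.1 hq with rfl | hq
      · exact Set.subset_union_right
      · exact (h2 q hq).trans Set.subset_union_left
  obtain ⟨W, hXW, hLW⟩ := hW L
  have h1 := sum_cls_inter_eq ((-1, X) :: L) W 0 fun x _ => by
    rw [List.map_cons, List.sum_cons, ← hLX x]
    simp
  rw [List.map_cons, List.sum_cons, zero_smul, neg_one_smul, neg_add_eq_zero,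
    show X.inter W = X from Obj.ext' (Set.inter_eq_left.2 hXW)] at h1
  refine ⟨X, rfl, ?_⟩
  rw [h1]
  clear h1 hLX h
  induction L with
  | nil => simp
  | cons p L ih =>
    rw [List.map_cons, List.sum_cons, TensorProduct.tmul_add]
    refine add_mem ?_ (ih (fun q hq => hL q (List.mem_cons_of_mem _ hq))
      fun q hq => hLW q (List.mem_cons_of_mem _ hq))
    rw [show p.2.inter W = p.2 from Obj.ext' (Set.inter_eq_left.2 (hLW p (List.mem_cons_self)))]
    rw [TensorProduct.tmul_smul]
    exact zsmul_mem ((hL p List.mem_cons_self).of_obj p.2 rfl) _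

/-- Multiplying a cone decomposition of the indicator function by the indicator of a half space `c ·
x ≤ M` that contains `X` does not change `X`, and it replaces every cone by a bounded piece with
class in the image. -/
theorem InS.of_divisible [Module ℚ Γ] [Module ℚ A] {n : ℕ} (X : Obj A n) : InS A X.carrier := by
  obtain ⟨α, hα⟩ := X.definable.exists_subset_box X.bounded
  have h1 := indicator_mem_coneSpan (-α) X.carrier X.definable fun x hx i => (hα hx i).1
  obtain ⟨S, hS, h2⟩ := exists_finset_mem_coneSpan h1
  obtain ⟨c, hc⟩ := exists_pos_functional S fun w hw => hS hw
  -- The largest value of `c` on the box of size `α`, which contains `X`.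
  let M : A := ∑ j, |c j| • α
  have hM : ∀ x ∈ X.carrier, ∑ j, c j • x j ≤ (M : Γ) := by
    intro x hx
    have : (M : Γ) = ∑ j, |c j| • (α : Γ) := by simp [M]
    rw [this]
    refine Finset.sum_le_sum fun j _ => (le_abs_self _).trans ?_
    rw [abs_zsmul]
    exact zsmul_le_zsmul_right (abs_nonneg _) (abs_le.2 (hα hx j))
  have key : ∀ f ∈ coneSpan A (S : Set (Fin n → ℤ)),
      f * {x : Fin n → Γ | ∑ j, c j • x j ≤ (M : Γ)}.indicator 1 ∈
        AddSubgroup.closure {f : (Fin n → Γ) → ℤ |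
          ∃ T : Obj A n, InS A T.carrier ∧ f = T.carrier.indicator 1} := by
    intro f hf
    induction hf using AddSubgroup.closure_induction with
    | mem f hf =>
      obtain ⟨κ, _, v, w, hw, hwS, rfl⟩ := hf
      have h3 := InS.truncatedCone v hw c (fun i => hc _ (hwS i)) M
      refine AddSubgroup.subset_closure ⟨⟨_, h3.isDefinable, h3.isBounded⟩, h3, ?_⟩
      exact Set.inter_indicator_one.symm
    | zero => rw [zero_mul]; exact zero_mem _
    | add f g _ _ hf hg => rw [add_mul]; exact add_mem hf hg
    | neg f _ hf => rw [neg_mul]; exact neg_mem hf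
  refine InS.of_indicator_mem X ?_
  have h3 := key _ h2
  have h4 : X.carrier ⊆ {x | ∑ j, c j • x j ≤ (M : Γ)} := hM
  rwa [← Set.inter_indicator_one, Set.inter_eq_left.2 h4] at h3

end Relations

end BoundedPolytopes

end

/-- Let `Γ` be a divisible ordered abelian group and `A` a subgroup of `Γ`. The natural homomorphism
`φ_A : T_A → K_ℚ^df` is injective, and it is an isomorphism if `A` is divisible. -/
theorem mainTheorem4 {Γ : Type*} [AddCommGroup Γ] [LinearOrder Γ] [IsOrderedAddMonoid Γ]
    (hΓ : ∀ n : ℕ, n ≠ 0 → ∀ x : Γ, ∃ y : Γ, n • y = x) (A : AddSubgroup Γ) :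
    Function.Injective (BoundedPolytopes.phi A) ∧
      ((∀ n : ℕ, n ≠ 0 → ∀ a : A, ∃ b : A, n • b = a) →
        Function.Bijective (BoundedPolytopes.phi A)) := by
  obtain ⟨_⟩ := BoundedPolytopes.exists_rat_module hΓ
  refine ⟨BoundedPolytopes.phi_injective A, fun hA => ⟨BoundedPolytopes.phi_injective A, ?_⟩⟩
  obtain ⟨_⟩ := BoundedPolytopes.exists_rat_module hA
  exact BoundedPolytopes.phi_surjective_of_inS fun _ X => BoundedPolytopes.InS.of_divisible X
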